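/- Let $I,J\ge 1$ be integers and let $q,\alpha\in\mathbb R$ satisfy either (1) $0<q<1$ and $\alpha<-q^{-I-J+1}$, or (2) $q>1$ and $-q^{-I-J+1}<\alpha<0$. **Vertex weights.** For $n\in\mathbb Z$ put $(b;q)_n=\prod_{k=0}^{n-1}(1-bq^k)$ if $n\ge 0$ and $(b;q)_n=\prod_{k=0}^{-n-1}(1-bq^{n+k})^{-1}$ if $n<0$. Let $${}_{r+1}\overline\phi_r\Big({q^{-n},a_1,\dots,a_r\atop b_1,\dots,b_r}\Big|q,z\Big)=\sum_{k=0}^n z^k\frac{(q^{-n};q)_k}{(q;q)_k}\prod_{i=1}^r(a_i;q)_k(b_iq^k;q)_{n-k}.$$ For $i_1,i_2\in\{0,\dots,I\}$ and $j_1,j_2\in\{0,\dots,J\}$ put, with $\nu=q^{-I}$, $$\mathsf L^{I,J}_\alpha(i_1,j_1;i_2,j_2)=\mathbf 1_{\{i_1+j_1=i_2+j_2\}}\,q^{\frac{2j_1-j_1^2}4-\frac{2j_2-j_2^2}4+\frac{i_2^2+i_1^2}4+\frac{i_2(j_2-1)+i_1j_1}2}\,\frac{\nu^{j_1-i_2}\alpha^{j_2-j_1+i_2}(-\alpha\nu^{-1};q)_{j_2-i_1}}{(q;q)_{i_2}(-\alpha;q)_{i_2+j_2}(q^{J+1-j_1};q)_{j_1-j_2}}\;{}_4\overline\phi_3\Big({q^{-i_2},q^{-i_1},-\alpha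 q^J,-q\nu\alpha^{-1}\atop \nu,q^{1+j_2-i_1},q^{J+1-i_2-j_2}}\Big|q,q\Big).$$ **SHS6V model.** This is the Markov process $(g_t)_{t\ge 0}$ on configurations in $\{0,\dots,I\}^{\mathbb Z}$ with finitely many particles ($g_t(x)$ is the number of particles at $x$) that is updated as follows. Given $g_t$ with no particle to the left of $a$, set $g_{t+1}(x)=0$ for $x<a$ and $h_t(a)=0$. Successively for $x=a,a+1,\dots$ sample $(g_{t+1}(x),h_t(x+1))\in\{0,\dots,I\}\times\{0,\dots,J\}$ from the probability distribution $\mathsf L^{I,J}_\alpha(g_t(x),h_t(x);\,\cdot\,,\,\cdot\,)$. **Unfused model.** Let $\beta(x,t)=(x\bmod I)+(t\bmod J)$, $b_1(x,t)=\mathsf L^{1,1}_{\alpha q^{\beta(x,t)}}(1,0;1,0)$ and $b_2(x,t)=\mathsf L^{1,1}_{\alpha q^{\beta(x,t)}}(0,1;0,1)$. Let $\chi_t(x),j_t(x)$ ($x\in\mathbb Z$, $t\in\mathbb Z_{\ge0}$) be independent random variables, independent of the initial configuration, with $$\mathbb P(\chi_t(x)=1)=b_1(x,t)=1-\mathbb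 P(\chi_t(x)=0),\qquad \mathbb P(j_t(x)=n)=(1-b_2(x+n,t))\prod_{k=1}^{n-1}b_2(x+k,t)\quad(n\ge1).$$ Given the positions $p_t(1)<\dots<p_t(m)$ of the (finitely many) particles at time $t$, and with $p_{t+1}(0)=-\infty$ and $p_t(m+1)=+\infty$, define successively for $i=1,\dots,m$: if $p_{t+1}(i-1)<p_t(i)$ and $\chi_t(p_t(i))=1$, then $p_{t+1}(i)=p_t(i)$; otherwise $p_{t+1}(i)=\min\big(p_t(i)+j_t(p_t(i)),\,p_t(i+1)\big)$. Let $\overline\eta_t\in\{0,1\}^{\mathbb Z}$ be the occupation configuration $\overline\eta_t(x)=\mathbf 1_{\{\exists i:\,p_t(i)=x\}}$. **Splitting and collapsing.** For $v\in\{0,\dots,n\}$ and $w=(w_1,\dots,w_n)\in\{0,1\}^n$ let $\Lambda_n(v;w)=Z_{v,n}^{-1}\mathbf 1_{\{w_1+\dots+w_n=v\}}q^{\sum_{r=1}^n(r-1)w_r}$, with $Z_{v,n}$ such that $\sum_w\Lambda_n(v;w)=1$, and let $\Lambda_n'(v;(w_1,\dots,w_n))=\Lambda_n(v;(w_n,\dots,w_1))$.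 For a probability measure $\mu$ on $\{0,\dots,n\}^{\mathbb Z}$ let $\boldsymbol\Lambda_n'\mu$ be the probability measure on $\{0,1\}^{\mathbb Z}$ such that for all integers $a<b$ and all $v_i\in\{0,1\}$ ($an\le i<bn$) $$\boldsymbol\Lambda'_n\mu\big(\eta(i)=v_i\ \text{for } an\le i<bn\big)=\sum_{u\in\{0,\dots,n\}^{[a,b-1]}}\mu\big(g(k)=u_k\ \text{for } a\le k<b\big)\prod_{k=a}^{b-1}\Lambda_n'\big(u_k;(v_{kn},\dots,v_{(k+1)n-1})\big).$$ For $\eta\in\{0,1\}^{\mathbb Z}$ let $\mathbf f_n(\eta)(k)=\sum_{i=kn}^{(k+1)n-1}\eta(i)$, $k\in\mathbb Z$. **Proposition (fusion).** Let $(g_t)_{t\ge0}$ be the SHS6V model started from a random configuration $g_0$ that has almost surely finitely many particles and law $\mu$, and let $(\overline\eta_t)_{t\ge0}$ be the unfused model with $\overline\eta_0\sim\boldsymbol\Lambda'_I\mu$. Then the processes have the same law: $$(g_t)_{t\ge0}\overset{d}{=}\big(\mathbf f_I(\overline\eta_{Jt})\big)_{t\ge0}.$$ -/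

import Mathlib

open MeasureTheory ProbabilityTheory

noncomputable section

/-- The `q`-Pochhammer symbol `(b; q)_n` for an integer `n`; for `n = -(m + 1)` it is
`∏_{k = 0}^{m} (1 - b q^{n + k})⁻¹`. -/
def qPoch (b q : ℝ) : ℤ → ℝ
  | Int.ofNat n => ∏ k ∈ Finset.range n, (1 - b * q ^ k)
  | Int.negSucc m => ∏ k ∈ Finset.range (m + 1), (1 - b * q ^ (Int.negSucc m + (k : ℤ)))⁻¹

/-- The regularized terminating basic hypergeometric series
`_{r+1}φ̄_r (q^{-n}, a_1, …, a_r; b_1, …, b_r | q, z)`. -/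
def regPhi {r : ℕ} (n : ℕ) (a b : Fin r → ℝ) (q z : ℝ) : ℝ :=
  ∑ k ∈ Finset.range (n + 1),
    z ^ k * (qPoch (q ^ (-(n : ℤ))) q k / qPoch q q k) *
      ∏ i, (qPoch (a i) q k * qPoch (b i * q ^ k) q ((n : ℤ) - k))

/-- The weight `L^{I,J}_α(i₁, j₁; i₂, j₂)` of a vertex with `i₁` lines at the bottom, `j₁` at the
left, `i₂` at the top and `j₂` at the right. It is used only for `i₁, i₂ ≤ I` and `j₁, j₂ ≤ J`. -/
def vertexWeight (q α : ℝ) (I J : ℕ) (i₁ j₁ i₂ j₂ : ℕ) : ℝ :=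
  let ν : ℝ := q ^ (-(I : ℤ))
  if i₁ + j₁ = i₂ + j₂ then
    q ^ ((2 * (j₁ : ℝ) - (j₁ : ℝ) ^ 2) / 4 - (2 * (j₂ : ℝ) - (j₂ : ℝ) ^ 2) / 4
        + ((i₂ : ℝ) ^ 2 + (i₁ : ℝ) ^ 2) / 4
        + ((i₂ : ℝ) * ((j₂ : ℝ) - 1) + (i₁ : ℝ) * (j₁ : ℝ)) / 2)
      * (ν ^ ((j₁ : ℤ) - i₂) * α ^ ((j₂ : ℤ) - j₁ + i₂) * qPoch (-α * ν⁻¹) q ((j₂ : ℤ) - i₁)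
        / (qPoch q q i₂ * qPoch (-α) q ((i₂ : ℤ) + j₂)
          * qPoch (q ^ ((J : ℤ) + 1 - j₁)) q ((j₁ : ℤ) - j₂)))
      * regPhi i₂ ![q ^ (-(i₁ : ℤ)), -α * q ^ J, -q * ν * α⁻¹]
          ![ν, q ^ (1 + (j₂ : ℤ) - i₁), q ^ ((J : ℤ) + 1 - i₂ - j₂)] q q
  else 0

/-- The parameter range in which the vertex weights are stochastic. -/
def StochasticRange (q α : ℝ) (I J : ℕ) : Prop :=
  (0 < q ∧ q < 1 ∧ α < -q ^ (-(I : ℤ) - J + 1)) ∨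
    (1 < q ∧ -q ^ (-(I : ℤ) - J + 1) < α ∧ α < 0)

/-- The probability that the sequential left-to-right update, entering the site `x` with `h`
horizontal lines, turns the values `c x, …, c (x + n - 1)` into `d x, …, d (x + n - 1)`.
By conservation of lines at most one `h'` contributes, namely `h' = c x + h - d x`. -/
def rowWeight (q α : ℝ) (I J : ℕ) (c d : ℤ → Fin (I + 1)) : ℕ → Fin (J + 1) → ℤ → ℝ
  | 0, _, _ => 1
  | n + 1, h, x => ∑ h' : Fin (J + 1),
      vertexWeight q α I J (c x) h (d x) h' * rowWeight q α I J c d n h' (x + 1)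

/-- `g` is a stochastic higher spin six vertex (SHS6V) model: it starts almost surely from
finitely many particles, and conditionally on `g 0, …, g t` with `g t` a finite configuration
without particles to the left of `a`, the configuration `g (t + 1)` vanishes to the left of `a`
and its values at `a, a + 1, …` are sampled one after the other, starting with `0` horizontal
lines at `a`. -/
structure IsSHS6V {Ω : Type*} [MeasurableSpace Ω] (P : Measure Ω) (q α : ℝ) (I J : ℕ)
    (g : ℕ → Ω → ℤ → Fin (I + 1)) : Prop where
  measurable : ∀ t, Measurable (g t)
  finite_zero : ∀ᵐ ω ∂P, {x | g 0 ω x ≠ 0}.Finite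
  update : ∀ (t : ℕ) (c : ℕ → ℤ → Fin (I + 1)) (d : ℤ → Fin (I + 1)) (a : ℤ) (n : ℕ),
    {x | c t x ≠ 0}.Finite → (∀ x < a, c t x = 0) → (∀ x < a, d x = 0) →
    P.real {ω | (∀ s ≤ t, g s ω = c s) ∧ ∀ x < a + n, g (t + 1) ω x = d x} =
      P.real {ω | ∀ s ≤ t, g s ω = c s} * rowWeight q α I J (c t) d n 0 a

/-- One step of the stochastic six vertex particle dynamics, from left to right, on the increasing
list of particle positions. The argument `prev` is the new position of the previous particle
(`⊥`, that is `-∞`, for the leftmost one). -/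
def s6vUpdate (χ j : ℤ → ℕ) : WithBot ℤ → List ℤ → List ℤ
  | _, [] => []
  | prev, [p] => [if prev < (p : WithBot ℤ) ∧ χ p = 1 then p else p + j p]
  | prev, p :: r :: ps =>
      let p' := if prev < (p : WithBot ℤ) ∧ χ p = 1 then p else min (p + j p) r
      p' :: s6vUpdate χ j (p' : WithBot ℤ) (r :: ps)

/-- The exponent `β(x, t) = (x mod I) + (t mod J)`. -/
def betaExp (I J : ℕ) (x : ℤ) (t : ℕ) : ℤ := x % (I : ℤ) + (t : ℤ) % (J : ℤ)

/-- `b₁(x, t) = L^{1,1}_{α q^{β(x,t)}}(1, 0; 1, 0)`. -/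
def b₁ (q α : ℝ) (I J : ℕ) (x : ℤ) (t : ℕ) : ℝ :=
  vertexWeight q (α * q ^ betaExp I J x t) 1 1 1 0 1 0

/-- `b₂(x, t) = L^{1,1}_{α q^{β(x,t)}}(0, 1; 0, 1)`. -/
def b₂ (q α : ℝ) (I J : ℕ) (x : ℤ) (t : ℕ) : ℝ :=
  vertexWeight q (α * q ^ betaExp I J x t) 1 1 0 1 0 1

/-- The occupation configuration of a list of particle positions. -/
def occupation (p : List ℤ) : ℤ → Fin 2 := fun x => if x ∈ p then 1 else 0

/-- `p` is the particle process of the unfused SHS6V model driven by the random variables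
`χ t x` and `j t x`: these are independent, independent of the initial configuration, have the
laws prescribed by `b₁` and `b₂`, and drive the update of the (finitely many, increasingly
ordered) particle positions. -/
structure IsUnfusedSHS6V {Ω : Type*} [MeasurableSpace Ω] (P : Measure Ω) (q α : ℝ) (I J : ℕ)
    (χ j : ℕ → ℤ → Ω → ℕ) (p : ℕ → Ω → List ℤ) : Prop where
  measurable_χ : ∀ t x, Measurable (χ t x)
  measurable_j : ∀ t x, Measurable (j t x)
  measurable_zero : Measurable fun ω => occupation (p 0 ω)
  sorted_zero : ∀ ω, (p 0 ω).Pairwise (· < ·)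
  indep : iIndepFun
    (Sum.elim (fun s : ℕ × ℤ => χ s.1 s.2) (fun s : ℕ × ℤ => j s.1 s.2)) P
  indep_zero : IndepFun (fun ω => occupation (p 0 ω))
    (fun ω => ((fun s : ℕ × ℤ => χ s.1 s.2 ω), (fun s : ℕ × ℤ => j s.1 s.2 ω))) P
  law_χ_one : ∀ t x, P.real {ω | χ t x ω = 1} = b₁ q α I J x t
  law_χ_zero : ∀ t x, P.real {ω | χ t x ω = 0} = 1 - b₁ q α I J x t
  law_j : ∀ t x (n : ℕ), 1 ≤ n → P.real {ω | j t x ω = n} =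
    (1 - b₂ q α I J (x + n) t) * ∏ k ∈ Finset.Ico 1 n, b₂ q α I J (x + k) t
  update : ∀ t ω, p (t + 1) ω =
    s6vUpdate (fun x => χ t x ω) (fun x => j t x ω) ⊥ (p t ω)

/-- The unnormalized weight `1{v₁ + ⋯ + vₙ = v} q^{∑ (r - 1) v_r}`. -/
def lambdaWeight (q : ℝ) (n v : ℕ) (w : Fin n → Fin 2) : ℝ :=
  if ∑ r, (w r : ℕ) = v then q ^ (∑ r : Fin n, (r : ℕ) * (w r : ℕ)) else 0

/-- The stochastic matrix `Λ_n(v; (v₁, …, vₙ))`. -/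
def lambdaMat (q : ℝ) (n v : ℕ) (w : Fin n → Fin 2) : ℝ :=
  (∑ u : Fin n → Fin 2, lambdaWeight q n v u)⁻¹ * lambdaWeight q n v w

/-- The reversed matrix `Λ'_n(v; (vₙ, …, v₁)) = Λ_n(v; (v₁, …, vₙ))`. -/
def lambdaMat' (q : ℝ) (n v : ℕ) (w : Fin n → Fin 2) : ℝ :=
  lambdaMat q n v (fun r => w r.rev)

/-- `ν = 𝚲'_n μ`: the probability measure on `{0,1}^ℤ` whose cylinder probabilities over blocks
of `n` sites are obtained from `μ` by splitting each value `u k` by the matrix `Λ'_n`. -/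
structure IsLambdaImage (q : ℝ) (n : ℕ) (μ : Measure (ℤ → Fin (n + 1)))
    (ν : Measure (ℤ → Fin 2)) : Prop where
  prob : IsProbabilityMeasure ν
  cylinder : ∀ (a b : ℤ), a < b → ∀ v : ℤ → Fin 2,
    ν.real {η | ∀ x ∈ Set.Ico (a * n) (b * n), η x = v x} =
      ∑ u : Finset.Ico a b → Fin (n + 1),
        μ.real {g | ∀ k : Finset.Ico a b, g k = u k} *
          ∏ k : Finset.Ico a b,
            lambdaMat' q n (u k) (fun r : Fin n => v ((k : ℤ) * n + (r : ℕ)))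

/-- The map `𝐟_n` that collapses every `n` neighbouring sites into one. -/
def collapse (n : ℕ) (η : ℤ → Fin 2) : ℤ → Fin (n + 1) := fun k =>
  ⟨∑ r : Fin n, (η (k * n + (r : ℕ)) : ℕ), Nat.lt_succ_of_le <| by
    calc ∑ r : Fin n, (η (k * n + (r : ℕ)) : ℕ) ≤ ∑ _r : Fin n, 1 :=
          Finset.sum_le_sum fun r _ => Nat.le_of_lt_succ (η (k * n + (r : ℕ))).isLt
      _ = n := by simp⟩

end

/-! The vertex weights satisfy two fusion relations. Vertically, a vertex carrying up to `J + 1`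
horizontal lines at parameter `α` is a one-line vertex at `α` below a `J`-line vertex at `αq`,
provided the incoming horizontal lines are split between the two rows by `Λ_{J+1}`; the outgoing
lines are then split in the same way (`fusedWeight_fusion`). On the level of the `₄φ̄₃` series this
is a pair of contiguous relations, one for each number of lines leaving the lower row:
`regPhi_contiguous_one` holds term by term, `regPhi_contiguous_zero` only after telescoping, and it
uses that the series is balanced. Horizontally, a one-line vertex with up to `I` vertical lines is a
row of `I` six-vertex vertices at `α, αq, αq², …`, provided the vertical lines are split by `Λ'_I`
(`sum_lambdaMat'_mul_transfer`).

Local relations of this kind can be pushed along a row. With no lines at the two ends, the first one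
says that the `J`-line row kernel is the composition of the one-line kernels at `α, αq, …, αq^{J-1}`
(`rowKernel_fusion`). The second one says that splitting the blocks by `Λ'_I` intertwines one step
of the unfused model with the one-line kernel (`rowKernel_intertwining`). Consequently, if the
unfused model starts from a `Λ'_I`-split configuration, then, even under constraints on the
collapsed path, its mass function stays of the form (mass of collapsed configurations) times `Λ'_I`
(`killedMass_intertwining`). The collapsed model observed at multiples of `J` is therefore Markov,
with the kernel of the SHS6V model.

On the probabilistic side, one step of the particle dynamics is rewritten as a row of six-vertex
weights (`stepProb_blockList`), and independence of the driving variables turns path probabilities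
into products (`IsUnfusedSHS6V.path_prob`). Particles are conserved and only move to the right, so a
path between two configurations in a finite window stays in it, and all sums are finite
(`IsUnfusedSHS6V.real_collapse_path`).

For the conclusion, the collapsed unfused model lives on countably many finite paths, and each such
path of positive probability has the same probability under the SHS6V model
(`IsSHS6V.real_path_eq`). Two probability measures, one of which is purely atomic and dominated by
the other on its atoms, coincide (`measure_eq_of_singleton_le`). Thus neither positivity nor
normalization of the fused weights has to be established. -/

/-! ### Contiguous relations for the regularized `₄φ̄₃` series. -/

/-- The finite product `∏_{k ≤ i < n} (1 - b q^i)`. -/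
noncomputable def qTail (b q : ℝ) (n k : ℕ) : ℝ := ∏ i ∈ Finset.Ico k n, (1 - b * q ^ i)

theorem qPoch_natCast (b q : ℝ) (n : ℕ) :
    qPoch b q (n : ℤ) = ∏ k ∈ Finset.range n, (1 - b * q ^ k) := rfl

theorem qPoch_zero (b q : ℝ) : qPoch b q 0 = 1 := by
  simpa using qPoch_natCast b q 0

theorem qPoch_natCast_succ (b q : ℝ) (n : ℕ) :
    qPoch b q ((n + 1 : ℕ) : ℤ) = qPoch b q (n : ℤ) * (1 - b * q ^ n) := by
  simp only [qPoch_natCast, Finset.prod_range_succ]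

theorem one_sub_mul_qPoch_shift (b q : ℝ) (n : ℕ) :
    (1 - b) * qPoch (q * b) q (n : ℤ) = qPoch b q (n : ℤ) * (1 - b * q ^ n) := by
  rw [← qPoch_natCast_succ, qPoch_natCast, qPoch_natCast, Finset.prod_range_succ', mul_comm]
  congr 1
  · exact Finset.prod_congr rfl fun i _ => by ring
  · simp

theorem qPoch_eq_qTail (b q : ℝ) {n k : ℕ} (h : k ≤ n) :
    qPoch (b * q ^ k) q ((n : ℤ) - k) = qTail b q n k := by
  rw [show (n : ℤ) - k = ((n - k : ℕ) : ℤ) by omega, qPoch_natCast, qTail,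
    Finset.prod_Ico_eq_prod_range]
  exact Finset.prod_congr rfl fun i _ => by ring

theorem qTail_succ_left (b q : ℝ) {n k : ℕ} (h : k < n) :
    qTail b q n k = (1 - b * q ^ k) * qTail b q n (k + 1) := by
  simp only [qTail]; rw [Finset.prod_eq_prod_Ico_succ_bot h]

theorem one_sub_mul_qTail_shift (b q : ℝ) {n k : ℕ} (h : k ≤ n) :
    (1 - b * q ^ k) * qTail (q * b) q n k = qTail b q n k * (1 - b * q ^ n) := by
  have h1 : qTail (q * b) q n k = qTail b q (n + 1) (k + 1) := by
    simp only [qTail]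
    rw [← Finset.prod_Ico_add' (fun i => 1 - b * q ^ i) k n 1]
    exact Finset.prod_congr rfl fun i _ => by ring
  rw [h1, ← qTail_succ_left b q (by omega : k < n + 1)]
  simp only [qTail]; rw [Finset.prod_Ico_succ_top h]

theorem qTail_self (b q : ℝ) (n : ℕ) : qTail b q n n = 1 := by simp [qTail]

/-- The `k`-th term of the regularized series `₄φ̄₃`. -/
noncomputable def phiTerm (n : ℕ) (q a b c d e f : ℝ) (k : ℕ) : ℝ :=
  q ^ k * (qPoch (q ^ (-(n : ℤ))) q k / qPoch q q k) *
    ((qPoch a q k * qTail d q n k) * (qPoch b q k * qTail e q n k) *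
      (qPoch c q k * qTail f q n k))

theorem regPhi_three (n : ℕ) (q a b c d e f : ℝ) :
    regPhi n ![a, b, c] ![d, e, f] q q = ∑ k ∈ Finset.range (n + 1), phiTerm n q a b c d e f k := by
  unfold regPhi phiTerm
  refine Finset.sum_congr rfl fun k hk => ?_
  have hk' : k ≤ n := by simpa [Nat.lt_succ_iff] using hk
  simp only [Fin.prod_univ_three, Matrix.cons_val_zero, Matrix.cons_val_one, Matrix.cons_val,
    qPoch_eq_qTail _ _ hk']

/-- The relation holds for each summand separately. Shifting a parameter by `q` changes the `k`-th
term by a factor linear in `q ^ k`, so after removal of the common factors only a polynomial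
identity in `x = q ^ k` is left. The tails of the lower parameters are never inverted, since they
may vanish. -/
theorem regPhi_contiguous_one (n : ℕ) (q A y z N B C : ℝ) (hA : A ≠ 0) (hz : z ≠ 0) (hz1 : z ≠ 1) :
    (1 - B / z) * (1 - 1 / A) * regPhi n ![q * A, y, z] ![N, q * B, C] q q
      + (1 / A - 1 / z) * ((1 - B * q ^ n) * regPhi n ![A, y, z] ![N, B, C] q q)
      = (1 - 1 / z) * (1 - B / A) * regPhi n ![A, y, q * z] ![N, q * B, C] q q := by
  have hz1' : 1 - z ≠ 0 := sub_ne_zero.2 (Ne.symm hz1)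
  simp only [regPhi_three, Finset.mul_sum, ← Finset.sum_add_distrib]
  refine Finset.sum_congr rfl fun k hk => ?_
  have hk' : k ≤ n := by simpa [Nat.lt_succ_iff] using hk
  unfold phiTerm
  have e1 := one_sub_mul_qPoch_shift A q k
  have e2 := one_sub_mul_qPoch_shift z q k
  have e3 := one_sub_mul_qTail_shift B q hk'
  generalize qPoch (q * A) q k = a1 at *
  generalize qPoch A q k = a0 at *
  generalize qPoch (q * z) q k = z1 at *
  generalize qPoch z q k = z0 at *
  generalize qTail (q * B) q n k = b1 at *
  generalize qTail B q n k = b0 at *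
  generalize qPoch (q ^ (-(n : ℤ))) q k / qPoch q q k = r at *
  generalize qPoch y q k = y0 at *
  generalize qTail N q n k = n0 at *
  generalize qTail C q n k = c0 at *
  generalize q ^ k = x at *
  generalize q ^ n = w at *
  have e2' : z1 = z0 * (1 - z * x) / (1 - z) := by field_simp; linarith
  subst e2'
  have key : (1 - B / z) * (1 - 1 / A) * a1 * b1 + (1 / A - 1 / z) * ((1 - B * w) * (a0 * b0))
      = (1 - 1 / z) * (1 - B / A) * (a0 * ((1 - z * x) / (1 - z)) * b1) := by
    rw [show (1 - B / z) * (1 - 1 / A) * a1 * b1 = -(1 - B / z) * (1 / A) * ((1 - A) * a1) * b1 by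
      field_simp; ring, e1, show (1 - B * w) * (a0 * b0) = a0 * (b0 * (1 - B * w)) by ring, ← e3]
    field_simp
    ring
  linear_combination x * r * n0 * y0 * z0 * c0 * key

/-- Here the summands do not match, but their difference telescopes. With `b` the summand with
parameters `A/q, y, z; N, qB, qC`, the defect of the `k`-th term is a constant times `H k - G k`,
where `G` collects the denominator factors and `H` the numerator factors of the term ratio of `b`,
so that `H k = G (k + 1)`. -/
theorem regPhi_contiguous_zero (n : ℕ) (q A y z N B C : ℝ) (hq : q ≠ 0)
    (hq1 : ∀ k : ℕ, k ≠ 0 → q ^ k ≠ 1) (hA : A ≠ 0) (hAq : A ≠ q) (hz : z ≠ 0) (hz1 : z ≠ 1)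
    (hC : C ≠ 0) (hCn : C * q ^ n ≠ 1) 
    (hbal : A * y * z = N * B * C * q ^ n) :
    (1 - 1 / z) * (1 - y / C) * regPhi n ![A, y, q * z] ![N, q * B, q * C] q q
      = q ^ n * (1 - B / z) * (1 - N / (z * A)) * regPhi n ![A, y, z] ![N, q * B, C] q q
        - q ^ n / z * (1 - N / A) *
          ((1 - B * q ^ n) * regPhi n ![A / q, y, z] ![N, B, C] q q) := by
  have hz1' : 1 - z ≠ 0 := sub_ne_zero.2 (Ne.symm hz1)
  have hA1' : 1 - A / q ≠ 0 := by
    rw [sub_ne_zero]; intro h; apply hAq; field_simp at h; exact h.symm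
  have hCn' : 1 - C * q ^ n ≠ 0 := sub_ne_zero.2 (Ne.symm hCn)
  set b : ℕ → ℝ := fun k => q ^ k * (qPoch (q ^ (-(n : ℤ))) q k / qPoch q q k) *
    ((qPoch (A / q) q k * qTail N q n k) * (qPoch y q k * qTail (q * B) q n k) *
      (qPoch z q k * qTail (q * C) q n k)) with hb
  set G : ℕ → ℝ := fun k => (1 - q ^ k) * (1 - N * q ^ k / q) * (1 - B * q ^ k) * (1 - C * q ^ k)
    * b k / q ^ k with hG
  set H : ℕ → ℝ := fun k => (1 - q ^ k / q ^ n) * (1 - A / q * q ^ k) * (1 - y * q ^ k) *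
    (1 - z * q ^ k) * b k / q ^ k with hH
  have hqk : ∀ k, q ^ k ≠ 0 := fun k => pow_ne_zero k hq
  have hGH : ∀ k < n, H k = G (k + 1) := by
    intro k hk
    have e1 := qPoch_natCast_succ (q ^ (-(n : ℤ))) q k
    have e2 := qPoch_natCast_succ q q k
    have e3 := qPoch_natCast_succ (A / q) q k
    have e4 := qPoch_natCast_succ y q k
    have e5 := qPoch_natCast_succ z q k
    have e6 := qTail_succ_left N q hk
    have e7 := qTail_succ_left (q * B) q hk
    have e8 := qTail_succ_left (q * C) q hk
    have hd : qPoch q q k ≠ 0 := by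
      rw [qPoch_natCast, Finset.prod_ne_zero_iff]
      intro i _
      have := hq1 (i + 1) (by omega)
      rw [sub_ne_zero]; intro h; apply this; rw [pow_succ']; exact h.symm
    have hd' : 1 - q * q ^ k ≠ 0 := by
      have := hq1 (k + 1) (by omega)
      rw [sub_ne_zero]; intro h; apply this; rw [pow_succ']; exact h.symm
    have hx : q ^ (-(n : ℤ)) = 1 / q ^ n := by simp
    have hk0 := hqk k
    have hn0 := hqk n
    simp only [hG, hH, hb, e1, e2, e3, e4, e5, e6, e7, e8]
    generalize qPoch (q ^ (-(n : ℤ))) q k = r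
    rw [hx, pow_succ]
    clear hbal e1 e2 e3 e4 e5 e6 e7 e8 hCn hCn' hq1 hx hqk hG hH hb
    generalize qPoch q q k = d at *
    generalize qPoch (A / q) q k = a0
    generalize qPoch z q k = z0
    generalize qPoch y q k = y0
    generalize qTail (q * B) q n (k + 1) = b1
    generalize qTail (q * C) q n (k + 1) = c1
    generalize qTail N q n (k + 1) = n0
    generalize q ^ k = x at *
    generalize q ^ n = w at *
    have e : r * (1 - 1 / w * x) / (d * (1 - q * x)) = (r / d) * ((1 - 1 / w * x) / (1 - q * x)) := by
      field_simp
    rw [e]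
    generalize r / d = r'
    rw [show N * (x * q) / q = N * x by field_simp, show (1 - x * q) = 1 - q * x by ring,
      show ((1 - 1 / w * x) / (1 - q * x)) = (1 - x / w) * (1 - q * x)⁻¹ by ring]
    generalize 1 - q * x = v at *
    generalize 1 - x / w = u at *
    rw [div_eq_div_iff hk0 (mul_ne_zero hk0 hq)]
    have hv := mul_inv_cancel₀ hd'
    generalize v⁻¹ = v' at *
    linear_combination (-(u * x * r' * (1 - N * x) * (1 - A / q * x) * (1 - y * x) * (1 - z * x) * q * a0 * y0 * z0 * n0 * b1 * c1 * x * (1 - q * B * x) * (1 - q * C * x))) * hv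
  have hterm : ∀ k ≤ n, (1 - 1 / z) * (1 - y / C) * phiTerm n q A y (q * z) N (q * B) (q * C) k
      - (q ^ n * (1 - B / z) * (1 - N / (z * A)) * phiTerm n q A y z N (q * B) C k
        - q ^ n / z * (1 - N / A) * ((1 - B * q ^ n) * phiTerm n q (A / q) y z N B C k))
      = q ^ n / (z * (1 - A / q) * (1 - C * q ^ n)) * (H k - G k) := by
    intro k hk
    have e1 := one_sub_mul_qPoch_shift (A / q) q k
    rw [show q * (A / q) = A by field_simp] at e1
    have e2 := one_sub_mul_qPoch_shift z q k
    have e3 := one_sub_mul_qTail_shift B q hk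
    have e4 := one_sub_mul_qTail_shift C q hk
    simp only [hG, hH, hb]
    unfold phiTerm
    have := hqk k
    have := hqk n
    generalize qPoch (A / q) q k = a0 at *
    generalize qPoch A q k = a1 at *
    generalize qPoch (q * z) q k = z1 at *
    generalize qPoch z q k = z0 at *
    generalize qTail (q * B) q n k = b1 at *
    generalize qTail B q n k = b0 at *
    generalize qTail (q * C) q n k = c1 at *
    generalize qTail C q n k = c0 at *
    generalize qPoch (q ^ (-(n : ℤ))) q k / qPoch q q k = r at *
    generalize qPoch y q k = y0 at *
    generalize qTail N q n k = n0 at *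
    generalize q ^ k = x at *
    generalize q ^ n = w at *
    have e2' : z1 = z0 * (1 - z * x) / (1 - z) := by field_simp; linarith
    have e1' : a1 = a0 * (1 - A / q * x) / (1 - A / q) := by
      rw [eq_div_iff hA1']; linarith
    have e4' : c0 = (1 - C * x) * c1 / (1 - C * w) := by rw [eq_div_iff hCn']; linarith
    -- The factor `1 - B q^n` stays attached to its tail instead of being divided out: in the
    -- application it equals `1 - q^{j₁}`, which vanishes for `j₁ = 0`.
    have e5 : (1 - B * w) * b0 = (1 - B * x) * b1 := by linarith
    -- The balancing condition enters only here, to eliminate `y`.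
    have hy : y = N * B * C * w / (A * z) := by field_simp; linarith
    rw [show ∀ u v : ℝ, (1 - B * w) * (u * (v * (y0 * b0) * (z0 * c0))) =
      u * (v * (y0 * ((1 - B * w) * b0)) * (z0 * c0)) by intros; ring, e5]
    have key : (1 - 1 / z) * (1 - y / C) * (((1 - A / q * x) / (1 - A / q)) * ((1 - z * x) / (1 - z)))
      - (w * (1 - B / z) * (1 - N / (z * A)) * (((1 - A / q * x) / (1 - A / q)) *
        ((1 - C * x) / (1 - C * w)))
        - w / z * (1 - N / A) * ((1 - B * x) * ((1 - C * x) / (1 - C * w))))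
      = w / (z * (1 - A / q) * (1 - C * w)) * (((1 - x / w) * (1 - A / q * x) * (1 - y * x) *
    (1 - z * x) - (1 - x) * (1 - N * x / q) * (1 - B * x) * (1 - C * x)) / x) := by
      rw [hy]
      have hA2 : q - A ≠ 0 := sub_ne_zero.2 (Ne.symm hAq)
      rw [show 1 - A / q = (q - A) / q by field_simp]
      field_simp
      ring
    rw [e1', e2', e4']
    linear_combination (r * n0 * y0 * z0 * b1 * c1 * a0 * x) * key
  have hsum : ∑ k ∈ Finset.range (n + 1), (H k - G k) = 0 := by
    rw [Finset.sum_sub_distrib, Finset.sum_range_succ, Finset.sum_range_succ']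
    -- The boundary terms vanish through the factors `1 - q^0` and `1 - q^n / q^n`.
    have h0 : G 0 = 0 := by simp [hG]
    have h1 : H n = 0 := by simp [hH, hqk]
    rw [h0, h1, Finset.sum_congr rfl fun k hk => hGH k (Finset.mem_range.1 hk)]
    ring
  rw [← sub_eq_zero]
  simp only [regPhi_three, Finset.mul_sum, ← Finset.sum_sub_distrib]
  rw [Finset.sum_congr rfl fun k hk => hterm k (by simpa [Nat.lt_succ_iff] using hk),
    ← Finset.mul_sum, hsum, mul_zero]

/-! ### Integer-index `q`-Pochhammer symbols and the normal form of the vertex weight. -/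

/-- For negative `n` the symbol is a product of inverses, and the recursion cancels one of them; the
hypothesis excludes the value `0⁻¹ = 0`. This version removes the last factor, `qPoch_add_one'` the
first one. -/
theorem qPoch_add_one {b q : ℝ} (n : ℤ) (h : n < 0 → 1 - b * q ^ n ≠ 0) :
    qPoch b q (n + 1) = qPoch b q n * (1 - b * q ^ n) := by
  obtain ⟨m, rfl | rfl⟩ := n.eq_nat_or_neg
  · simpa using qPoch_natCast_succ b q m
  · cases m with
    | zero => simpa using qPoch_natCast_succ b q 0
    | succ m =>
      have h' := h (by omega)
      rw [show (-((m + 1 : ℕ) : ℤ)) = Int.negSucc m from rfl] at *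
      cases m with
      | zero =>
        simp only [show Int.negSucc 0 + 1 = 0 by rfl, qPoch_zero]
        simp only [qPoch]
        simp at h' ⊢
        rw [inv_mul_cancel₀ h']
      | succ m =>
        rw [show Int.negSucc (m + 1) + 1 = Int.negSucc m by rfl]
        simp only [qPoch]
        rw [Finset.prod_range_succ' _ (m + 1)]
        simp only [Nat.cast_zero, add_zero]
        rw [mul_assoc, inv_mul_cancel₀ h', mul_one]
        refine Finset.prod_congr rfl fun k _ => ?_
        congr 4
        simp only [Int.negSucc_eq]; push_cast; ring

theorem qPoch_add_one' {b q : ℝ} (hq : q ≠ 0) (n : ℤ) (h : n < 0 → 1 - b ≠ 0) :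
    qPoch b q (n + 1) = (1 - b) * qPoch (b * q) q n := by
  obtain ⟨m, rfl | rfl⟩ := n.eq_nat_or_neg
  · have := one_sub_mul_qPoch_shift b q m
    rw [mul_comm b q, this, ← qPoch_natCast_succ]; simp
  · cases m with
    | zero => simpa [qPoch_zero] using qPoch_natCast_succ b q 0
    | succ m =>
      have h' := h (by omega)
      rw [show (-((m + 1 : ℕ) : ℤ)) = Int.negSucc m from rfl] at *
      cases m with
      | zero =>
        simp only [show Int.negSucc 0 + 1 = 0 by rfl, qPoch_zero]
        simp only [qPoch]
        simp [mul_assoc, hq, h']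
      | succ m =>
        rw [show Int.negSucc (m + 1) + 1 = Int.negSucc m by rfl]
        simp only [qPoch]
        rw [Finset.prod_range_succ _ (m + 1)]
        have e : (1 - b * q * q ^ (Int.negSucc (m + 1) + ((m + 1 : ℕ) : ℤ))) = 1 - b := by
          rw [show Int.negSucc (m + 1) + ((m + 1 : ℕ) : ℤ) = -1 by
            simp only [Int.negSucc_eq]; push_cast; ring]
          simp [mul_assoc, hq]
        rw [e, mul_comm, mul_assoc, inv_mul_cancel₀ h', mul_one]
        refine Finset.prod_congr rfl fun k _ => ?_
        rw [mul_assoc b q, ← zpow_one_add₀ hq]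
        congr 4
        simp only [Int.negSucc_eq]; push_cast; ring

/-- The factor of the vertex weight in front of the hypergeometric series. -/
noncomputable def vertexPref (q α : ℝ) (I J : ℕ) (i₁ j₁ i₂ j₂ : ℕ) : ℝ :=
  q ^ (((i₁ + j₁).choose 2 : ℤ) - (j₁.choose 2 : ℤ)) *
    ((q ^ I) ^ ((i₂ : ℤ) - j₁) * α ^ ((j₂ : ℤ) - j₁ + i₂) * qPoch (-α * q ^ I) q ((j₂ : ℤ) - i₁)
        / (qPoch q q i₂ * qPoch (-α) q ((i₂ + j₂ : ℕ) : ℤ)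
          * qPoch (q ^ ((J : ℤ) + 1 - j₁)) q ((j₁ : ℤ) - j₂)))

/-- The hypergeometric series in the vertex weight. -/
noncomputable def vertexPhi (q α : ℝ) (I J : ℕ) (i₁ i₂ j₂ : ℕ) : ℝ :=
  regPhi i₂ ![q ^ (-(i₁ : ℤ)), -α * q ^ J, -q * q ^ (-(I : ℤ)) * α⁻¹]
          ![q ^ (-(I : ℤ)), q ^ (1 + (j₂ : ℤ) - i₁), q ^ ((J : ℤ) + 1 - i₂ - j₂)] q q

theorem vertexWeight_of_ne (q α : ℝ) (I J : ℕ) {i₁ j₁ i₂ j₂ : ℕ} (h : i₁ + j₁ ≠ i₂ + j₂) :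
    vertexWeight q α I J i₁ j₁ i₂ j₂ = 0 := by
  simp [vertexWeight, h]

/-- Line conservation makes the quarter-integral exponent collapse to a difference of binomial
coefficients, so real powers can be replaced by integer powers. -/
theorem vertexWeight_eq (q α : ℝ) (I J : ℕ) {i₁ j₁ i₂ j₂ : ℕ}
    (h : i₁ + j₁ = i₂ + j₂) :
    vertexWeight q α I J i₁ j₁ i₂ j₂ =
      vertexPref q α I J i₁ j₁ i₂ j₂ * vertexPhi q α I J i₁ i₂ j₂ := by
  unfold vertexWeight vertexPref vertexPhi
  simp only [h, if_true]
  have h' : (i₁ : ℝ) = i₂ + j₂ - j₁ := by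
    have : (i₁ : ℝ) + j₁ = i₂ + j₂ := by exact_mod_cast h
    linarith
  congr 2
  · rw [← Real.rpow_intCast]
    congr 1
    push_cast
    rw [Nat.cast_choose_two, Nat.cast_choose_two, h']
    push_cast
    ring
  · congr 1
    · congr 1
      · congr 1
        rw [zpow_neg, zpow_natCast, inv_zpow', neg_sub]
      · rw [zpow_neg, zpow_natCast, inv_inv]

/-- Non-degeneracy of the parameters of a vertex with at most `n` lines. -/
structure Nondegenerate (q α : ℝ) (n : ℕ) : Prop where
  q_pos : 0 < q
  q_ne_one : q ≠ 1
  α_ne_zero : α ≠ 0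
  one_add_ne : ∀ m : ℕ, m < n → 1 + α * q ^ m ≠ 0

theorem Nondegenerate.shift {q α : ℝ} {n : ℕ} (h : Nondegenerate q α (n + 1)) :
    Nondegenerate q (α * q) n where
  q_pos := h.q_pos
  q_ne_one := h.q_ne_one
  α_ne_zero := mul_ne_zero h.α_ne_zero h.q_pos.ne'
  one_add_ne m hm := by
    have := h.one_add_ne (m + 1) (by omega)
    rwa [pow_succ', ← mul_assoc] at this

theorem Nondegenerate.mono {q α : ℝ} {n m : ℕ} (h : Nondegenerate q α n) (hm : m ≤ n) :
    Nondegenerate q α m where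
  q_pos := h.q_pos
  q_ne_one := h.q_ne_one
  α_ne_zero := h.α_ne_zero
  one_add_ne k hk := h.one_add_ne k (by omega)

theorem Nondegenerate.zpow_ne_one {q α : ℝ} {n : ℕ} (h : Nondegenerate q α n) {k : ℤ}
    (hk : k ≠ 0) : q ^ k ≠ 1 := by
  intro h1
  rcases zpow_eq_one_iff_of_ne_zero₀ hk |>.1 h1 with h2 | ⟨h2, _⟩
  · exact h.q_ne_one h2
  · have := h.q_pos; linarith

theorem Nondegenerate.one_add_zpow_ne {q α : ℝ} {n : ℕ} (h : Nondegenerate q α n) {k : ℤ}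
    (hk : 0 ≤ k) (hk' : k < n) : 1 + α * q ^ k ≠ 0 := by
  lift k to ℕ using hk
  exact_mod_cast h.one_add_ne k (by exact_mod_cast hk')

/-! ### Comparison of the prefactors for `(αq, J)` and `(α, J + 1)`. -/

section Prefactor

variable {q α : ℝ} {I J : ℕ}

theorem Nondegenerate.qPoch_shift_top (h : Nondegenerate q α (I + J + 1)) {m : ℤ}
    (hm : -(I : ℤ) ≤ m) :
    (1 + α * q ^ I) * qPoch (-(α * q) * q ^ I) q m
      = qPoch (-α * q ^ I) q m * (1 + α * q ^ I * q ^ m) := by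
  have h1 := qPoch_add_one' (b := -α * q ^ I) h.q_pos.ne' m (fun _ => by
    have := h.one_add_ne I (by omega)
    simpa using this)
  have h2 := qPoch_add_one (b := -α * q ^ I) (q := q) m (fun hm' => by
    have := h.one_add_zpow_ne (k := I + m) (by omega) (by push_cast; omega)
    rw [zpow_add₀ h.q_pos.ne', zpow_natCast] at this
    convert this using 1; ring)
  rw [h1] at h2
  rw [show -(α * q) * q ^ I = -α * q ^ I * q by ring]
  linear_combination h2

theorem Nondegenerate.qPoch_shift_top' (h : Nondegenerate q α (I + J + 1)) (m : ℤ) :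
    (1 + α * q ^ I) * qPoch (-(α * q) * q ^ I) q m = qPoch (-α * q ^ I) q (m + 1) := by
  have h1 := qPoch_add_one' (b := -α * q ^ I) h.q_pos.ne' m (fun _ => by
    have := h.one_add_ne I (by omega)
    simpa using this)
  rw [h1, show -(α * q) * q ^ I = -α * q ^ I * q by ring]
  ring

theorem Nondegenerate.qPoch_neg_ne_zero (h : Nondegenerate q α (I + J + 1)) {s : ℕ}
    (hs : s ≤ I + J + 1) : qPoch (-α) q (s : ℤ) ≠ 0 := by
  rw [qPoch_natCast, Finset.prod_ne_zero_iff]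
  intro i hi
  have := h.one_add_ne i (by have := Finset.mem_range.1 hi; omega)
  convert this using 1; ring

theorem Nondegenerate.qPoch_self_ne_zero {n : ℕ} (h : Nondegenerate q α n) (k : ℕ) :
    qPoch q q (k : ℤ) ≠ 0 := by
  rw [qPoch_natCast, Finset.prod_ne_zero_iff]
  intro i _
  have := h.zpow_ne_one (k := (i + 1 : ℕ)) (by omega)
  rw [zpow_natCast, pow_succ'] at this
  rw [sub_ne_zero]; exact this.symm

theorem Nondegenerate.one_sub_zpow_ne {n : ℕ} (h : Nondegenerate q α n) {k : ℤ}
    (hk : k ≠ 0) : 1 - q ^ k ≠ 0 := sub_ne_zero.2 (h.zpow_ne_one hk).symm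

theorem qPoch_zpow_ne_zero {n : ℕ} (h : Nondegenerate q α n) {a m : ℤ} (ha : 0 < a)
    (ham : 0 < a + m) : qPoch (q ^ a) q m ≠ 0 := by
  cases m with
  | ofNat m =>
    simp only [qPoch]
    rw [Finset.prod_ne_zero_iff]
    intro i _
    rw [← zpow_natCast, ← zpow_add₀ h.q_pos.ne']
    exact h.one_sub_zpow_ne (by omega)
  | negSucc m =>
    simp only [qPoch]
    rw [Finset.prod_ne_zero_iff]
    intro i _
    rw [← zpow_add₀ h.q_pos.ne']
    exact inv_ne_zero (h.one_sub_zpow_ne (by omega))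

theorem qPoch_shift_neg (q α : ℝ) (s : ℕ) :
    (1 + α) * qPoch (-(α * q)) q (s : ℤ) = qPoch (-α) q (s : ℤ) * (1 + α * q ^ s) := by
  have := one_sub_mul_qPoch_shift (-α) q s
  rw [show q * -α = -(α * q) by ring] at this
  linear_combination this

theorem qPoch_shift_neg' (q α : ℝ) (s : ℕ) :
    (1 + α) * qPoch (-(α * q)) q (s : ℤ) = qPoch (-α) q ((s + 1 : ℕ) : ℤ) := by
  rw [qPoch_shift_neg, qPoch_natCast_succ]; ring

theorem choose_two_succ (j : ℕ) : (((j + 1).choose 2 : ℕ) : ℤ) = j.choose 2 + j := by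
  rw [Nat.choose_succ_succ' j 1]; simp; ring

/-- In the four comparisons the two words of the name give the number of lines entering and leaving
the lower one-line row. They fix how `i₁`, `j₁`, `j₂` change when that row is removed. The
correction factors are those by which the contiguous relations must be multiplied to become
relations between weights. -/
theorem vertexPref_zero_zero (h : Nondegenerate q α (I + J + 1)) {i₁ j₁ i₂ j₂ : ℕ}
    (hs : i₁ + j₁ = i₂ + j₂) (hi₁ : i₁ ≤ I) (hj₁ : j₁ ≤ J) (hj₂ : j₂ ≤ J) :
    (1 - q ^ ((J : ℤ) + 1 - j₁)) * vertexPref q (α * q) I J i₁ j₁ i₂ j₂ *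
        ((1 + α * q ^ I) * (1 + α * q ^ (i₂ + j₂)))
      = vertexPref q α I (J + 1) i₁ j₁ i₂ j₂ * (q ^ i₁ * (1 + α * q ^ I * q ^ ((j₂ : ℤ) - i₁)) *
          (1 + α) * (1 - q ^ ((J : ℤ) + 1 - j₂))) := by
  have hq := h.q_pos.ne'
  have hα0 := h.one_add_ne 0 (by omega)
  rw [pow_zero, mul_one] at hα0
  have e1 := h.qPoch_shift_top (m := (j₂ : ℤ) - i₁) (by omega)
  have e2 := qPoch_shift_neg q α (i₂ + j₂)
  have e3 := qPoch_add_one' (b := q ^ ((J : ℤ) + 1 - j₁)) hq ((j₁ : ℤ) - j₂)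
    (fun _ => h.one_sub_zpow_ne (by omega))
  have e4 := qPoch_add_one (b := q ^ ((J : ℤ) + 1 - j₁)) (q := q) ((j₁ : ℤ) - j₂) (fun _ => by
    rw [← zpow_add₀ hq]; exact h.one_sub_zpow_ne (by omega))
  rw [e3, ← zpow_add₀ hq, ← zpow_add_one₀ hq,
    show (J : ℤ) + 1 - j₁ + (j₁ - j₂) = (J : ℤ) + 1 - j₂ by ring,
    show (J : ℤ) + 1 - j₁ + 1 = ((J + 1 : ℕ) : ℤ) + 1 - j₁ by push_cast; ring] at e4
  have n1 := h.one_sub_zpow_ne (k := (J : ℤ) + 1 - j₁) (by omega)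
  have n2 := h.one_sub_zpow_ne (k := (J : ℤ) + 1 - j₂) (by omega)
  have n3 := qPoch_zpow_ne_zero h (a := (J : ℤ) + 1 - j₁) (m := (j₁ : ℤ) - j₂) (by omega) (by omega)
  have n4 := qPoch_zpow_ne_zero h (a := ((J + 1 : ℕ) : ℤ) + 1 - j₁) (m := (j₁ : ℤ) - j₂)
    (by push_cast; omega) (by push_cast; omega)
  have n5 := h.qPoch_self_ne_zero i₂
  have n6 := h.qPoch_neg_ne_zero (s := i₂ + j₂) (by omega)
  have n7 : qPoch (-(α * q)) q ((i₂ + j₂ : ℕ) : ℤ) ≠ 0 := by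
    intro h0
    rw [h0, mul_zero] at e2
    rcases mul_eq_zero.1 e2.symm with h1 | h1
    · exact n6 h1
    · exact h.one_add_ne (i₂ + j₂) (by omega) h1
  unfold vertexPref
  rw [mul_zpow, show ((j₂ : ℤ) - j₁ + i₂) = i₁ by omega, zpow_natCast, zpow_natCast]
  generalize qPoch (-(α * q) * q ^ I) q ((j₂ : ℤ) - i₁) = a1 at *
  generalize qPoch (-α * q ^ I) q ((j₂ : ℤ) - i₁) = a0 at *
  generalize qPoch (-(α * q)) q ((i₂ + j₂ : ℕ) : ℤ) = b1 at *
  generalize qPoch (-α) q ((i₂ + j₂ : ℕ) : ℤ) = b0 at *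
  generalize qPoch (q ^ ((J : ℤ) + 1 - j₁)) q ((j₁ : ℤ) - j₂) = c0 at *
  generalize qPoch (q ^ (((J + 1 : ℕ) : ℤ) + 1 - j₁)) q ((j₁ : ℤ) - j₂) = c1 at *
  generalize qPoch q q i₂ = d at *
  generalize (q ^ I) ^ ((i₂ : ℤ) - j₁) = w at *
  generalize q ^ (((i₁ + j₁).choose 2 : ℤ) - (j₁.choose 2 : ℤ)) = w' at *
  generalize 1 - q ^ ((J : ℤ) + 1 - j₁) = u at *
  generalize 1 - q ^ ((J : ℤ) + 1 - j₂) = v at *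
  generalize 1 + α * q ^ I * q ^ ((j₂ : ℤ) - i₁) = x at *
  generalize 1 + α * q ^ (i₂ + j₂) = y at *
  generalize 1 + α * q ^ I = z at *
  generalize 1 + α = α1 at *
  have hy : y = α1 * b1 / b0 := by field_simp; linarith
  have hv : v = u * c1 / c0 := by field_simp; linarith
  rw [hy, hv]
  field_simp
  linear_combination w' * w * α ^ i₁ * e1

theorem vertexPref_one_zero (h : Nondegenerate q α (I + J + 1)) {i₁ j i₂ j₂ : ℕ}
    (hs : i₁ + (j + 1) = i₂ + j₂) (hi₂ : i₂ ≤ I) (hj₁ : j ≤ J) (hj₂ : j₂ ≤ J) :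
    vertexPref q (α * q) I J (i₁ + 1) j i₂ j₂ * ((1 + α * q ^ I) * (1 + α * q ^ (i₂ + j₂)))
      = vertexPref q α I (J + 1) i₁ (j + 1) i₂ j₂ *
        (q ^ j * q ^ I * α * q ^ (i₁ + 1) * (1 + α) * (1 - q ^ ((J : ℤ) + 1 - j₂))) := by
  have hq := h.q_pos.ne'
  have hα0 := h.one_add_ne 0 (by omega)
  rw [pow_zero, mul_one] at hα0
  have e1 := h.qPoch_shift_top' ((j₂ : ℤ) - (i₁ + 1 : ℕ))
  have e2 := qPoch_shift_neg q α (i₂ + j₂)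
  have e4 := qPoch_add_one (b := q ^ ((J : ℤ) + 1 - j)) (q := q) ((j : ℤ) - j₂) (fun _ => by
    rw [← zpow_add₀ hq]; exact h.one_sub_zpow_ne (by omega))
  rw [← zpow_add₀ hq, show (J : ℤ) + 1 - j + (j - j₂) = (J : ℤ) + 1 - j₂ by ring] at e4
  have n2 := h.one_sub_zpow_ne (k := (J : ℤ) + 1 - j₂) (by omega)
  have n3 := qPoch_zpow_ne_zero h (a := (J : ℤ) + 1 - j) (m := (j : ℤ) - j₂) (by omega) (by omega)
  have n5 := h.qPoch_self_ne_zero i₂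
  have n6 := h.qPoch_neg_ne_zero (s := i₂ + j₂) (by omega)
  have n7 : qPoch (-(α * q)) q ((i₂ + j₂ : ℕ) : ℤ) ≠ 0 := by
    intro h0
    rw [h0, mul_zero] at e2
    rcases mul_eq_zero.1 e2.symm with h1 | h1
    · exact n6 h1
    · exact h.one_add_ne (i₂ + j₂) (by omega) h1
  unfold vertexPref
  rw [mul_zpow, show ((j₂ : ℤ) - j + i₂) = (i₁ + 1 : ℕ) by omega,
    show ((j₂ : ℤ) - (j + 1 : ℕ) + i₂) = i₁ by omega, zpow_natCast, zpow_natCast, zpow_natCast,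
    show ((J + 1 : ℕ) : ℤ) + 1 - (j + 1 : ℕ) = (J : ℤ) + 1 - j by push_cast; ring,
    show ((j + 1 : ℕ) : ℤ) - j₂ = j - j₂ + 1 by push_cast; ring, e4,
    show (i₁ + 1 + j) = i₁ + (j + 1) by ring,
    show ((i₂ : ℤ) - j) = i₂ - (j + 1 : ℕ) + 1 by push_cast; ring, zpow_add_one₀ (pow_ne_zero _ hq),
    choose_two_succ, show (((i₁ + (j + 1)).choose 2 : ℤ) - (j.choose 2 : ℤ)) =
      (((i₁ + (j + 1)).choose 2 : ℤ) - (j.choose 2 + j : ℤ)) + j by ring, zpow_add₀ hq _ (j : ℤ),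
    zpow_natCast]
  rw [show (j₂ : ℤ) - (i₁ + 1 : ℕ) + 1 = j₂ - i₁ by push_cast; ring] at e1
  rw [← e1]
  generalize qPoch (-(α * q) * q ^ I) q ((j₂ : ℤ) - (i₁ + 1 : ℕ)) = a1 at *
  generalize qPoch (-(α * q)) q ((i₂ + j₂ : ℕ) : ℤ) = b1 at *
  generalize qPoch (-α) q ((i₂ + j₂ : ℕ) : ℤ) = b0 at *
  generalize qPoch (q ^ ((J : ℤ) + 1 - j)) q ((j : ℤ) - j₂) = c0 at *
  generalize qPoch q q i₂ = d at *
  generalize 1 - q ^ ((J : ℤ) + 1 - j₂) = v at *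
  generalize 1 + α * q ^ (i₂ + j₂) = y at *
  generalize 1 + α * q ^ I = z at *
  generalize 1 + α = α1 at *
  have hy : y = α1 * b1 / b0 := by field_simp; linarith
  rw [hy]
  generalize (q ^ I) ^ ((i₂ : ℤ) - (j + 1 : ℕ)) = w at *
  generalize q ^ (((i₁ + (j + 1)).choose 2 : ℤ) - (j.choose 2 + j : ℤ)) = w' at *
  field_simp
  ring

theorem vertexPref_one_one (h : Nondegenerate q α (I + J + 1)) {i₁ j i₂ k : ℕ}
    (hs : i₁ + (j + 1) = i₂ + (k + 1)) :
    vertexPref q (α * q) I J i₁ j i₂ k * (1 + α * q ^ I)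
      = vertexPref q α I (J + 1) i₁ (j + 1) i₂ (k + 1) * (q ^ I * (1 + α)) := by
  have hq := h.q_pos.ne'
  have hα0 := h.one_add_ne 0 (by omega)
  rw [pow_zero, mul_one] at hα0
  have e1 := h.qPoch_shift_top' ((k : ℤ) - i₁)
  have e2 := qPoch_shift_neg' q α (i₂ + k)
  unfold vertexPref
  rw [mul_zpow, show ((k : ℤ) - j + i₂) = i₁ by omega,
    show ((k + 1 : ℕ) - (j + 1 : ℕ) + i₂ : ℤ) = i₁ by omega, zpow_natCast, zpow_natCast,
    show ((J + 1 : ℕ) : ℤ) + 1 - (j + 1 : ℕ) = (J : ℤ) + 1 - j by push_cast; ring,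
    show ((j + 1 : ℕ) : ℤ) - (k + 1 : ℕ) = j - k by push_cast; ring,
    show (i₁ + (j + 1)) = i₁ + j + 1 by ring,
    show (i₂ + (k + 1)) = i₂ + k + 1 by ring,
    show ((i₂ : ℤ) - j) = i₂ - (j + 1 : ℕ) + 1 by push_cast; ring, zpow_add_one₀ (pow_ne_zero _ hq),
    choose_two_succ, choose_two_succ, ← e2, show (((k + 1 : ℕ) : ℤ) - i₁) = k - i₁ + 1 by
      push_cast; ring, ← e1, show (((i₁ + j).choose 2 + (i₁ + j : ℕ) : ℤ) - (j.choose 2 + j : ℤ)) =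
      (((i₁ + j).choose 2 : ℤ) - j.choose 2) + i₁ by push_cast; ring, zpow_add₀ hq _ (i₁ : ℤ),
    zpow_natCast]
  field_simp

theorem vertexPref_zero_one (h : Nondegenerate q α (I + J + 1)) {i j₁ i₂ k : ℕ}
    (hs : i + 1 + j₁ = i₂ + (k + 1)) (hi₁ : i + 1 ≤ I) (hj₁ : j₁ ≤ J) :
    vertexPref q (α * q) I J i j₁ i₂ k * (1 + α * q ^ I) * (1 - q ^ ((J : ℤ) + 1 - j₁)) *
        (α * q ^ j₁)
      = vertexPref q α I (J + 1) (i + 1) j₁ i₂ (k + 1) *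
        ((1 + α * q ^ I * q ^ ((k : ℤ) - i)) * (1 + α)) := by
  have hq := h.q_pos.ne'
  have hα := h.α_ne_zero
  have hα0 := h.one_add_ne 0 (by omega)
  rw [pow_zero, mul_one] at hα0
  have e1 := h.qPoch_shift_top (m := (k : ℤ) - i) (by omega)
  have e2 := qPoch_shift_neg' q α (i₂ + k)
  have e3 := qPoch_add_one' (b := q ^ ((J : ℤ) + 1 - j₁)) hq ((j₁ : ℤ) - (k + 1 : ℕ))
    (fun _ => h.one_sub_zpow_ne (by omega))
  rw [← zpow_add_one₀ hq,
    show (J : ℤ) + 1 - j₁ + 1 = ((J + 1 : ℕ) : ℤ) + 1 - j₁ by push_cast; ring,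
    show (j₁ : ℤ) - (k + 1 : ℕ) + 1 = j₁ - k by push_cast; ring] at e3
  have n1 := h.one_sub_zpow_ne (k := (J : ℤ) + 1 - j₁) (by omega)
  unfold vertexPref
  rw [mul_zpow, show ((k : ℤ) - j₁ + i₂) = i by omega,
    show ((k + 1 : ℕ) - j₁ + i₂ : ℤ) = (i + 1 : ℕ) by omega, zpow_natCast, zpow_natCast,
    zpow_natCast, show (i + 1 + j₁) = i + j₁ + 1 by ring,
    show (i₂ + (k + 1)) = i₂ + k + 1 by ring, e3,
    choose_two_succ, ← e2, show (((k + 1 : ℕ) : ℤ) - (i + 1 : ℕ)) = k - i by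
      push_cast; ring, show (((i + j₁).choose 2 + (i + j₁ : ℕ) : ℤ) - (j₁.choose 2 : ℤ)) =
      (((i + j₁).choose 2 : ℤ) - j₁.choose 2) + (i + j₁ : ℕ) by push_cast; ring,
    zpow_add₀ hq _ ((i + j₁ : ℕ) : ℤ), zpow_natCast]
  generalize 1 - q ^ ((J : ℤ) + 1 - j₁) = u at *
  generalize qPoch (-(α * q) * q ^ I) q ((k : ℤ) - i) = a1 at *
  generalize qPoch (-α * q ^ I) q ((k : ℤ) - i) = a0 at *
  generalize 1 + α * q ^ I * q ^ ((k : ℤ) - i) = x at *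
  generalize 1 + α * q ^ I = z at *
  generalize (q ^ I) ^ ((i₂ : ℤ) - j₁) = w at *
  generalize q ^ (((i + j₁).choose 2 : ℤ) - (j₁.choose 2 : ℤ)) = w' at *
  generalize 1 + α = α1 at *
  field_simp
  linear_combination w' * w * α ^ (i + 1) * q ^ (i + j₁) * (qPoch q q i₂)⁻¹ *
    (qPoch (-(α * q)) q ((i₂ + k : ℕ) : ℤ))⁻¹ *
    (qPoch (q ^ (((J + 1 : ℕ) : ℤ) + 1 - j₁)) q ((j₁ : ℤ) - (k + 1 : ℕ)))⁻¹ * e1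

end Prefactor

/-! ### Vertical fusion of the weights. -/

section VerticalFusion

variable {q α : ℝ} {I J : ℕ}

/-- Every term has a vanishing factor: the tail of `q^{J+1-i₂-j₂}` contains `1 - q^0` at index `i₁`
if `k ≤ i₁`, and `(q^{-i₁}; q)_k` contains it otherwise. This settles the boundary case `j₁ = J +
1`, in which `J` upper rows cannot take all the lines. -/
theorem vertexPhi_eq_zero (h : q ≠ 0) {i₁ i₂ j₂ : ℕ} (hs : i₁ + (J + 1) = i₂ + j₂)
    (hj₂ : j₂ ≤ J) : vertexPhi q α I J i₁ i₂ j₂ = 0 := by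
  unfold vertexPhi
  rw [regPhi_three]
  refine Finset.sum_eq_zero fun k _ => ?_
  unfold phiTerm
  rcases le_or_gt k i₁ with hk | hk
  · have : qTail (q ^ ((J : ℤ) + 1 - i₂ - j₂)) q i₂ k = 0 := by
      refine Finset.prod_eq_zero (i := i₁) (Finset.mem_Ico.2 ⟨hk, by omega⟩) ?_
      rw [← zpow_natCast, ← zpow_add₀ h, show (J : ℤ) + 1 - i₂ - j₂ + i₁ = 0 by omega]; simp
    rw [this]; ring
  · have : qPoch (q ^ (-(i₁ : ℤ))) q k = 0 := by
      rw [qPoch_natCast]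
      refine Finset.prod_eq_zero (i := i₁) (Finset.mem_range.2 hk) ?_
      rw [← zpow_natCast, ← zpow_add₀ h]; simp
    rw [this]; ring

/-- This is `regPhi_contiguous_zero` with `A = q^{-i₁}`, `y = -αq^{J+1}`, `z = -q^{-I}/α`, `N =
q^{-I}`, `B = q^{j₂-i₁}`, `C = q^{J+1-i₂-j₂}`. Passing from `z` to `qz` is the passage from `αq` to
`α`, and the choice of `y` is common to both sides because `α q^{J+1} = (αq) q^J`. -/
theorem vertexPhi_zero (h : Nondegenerate q α (I + J + 1)) {i₁ j₁ i₂ j₂ : ℕ}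
    (hs : i₁ + j₁ = i₂ + j₂) (hj₂ : j₂ ≤ J) :
    (1 + α * q ^ I) * (1 + α * q ^ (i₂ + j₂)) * vertexPhi q α I (J + 1) i₁ i₂ j₂
      = q ^ i₂ * (1 + α * q ^ I * q ^ ((j₂ : ℤ) - i₁)) * (1 + α * q ^ i₁) *
          vertexPhi q (α * q) I J i₁ i₂ j₂
        + q ^ i₂ * α * q ^ I * (1 - q ^ (-(I : ℤ)) * q ^ i₁) * (1 - q ^ j₁) *
          vertexPhi q (α * q) I J (i₁ + 1) i₂ j₂ := by
  have hq := h.q_pos.ne'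
  have hα := h.α_ne_zero
  have hqI : q ^ I ≠ 0 := pow_ne_zero _ hq
  have key := regPhi_contiguous_zero i₂ q (q ^ (-(i₁ : ℤ))) (-α * q ^ (J + 1))
    (-q ^ (-(I : ℤ)) / α) (q ^ (-(I : ℤ))) (q ^ ((j₂ : ℤ) - i₁)) (q ^ ((J : ℤ) + 1 - i₂ - j₂)) hq
    (fun k hk => by rw [← zpow_natCast]; exact h.zpow_ne_one (by omega))
    (zpow_ne_zero _ hq)
    (fun e => by
      have : q ^ ((i₁ : ℤ) + 1) = 1 := by
        rw [zpow_add_one₀ hq]; nth_rewrite 2 [← e]; rw [← zpow_add₀ hq]; simp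
      exact h.zpow_ne_one (by omega) this)
    (div_ne_zero (neg_ne_zero.2 (zpow_ne_zero _ hq)) hα)
    (fun e => by
      apply h.one_add_ne I (by omega)
      rw [div_eq_one_iff_eq hα] at e
      rw [← e, zpow_neg, zpow_natCast]; field_simp; ring)
    (zpow_ne_zero _ hq)
    (by
      rw [← zpow_natCast, ← zpow_add₀ hq]; exact h.zpow_ne_one (by omega))
    (by
      have e1 : q ^ ((J : ℤ) + 1 - i₂ - j₂) = q ^ (J + 1) / (q ^ i₂ * q ^ j₂) := by
        rw [sub_sub, zpow_sub₀ hq, zpow_add₀ hq (i₂ : ℤ)]; norm_cast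
      rw [e1, zpow_sub₀ hq, zpow_neg, zpow_neg]
      simp only [zpow_natCast]
      field_simp)
  have e0 : q * (-q ^ (-(I : ℤ)) / α) = -q * q ^ (-(I : ℤ)) * α⁻¹ := by ring
  have e1 : -q ^ (-(I : ℤ)) / α = -q * q ^ (-(I : ℤ)) * (α * q)⁻¹ := by field_simp
  have e2 : q * q ^ ((j₂ : ℤ) - i₁) = q ^ (1 + (j₂ : ℤ) - i₁) := by
    rw [← zpow_one_add₀ hq]; congr 1; ring
  have e3 : q * q ^ ((J : ℤ) + 1 - i₂ - j₂) = q ^ (((J + 1 : ℕ) : ℤ) + 1 - i₂ - j₂) := by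
    rw [← zpow_one_add₀ hq]; congr 1; push_cast; ring
  have e4 : -α * q ^ (J + 1) = -(α * q) * q ^ J := by ring
  have e5 : q ^ (-(i₁ : ℤ)) / q = q ^ (-((i₁ + 1 : ℕ) : ℤ)) := by
    rw [div_eq_mul_inv, ← zpow_sub_one₀ hq]; congr 1; push_cast; ring
  have e6 : q ^ ((j₂ : ℤ) - i₁) = q ^ (1 + (j₂ : ℤ) - (i₁ + 1 : ℕ)) := by
    congr 1; push_cast; ring
  have p0 : regPhi i₂ ![q ^ (-(i₁ : ℤ)), -α * q ^ (J + 1), q * (-q ^ (-(I : ℤ)) / α)]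
      ![q ^ (-(I : ℤ)), q * q ^ ((j₂ : ℤ) - i₁), q * q ^ ((J : ℤ) + 1 - i₂ - j₂)] q q
      = vertexPhi q α I (J + 1) i₁ i₂ j₂ := by rw [e0, e2, e3]; rfl
  have p1 : regPhi i₂ ![q ^ (-(i₁ : ℤ)), -α * q ^ (J + 1), (-q ^ (-(I : ℤ)) / α)]
      ![q ^ (-(I : ℤ)), q * q ^ ((j₂ : ℤ) - i₁), q ^ ((J : ℤ) + 1 - i₂ - j₂)] q q
      = vertexPhi q (α * q) I J i₁ i₂ j₂ := by rw [e1, e2, e4]; rfl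
  have p2 : regPhi i₂ ![q ^ (-(i₁ : ℤ)) / q, -α * q ^ (J + 1), (-q ^ (-(I : ℤ)) / α)]
      ![q ^ (-(I : ℤ)), q ^ ((j₂ : ℤ) - i₁), q ^ ((J : ℤ) + 1 - i₂ - j₂)] q q
      = vertexPhi q (α * q) I J (i₁ + 1) i₂ j₂ := by rw [e1, e4, e5, e6]; rfl
  rw [p0, p1, p2] at key
  have f1 : 1 / (-q ^ (-(I : ℤ)) / α) = -(α * q ^ I) := by
    rw [zpow_neg, zpow_natCast]; field_simp
  have f2 : -α * q ^ (J + 1) / q ^ ((J : ℤ) + 1 - i₂ - j₂) = -(α * q ^ (i₂ + j₂)) := by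
    have e1 : q ^ ((J : ℤ) + 1 - i₂ - j₂) = q ^ (J + 1) / (q ^ i₂ * q ^ j₂) := by
      rw [sub_sub, zpow_sub₀ hq, zpow_add₀ hq (i₂ : ℤ)]; norm_cast
    rw [e1, pow_add q i₂]; field_simp
  have f3 : q ^ ((j₂ : ℤ) - i₁) / (-q ^ (-(I : ℤ)) / α) = -(α * q ^ I * q ^ ((j₂ : ℤ) - i₁)) := by
    rw [zpow_neg, zpow_natCast]; field_simp
  have f4 : q ^ (-(I : ℤ)) / (-q ^ (-(I : ℤ)) / α * q ^ (-(i₁ : ℤ))) = -(α * q ^ i₁) := by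
    simp only [zpow_neg, zpow_natCast]; field_simp
  have f5 : q ^ i₂ / (-q ^ (-(I : ℤ)) / α) = -(q ^ i₂ * α * q ^ I) := by
    rw [zpow_neg, zpow_natCast]; field_simp
  have f6 : q ^ (-(I : ℤ)) / q ^ (-(i₁ : ℤ)) = q ^ (-(I : ℤ)) * q ^ i₁ := by
    simp only [zpow_neg, zpow_natCast]; field_simp
  have f7 : q ^ ((j₂ : ℤ) - i₁) * q ^ i₂ = q ^ j₁ := by
    rw [← zpow_natCast, ← zpow_add₀ hq, ← zpow_natCast]; congr 1; omega
  rw [f1, f2, f3, f4, f5, f6, f7] at key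
  linear_combination key

theorem vertexPhi_one (h : Nondegenerate q α (I + J + 1)) {i₁ j₁ i₂ k : ℕ}
    (hs : i₁ + j₁ = i₂ + (k + 1)) :
    (1 + α * q ^ I * q ^ ((k : ℤ) + 1 - i₁)) * (1 - q ^ i₁) *
          vertexPhi q (α * q) I J (i₁ - 1) i₂ k
        + (q ^ i₁ + α * q ^ I) * (1 - q ^ j₁) * vertexPhi q (α * q) I J i₁ i₂ k
      = (1 + α * q ^ I) * (1 - q ^ (k + 1)) * vertexPhi q α I (J + 1) i₁ i₂ (k + 1) := by
  have hq := h.q_pos.ne'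
  have hα := h.α_ne_zero
  have hqI : q ^ I ≠ 0 := pow_ne_zero _ hq
  have key := regPhi_contiguous_one i₂ q (q ^ (-(i₁ : ℤ))) (-α * q ^ (J + 1))
    (-q ^ (-(I : ℤ)) / α) (q ^ (-(I : ℤ))) (q ^ ((k : ℤ) + 1 - i₁)) (q ^ ((J : ℤ) + 1 - i₂ - k))
    (zpow_ne_zero _ hq)
    (div_ne_zero (neg_ne_zero.2 (zpow_ne_zero _ hq)) hα)
    (fun e => by
      apply h.one_add_ne I (by omega)
      rw [div_eq_one_iff_eq hα] at e
      rw [← e, zpow_neg, zpow_natCast]; field_simp; ring)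
  have e0 : q * (-q ^ (-(I : ℤ)) / α) = -q * q ^ (-(I : ℤ)) * α⁻¹ := by ring
  have e1 : -q ^ (-(I : ℤ)) / α = -q * q ^ (-(I : ℤ)) * (α * q)⁻¹ := by field_simp
  have e2 : q * q ^ ((k : ℤ) + 1 - i₁) = q ^ (1 + ((k + 1 : ℕ) : ℤ) - i₁) := by
    rw [← zpow_one_add₀ hq]; congr 1; push_cast; ring
  have e3 : q ^ ((J : ℤ) + 1 - i₂ - k) = q ^ (((J + 1 : ℕ) : ℤ) + 1 - i₂ - (k + 1 : ℕ)) := by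
    congr 1; push_cast; ring
  have e4 : -α * q ^ (J + 1) = -(α * q) * q ^ J := by ring
  have e6 : q ^ ((k : ℤ) + 1 - i₁) = q ^ (1 + (k : ℤ) - i₁) := by
    congr 1; ring
  have p0 : regPhi i₂ ![q ^ (-(i₁ : ℤ)), -α * q ^ (J + 1), q * (-q ^ (-(I : ℤ)) / α)]
      ![q ^ (-(I : ℤ)), q * q ^ ((k : ℤ) + 1 - i₁), q ^ ((J : ℤ) + 1 - i₂ - k)] q q
      = vertexPhi q α I (J + 1) i₁ i₂ (k + 1) := by rw [e0, e2, e3]; rfl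
  have p2 : regPhi i₂ ![q ^ (-(i₁ : ℤ)), -α * q ^ (J + 1), (-q ^ (-(I : ℤ)) / α)]
      ![q ^ (-(I : ℤ)), q ^ ((k : ℤ) + 1 - i₁), q ^ ((J : ℤ) + 1 - i₂ - k)] q q
      = vertexPhi q (α * q) I J i₁ i₂ k := by rw [e1, e4, e6]; rfl
  have f1 : 1 / (-q ^ (-(I : ℤ)) / α) = -(α * q ^ I) := by
    rw [zpow_neg, zpow_natCast]; field_simp
  have f3 : q ^ ((k : ℤ) + 1 - i₁) / (-q ^ (-(I : ℤ)) / α) =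
      -(α * q ^ I * q ^ ((k : ℤ) + 1 - i₁)) := by
    rw [zpow_neg, zpow_natCast]; field_simp
  have f4 : 1 / q ^ (-(i₁ : ℤ)) = q ^ i₁ := by simp
  have f6 : q ^ ((k : ℤ) + 1 - i₁) / q ^ (-(i₁ : ℤ)) = q ^ (k + 1) := by
    rw [← zpow_sub₀ hq, ← zpow_natCast]; congr 1; push_cast; ring
  have f7 : q ^ ((k : ℤ) + 1 - i₁) * q ^ i₂ = q ^ j₁ := by
    rw [← zpow_natCast, ← zpow_add₀ hq, ← zpow_natCast]; congr 1; omega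
  rw [p0, p2, f1, f3, f4, f6, f7] at key
  -- For `i₁ = 0` the truncated `i₁ - 1` has no meaning, but its coefficient `1 - q^{i₁}` is zero.
  rcases Nat.eq_zero_or_pos i₁ with rfl | hi
  · simp only [pow_zero, sub_self, mul_zero, zero_mul, zero_add] at key ⊢
    linear_combination key
  · have e5 : q * q ^ (-(i₁ : ℤ)) = q ^ (-((i₁ - 1 : ℕ) : ℤ)) := by
      rw [← zpow_one_add₀ hq]; congr 1; omega
    have e7 : q * q ^ ((k : ℤ) + 1 - i₁) = q ^ (1 + (k : ℤ) - (i₁ - 1 : ℕ)) := by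
      rw [← zpow_one_add₀ hq]; congr 1; omega
    have p1 : regPhi i₂ ![q * q ^ (-(i₁ : ℤ)), -α * q ^ (J + 1), (-q ^ (-(I : ℤ)) / α)]
      ![q ^ (-(I : ℤ)), q * q ^ ((k : ℤ) + 1 - i₁), q ^ ((J : ℤ) + 1 - i₂ - k)] q q
      = vertexPhi q (α * q) I J (i₁ - 1) i₂ k := by rw [e1, e7, e4, e5]; rfl
    rw [p1] at key
    linear_combination key

/-- Up to the normalization `1 - q^{J+1}`, the factors `q^{j₁} - q^{J+1}` and `1 - q^{j₁}` are the
`Λ_{J+1}`-probabilities that the lower row receives no line or one line, and `q^{j₂} - q^{J+1}`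
plays the same role on the right. The fractions over `1 + α` are the one-line weights. They are
written out because `vertexWeight` with `J = 1` is itself computed from this relation. -/
theorem vertexWeight_fusion_zero (h : Nondegenerate q α (I + J + 1)) {i₁ j₁ i₂ j₂ : ℕ}
    (hs : i₁ + j₁ = i₂ + j₂) (hi₁ : i₁ ≤ I) (hi₂ : i₂ ≤ I) (hj₁ : j₁ ≤ J + 1) (hj₂ : j₂ ≤ J) :
    (q ^ j₁ - q ^ (J + 1)) * ((1 + α * q ^ i₁) / (1 + α)) *
        vertexWeight q (α * q) I J i₁ j₁ i₂ j₂
      + (1 - q ^ j₁) * ((1 - q ^ (-(I : ℤ)) * q ^ i₁) / (1 + α)) *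
        vertexWeight q (α * q) I J (i₁ + 1) (j₁ - 1) i₂ j₂
      = vertexWeight q α I (J + 1) i₁ j₁ i₂ j₂ * (q ^ j₂ - q ^ (J + 1)) := by
  have hq := h.q_pos.ne'
  have hα0 := h.one_add_ne 0 (by omega)
  rw [pow_zero, mul_one] at hα0
  have hφ := vertexPhi_zero h hs hj₂
  have z1 := h.one_add_ne I (by omega)
  have z2 := h.one_add_ne (i₂ + j₂) (by omega)
  have hv : q ^ j₂ - q ^ (J + 1) = q ^ j₂ * (1 - q ^ ((J : ℤ) + 1 - j₂)) := by
    rw [show q ^ ((J : ℤ) + 1 - j₂) = q ^ (J + 1) / q ^ j₂ by rw [zpow_sub₀ hq]; norm_cast]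
    field_simp
  have hu : q ^ j₁ - q ^ (J + 1) = q ^ j₁ * (1 - q ^ ((J : ℤ) + 1 - j₁)) := by
    rw [show q ^ ((J : ℤ) + 1 - j₁) = q ^ (J + 1) / q ^ j₁ by rw [zpow_sub₀ hq]; norm_cast]
    field_simp
  have hpow : q ^ i₂ * q ^ j₂ = q ^ i₁ * q ^ j₁ := by rw [← pow_add, ← pow_add, hs]
  rw [vertexWeight_eq _ _ _ _ hs, vertexWeight_eq _ _ _ _ hs, hv]
  have first : (q ^ j₁ - q ^ (J + 1)) * ((1 + α * q ^ i₁) / (1 + α)) *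
      (vertexPref q (α * q) I J i₁ j₁ i₂ j₂ * vertexPhi q (α * q) I J i₁ i₂ j₂) =
      vertexPref q α I (J + 1) i₁ j₁ i₂ j₂ * (1 - q ^ ((J : ℤ) + 1 - j₂)) * q ^ j₂ *
        (q ^ i₂ * (1 + α * q ^ I * q ^ ((j₂ : ℤ) - i₁)) * (1 + α * q ^ i₁) *
          vertexPhi q (α * q) I J i₁ i₂ j₂) / ((1 + α * q ^ I) * (1 + α * q ^ (i₂ + j₂))) := by
    rcases Nat.lt_or_ge J j₁ with hj | hj
    · obtain rfl : j₁ = J + 1 := by omega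
      rw [vertexPhi_eq_zero hq hs hj₂]; simp
    · have e := vertexPref_zero_zero h hs hi₁ hj hj₂
      rw [hu, eq_div_iff (mul_ne_zero z1 z2)]
      have e' : q ^ j₁ * (1 - q ^ ((J : ℤ) + 1 - j₁)) * ((1 + α * q ^ i₁) / (1 + α)) *
        (vertexPref q (α * q) I J i₁ j₁ i₂ j₂ * vertexPhi q (α * q) I J i₁ i₂ j₂) *
        ((1 + α * q ^ I) * (1 + α * q ^ (i₂ + j₂))) =
        q ^ j₁ * ((1 + α * q ^ i₁) / (1 + α)) * vertexPhi q (α * q) I J i₁ i₂ j₂ *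
        ((1 - q ^ ((J : ℤ) + 1 - j₁)) * vertexPref q (α * q) I J i₁ j₁ i₂ j₂ *
        ((1 + α * q ^ I) * (1 + α * q ^ (i₂ + j₂)))) := by ring
      rw [e', e]
      field_simp
      linear_combination (-(1 + α * q ^ i₁) * vertexPhi q (α * q) I J i₁ i₂ j₂ *
        vertexPref q α I (J + 1) i₁ j₁ i₂ j₂ * (1 + α * q ^ I * q ^ ((j₂ : ℤ) - i₁)) *
        (1 - q ^ ((J : ℤ) + 1 - j₂))) * hpow
  have second : (1 - q ^ j₁) * ((1 - q ^ (-(I : ℤ)) * q ^ i₁) / (1 + α)) *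
        vertexWeight q (α * q) I J (i₁ + 1) (j₁ - 1) i₂ j₂ =
      vertexPref q α I (J + 1) i₁ j₁ i₂ j₂ * (1 - q ^ ((J : ℤ) + 1 - j₂)) * q ^ j₂ *
        (q ^ i₂ * α * q ^ I * (1 - q ^ (-(I : ℤ)) * q ^ i₁) * (1 - q ^ j₁) *
          vertexPhi q (α * q) I J (i₁ + 1) i₂ j₂) /
            ((1 + α * q ^ I) * (1 + α * q ^ (i₂ + j₂))) := by
    rcases j₁ with _ | j
    · simp
    · have e := vertexPref_one_zero h hs hi₂ (by omega) hj₂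
      rw [Nat.add_sub_cancel, vertexWeight_eq _ _ _ _ (by omega),
        eq_div_iff (mul_ne_zero z1 z2)]
      have e' : ∀ u v w x : ℝ, u * (v / (1 + α)) * (w * x) *
          ((1 + α * q ^ I) * (1 + α * q ^ (i₂ + j₂))) =
          u * (v / (1 + α)) * x * (w * ((1 + α * q ^ I) * (1 + α * q ^ (i₂ + j₂)))) := by
        intros; ring
      rw [e', e]
      generalize vertexPref q α I (J + 1) i₁ (j + 1) i₂ j₂ = w
      generalize q ^ (-(I : ℤ)) = ν
      generalize q ^ ((J : ℤ) + 1 - j₂) = v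
      rw [show q ^ j * q ^ I * α * q ^ (i₁ + 1) * (1 + α) * (1 - v) =
        (q ^ i₁ * q ^ (j + 1)) * (q ^ I * α * (1 + α) * (1 - v)) by ring, ← hpow]
      field_simp
  rw [first, second, ← add_div, ← mul_add, ← hφ]
  field_simp

theorem vertexWeight_fusion_one (h : Nondegenerate q α (I + J + 1)) {i₁ j₁ i₂ k : ℕ}
    (hs : i₁ + j₁ = i₂ + (k + 1)) (hi₁ : i₁ ≤ I) (hj₁ : j₁ ≤ J + 1) (hk : k ≤ J) :
    (q ^ j₁ - q ^ (J + 1)) * (α * (1 - q ^ i₁) / (1 + α)) *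
        vertexWeight q (α * q) I J (i₁ - 1) j₁ i₂ k
      + (1 - q ^ j₁) * ((α + q ^ (-(I : ℤ)) * q ^ i₁) / (1 + α)) *
        vertexWeight q (α * q) I J i₁ (j₁ - 1) i₂ k
      = vertexWeight q α I (J + 1) i₁ j₁ i₂ (k + 1) * (1 - q ^ (k + 1)) := by
  have hq := h.q_pos.ne'
  have hα := h.α_ne_zero
  have hα0 := h.one_add_ne 0 (by omega)
  rw [pow_zero, mul_one] at hα0
  have hφ := vertexPhi_one h hs
  have z1 := h.one_add_ne I (by omega)
  have hu : q ^ j₁ - q ^ (J + 1) = q ^ j₁ * (1 - q ^ ((J : ℤ) + 1 - j₁)) := by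
    rw [show q ^ ((J : ℤ) + 1 - j₁) = q ^ (J + 1) / q ^ j₁ by rw [zpow_sub₀ hq]; norm_cast]
    field_simp
  rw [vertexWeight_eq _ _ _ (J + 1) hs]
  have first : (q ^ j₁ - q ^ (J + 1)) * (α * (1 - q ^ i₁) / (1 + α)) *
      vertexWeight q (α * q) I J (i₁ - 1) j₁ i₂ k =
      vertexPref q α I (J + 1) i₁ j₁ i₂ (k + 1) *
        ((1 + α * q ^ I * q ^ ((k : ℤ) + 1 - i₁)) * (1 - q ^ i₁) *
          vertexPhi q (α * q) I J (i₁ - 1) i₂ k) / (1 + α * q ^ I) := by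
    rcases i₁ with _ | i
    · simp
    rcases Nat.lt_or_ge J j₁ with hj | hj
    · obtain rfl : j₁ = J + 1 := by omega
      rw [Nat.add_sub_cancel, vertexPhi_eq_zero hq (by omega) hk]; simp
    · have e := vertexPref_zero_one h hs hi₁ hj
      rw [hu, eq_div_iff z1, Nat.add_sub_cancel, vertexWeight_eq _ _ _ _ (by omega)]
      rw [show (k : ℤ) + 1 - (i + 1 : ℕ) = k - i by push_cast; ring]
      generalize vertexPref q (α * q) I J i j₁ i₂ k = w1 at *
      generalize vertexPref q α I (J + 1) (i + 1) j₁ i₂ (k + 1) = w0 at *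
      generalize q ^ ((J : ℤ) + 1 - j₁) = u at *
      generalize q ^ ((k : ℤ) - i) = v at *
      generalize vertexPhi q (α * q) I J i i₂ k = p at *
      rw [show q ^ j₁ * (1 - u) * (α * (1 - q ^ (i + 1)) / (1 + α)) * (w1 * p) * (1 + α * q ^ I) =
        ((1 - q ^ (i + 1)) / (1 + α)) * p * (w1 * (1 + α * q ^ I) * (1 - u) * (α * q ^ j₁)) by ring, e]
      field_simp
  have second : (1 - q ^ j₁) * ((α + q ^ (-(I : ℤ)) * q ^ i₁) / (1 + α)) *
        vertexWeight q (α * q) I J i₁ (j₁ - 1) i₂ k =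
      vertexPref q α I (J + 1) i₁ j₁ i₂ (k + 1) *
        ((q ^ i₁ + α * q ^ I) * (1 - q ^ j₁) * vertexPhi q (α * q) I J i₁ i₂ k)
          / (1 + α * q ^ I) := by
    rcases j₁ with _ | j
    · simp
    · have e := vertexPref_one_one h hs
      rw [Nat.add_sub_cancel, vertexWeight_eq _ _ _ _ (by omega), eq_div_iff z1]
      generalize vertexPref q (α * q) I J i₁ j i₂ k = w1 at *
      generalize vertexPref q α I (J + 1) i₁ (j + 1) i₂ (k + 1) = w0 at *
      generalize vertexPhi q (α * q) I J i₁ i₂ k = p at *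
      rw [show ∀ a b : ℝ, a * b * (w1 * p) * (1 + α * q ^ I) = a * b * p * (w1 * (1 + α * q ^ I)) by
        intros; ring, e, zpow_neg, zpow_natCast]
      have hqI : q ^ I ≠ 0 := pow_ne_zero _ hq
      field_simp
      ring
  rw [first, second, ← add_div, ← mul_add, hφ]
  field_simp

end VerticalFusion

/-! ### Explicit weights for zero and one horizontal line. -/

section Line

variable {q α : ℝ} {I J : ℕ}

theorem qPoch_neg_pow_self (hq : q ≠ 0) (i : ℕ) :
    qPoch (q ^ (-(i : ℤ))) q (i : ℤ) = (-1) ^ i * (q ^ (i + 1).choose 2)⁻¹ * qPoch q q (i : ℤ) := by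
  induction i with
  | zero => simp [qPoch_zero]
  | succ i ih =>
    have h1 := qPoch_add_one' (b := q ^ (-((i + 1 : ℕ) : ℤ))) hq (i : ℤ) (fun h => by omega)
    rw [← zpow_add_one₀ hq, show -((i + 1 : ℕ) : ℤ) + 1 = -i by push_cast; ring, ih] at h1
    rw [show ((i + 1 : ℕ) : ℤ) = (i : ℤ) + 1 by push_cast; rfl] at h1 ⊢
    rw [h1, show (i : ℤ) + 1 = ((i + 1 : ℕ) : ℤ) by push_cast; rfl, qPoch_natCast_succ, Nat.choose_succ_succ' (i + 1) 1]
    simp only [zpow_neg, zpow_natCast, Nat.choose_one_right, pow_add, pow_succ]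
    field_simp
    ring

/-- Each factor `1 + q^{k+1}/c` is `q^{k+1}/c` times `1 + c q^{-k-1}`, and the latter cancels
against an inverse in the symbol of negative index. -/
theorem qPoch_neg_inv (hq : q ≠ 0) {c : ℝ} (hc : c ≠ 0) (i : ℕ)
    (hi : ∀ k < i, 1 + c * q ^ (-(k : ℤ) - 1) ≠ 0) :
    qPoch (-c) q (-(i : ℤ)) * qPoch (-q * c⁻¹) q (i : ℤ) = q ^ (i + 1).choose 2 * (c ^ i)⁻¹ := by
  induction i with
  | zero => simp [qPoch_zero]
  | succ i ih =>
    have h0 := hi i (by omega)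
    have h1 := qPoch_add_one (b := -c) (q := q) (-((i + 1 : ℕ) : ℤ)) (fun _ => by
      convert h0 using 1
      rw [show -((i + 1 : ℕ) : ℤ) = -(i : ℤ) - 1 by push_cast; ring]; ring)
    have ih' := ih fun k hk => hi k (by omega)
    rw [show -((i + 1 : ℕ) : ℤ) + 1 = -i by push_cast; ring,
      show 1 - -c * q ^ (-((i + 1 : ℕ) : ℤ)) = 1 + c * (q ^ (i + 1))⁻¹ by
        rw [zpow_neg, zpow_natCast]; ring] at h1
    rw [h1] at ih'
    rw [qPoch_natCast_succ, Nat.choose_succ_succ' (i + 1) 1, Nat.choose_one_right, pow_add,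
      pow_succ c, mul_inv]
    have hp : q ^ (i + 1) ≠ 0 := pow_ne_zero _ hq
    have : 1 - -q * c⁻¹ * q ^ i = (1 + c * (q ^ (i + 1))⁻¹) * (q ^ (i + 1) * c⁻¹) := by
      field_simp; ring
    rw [this]
    linear_combination (q ^ (i + 1) * c⁻¹) * ih'

/-- The tail of `q^{1-i}` kills every term of the series except `k = i`; reversal of the two
remaining symbols cancels the prefactor. This is the base case `J = 0` from which the one-line
weights are obtained. -/
theorem vertexWeight_no_row (h : Nondegenerate q α I) {i : ℕ} (hi : i ≤ I) :
    vertexWeight q α I 0 i 0 i 0 = 1 := by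
  have hq := h.q_pos.ne'
  have hα := h.α_ne_zero
  have hqI : q ^ I ≠ 0 := pow_ne_zero _ hq
  rw [vertexWeight_eq _ _ _ _ rfl]
  have hφ : vertexPhi q α I 0 i i 0 = phiTerm i q (q ^ (-(i : ℤ))) (-α * q ^ 0)
      (-q * q ^ (-(I : ℤ)) * α⁻¹) (q ^ (-(I : ℤ))) (q ^ (1 + ((0 : ℕ) : ℤ) - i))
      (q ^ (((0 : ℕ) : ℤ) + 1 - i - ((0 : ℕ) : ℤ))) i := by
    unfold vertexPhi
    rw [regPhi_three]
    refine Finset.sum_eq_single_of_mem i (by simp) fun k hk hki => ?_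
    have hk' : k < i := by have := Finset.mem_range.1 hk; omega
    have : qTail (q ^ (((0 : ℕ) : ℤ) + 1 - i - ((0 : ℕ) : ℤ))) q i k = 0 := by
      refine Finset.prod_eq_zero (i := i - 1) (Finset.mem_Ico.2 ⟨by omega, by omega⟩) ?_
      rw [← zpow_natCast, ← zpow_add₀ hq,
        show (((0 : ℕ) : ℤ) + 1 - i - ((0 : ℕ) : ℤ)) + (i - 1 : ℕ) = 0 by omega]; simp
    unfold phiTerm
    rw [this]; ring
  have n1 := h.qPoch_self_ne_zero i
  have n2 : qPoch (-α) q (i : ℤ) ≠ 0 := by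
    rw [qPoch_natCast, Finset.prod_ne_zero_iff]
    intro k hk
    have := h.one_add_ne k (by have := Finset.mem_range.1 hk; omega)
    convert this using 1; ring
  have e1 := qPoch_neg_inv hq (mul_ne_zero hα hqI) i fun k hk => by
    have := h.one_add_zpow_ne (k := I - k - 1) (by omega) (by omega)
    rw [show (I : ℤ) - k - 1 = I + (-k - 1) by ring, zpow_add₀ hq, zpow_natCast] at this
    rwa [mul_assoc]
  rw [hφ]
  unfold vertexPref phiTerm
  simp only [qTail_self, qPoch_neg_pow_self hq]
  rw [show -q * q ^ (-(I : ℤ)) * α⁻¹ = -q * (α * q ^ I)⁻¹ by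
    rw [zpow_neg, zpow_natCast, mul_inv]; ring, show -α * q ^ I = -(α * q ^ I) by ring]
  simp only [Nat.cast_zero, sub_zero, zero_sub, add_zero, zero_add, pow_zero, mul_one,
    sub_self, qPoch_zero]
  rw [zpow_natCast, zpow_natCast, show ((i.choose 2 : ℤ) - ((Nat.choose 0 2 : ℕ) : ℤ)) = (i.choose 2 : ℤ) by
    simp, zpow_natCast]
  have hc : (i + 1).choose 2 = i.choose 2 + i := by
    have := choose_two_succ i; exact_mod_cast this
  have hp : q ^ (i + 1).choose 2 = q ^ i.choose 2 * q ^ i := by rw [hc, pow_add]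
  rw [hp] at e1 ⊢
  generalize qPoch (-(α * q ^ I)) q (-(i : ℤ)) = a at *
  generalize qPoch (-q * (α * q ^ I)⁻¹) q (i : ℤ) = b at *
  generalize qPoch q q (i : ℤ) = c at *
  generalize qPoch (-α) q (i : ℤ) = d at *
  have hs : ((-1 : ℝ) ^ i) * (-1) ^ i = 1 := by rw [← mul_pow]; norm_num
  generalize (-1 : ℝ) ^ i = s at *
  generalize hg : q ^ i.choose 2 = g at *
  have hg0 : g ≠ 0 := by rw [← hg]; exact pow_ne_zero _ hq
  rw [mul_pow] at e1
  have hw : (q ^ I) ^ i ≠ 0 := pow_ne_zero _ hqI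
  generalize (q ^ I) ^ i = w at *
  have hi0 : q ^ i ≠ 0 := pow_ne_zero _ hq
  have ha0 : α ^ i ≠ 0 := pow_ne_zero _ hα
  calc _ = (w * α ^ i) * (a * b) * (s * s) / (g * q ^ i) := by field_simp
    _ = 1 := by rw [e1, hs]; field_simp

/-- The weights of a vertex with one horizontal line, as a function of `ν = q^{-I}`. -/
noncomputable def lineWeight (q α ν : ℝ) (i h i' h' : ℕ) : ℝ :=
  if h = 0 ∧ h' = 0 ∧ i' = i then (1 + α * q ^ i) / (1 + α)
  else if h = 0 ∧ h' = 1 ∧ i = i' + 1 then α * (1 - q ^ i) / (1 + α)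
  else if h = 1 ∧ h' = 0 ∧ i' = i + 1 then (1 - ν * q ^ i) / (1 + α)
  else if h = 1 ∧ h' = 1 ∧ i' = i then (α + ν * q ^ i) / (1 + α)
  else 0

/-- Vertical fusion with `J = 0` above a single line, where the upper weight is `1`; the common
factor `1 - q` is then cancelled. -/
theorem vertexWeight_one_row (h : Nondegenerate q α (I + 1)) {i i' k k' : ℕ} (hi : i ≤ I)
    (hi' : i' ≤ I) (hk : k ≤ 1) (hk' : k' ≤ 1) :
    vertexWeight q α I 1 i k i' k' = lineWeight q α (q ^ (-(I : ℤ))) i k i' k' := by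
  have hq1 : 1 - q ≠ 0 := sub_ne_zero.2 h.q_ne_one.symm
  by_cases hs : i + k = i' + k'
  swap
  · rw [vertexWeight_of_ne _ _ _ _ hs]
    unfold lineWeight
    split_ifs <;> first | rfl | omega
  have h' : Nondegenerate q α (I + 0 + 1) := h
  have no := fun {m : ℕ} (hm : m ≤ I) => vertexWeight_no_row h.shift hm
  interval_cases k <;> interval_cases k'
  · obtain rfl : i = i' := by omega
    have := vertexWeight_fusion_zero h' hs hi hi' (by omega) (by omega)
    rw [no hi] at this
    simp only [zero_add, pow_zero, pow_one, sub_self, zero_mul, add_zero, mul_one] at this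
    simp only [lineWeight]
    apply mul_right_cancel₀ hq1
    rw [← this]; simp; ring
  · obtain rfl : i = i' + 1 := by omega
    have := vertexWeight_fusion_one h' (k := 0) hs hi (by omega) (by omega)
    rw [Nat.add_sub_cancel, no hi'] at this
    simp only [zero_add, pow_zero, pow_one, sub_self, zero_mul, add_zero, mul_one] at this
    simp only [lineWeight]
    apply mul_right_cancel₀ hq1
    rw [← this]; simp; ring
  · obtain rfl : i' = i + 1 := by omega
    have := vertexWeight_fusion_zero h' hs hi hi' (by omega) (by omega)
    rw [Nat.sub_self, no hi'] at this
    simp only [zero_add, pow_zero, pow_one, sub_self, zero_mul, mul_one] at this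
    simp only [lineWeight]
    apply mul_right_cancel₀ hq1
    rw [← this]; simp; ring
  · obtain rfl : i = i' := by omega
    have := vertexWeight_fusion_one h' (k := 0) hs hi (by omega) (by omega)
    rw [Nat.sub_self, no hi] at this
    simp only [zero_add, pow_one, sub_self, zero_mul, mul_one] at this
    simp only [lineWeight]
    apply mul_right_cancel₀ hq1
    rw [← this]; simp; ring

end Line

/-! ### Splitting one site off a one-line vertex. -/

section HorizontalFusion

theorem lineWeight_of_ne (q α ν : ℝ) {i h i' h' : ℕ} (hne : i + h ≠ i' + h') :
    lineWeight q α ν i h i' h' = 0 := by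
  unfold lineWeight
  split_ifs <;> first | rfl | omega

/-- The conditional probability under `Λ'_{n+1}(v; ·)` that the first entry is `u`. -/
noncomputable def headProb (q : ℝ) (n v u : ℕ) : ℝ :=
  if u = 0 then (1 - q ^ (n + 1 - v)) / (1 - q ^ (n + 1))
  else (q ^ (n + 1 - v) - q ^ (n + 1)) / (1 - q ^ (n + 1))

/-- On the left a column of `i` lines is first split into a leading site and `n` remaining ones and
then crossed by the line; on the right it is crossed first and split afterwards. Since `h`, `u`,
`h'` are bits, conservation leaves eight rational identities. The truncated `i - 1` at `i = 0` does
no harm because `headProb q n 0 1 = 0`. -/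
theorem lineWeight_fusion {q α : ℝ} {n : ℕ} (hα : Nondegenerate q α 2)
    {i h u m h' : ℕ} (hi : i ≤ n + 1) (hm : m ≤ n) (hh : h ≤ 1) (hu : u ≤ 1) (hh' : h' ≤ 1) :
    headProb q n i 0 * (lineWeight q α q⁻¹ 0 h u 0 * lineWeight q (α * q) (q ^ n)⁻¹ i 0 m h'
        + lineWeight q α q⁻¹ 0 h u 1 * lineWeight q (α * q) (q ^ n)⁻¹ i 1 m h')
      + headProb q n i 1 *
        (lineWeight q α q⁻¹ 1 h u 0 * lineWeight q (α * q) (q ^ n)⁻¹ (i - 1) 0 m h'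
        + lineWeight q α q⁻¹ 1 h u 1 * lineWeight q (α * q) (q ^ n)⁻¹ (i - 1) 1 m h')
      = lineWeight q α (q ^ (n + 1))⁻¹ i h (u + m) h' * headProb q n (u + m) u := by
  have hq := hα.q_pos.ne'
  have hd : 1 - q ^ (n + 1) ≠ 0 := by
    have := hα.one_sub_zpow_ne (k := (n + 1 : ℕ)) (by omega)
    rwa [zpow_natCast] at this
  have ha0 : 1 + α ≠ 0 := by simpa using hα.one_add_ne 0 (by omega)
  have ha1 : 1 + α * q ≠ 0 := by simpa using hα.one_add_ne 1 (by omega)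
  have ha1' : 1 + q * α ≠ 0 := by rwa [mul_comm]
  have hpow : ∀ k ≤ n + 1, q ^ (n + 1 - k) = q ^ (n + 1) / q ^ k := fun k hk => by
    rw [eq_div_iff (pow_ne_zero _ hq), ← pow_add]; congr 1; omega
  have hn : q ^ (n + 1) = q ^ n * q := pow_succ _ _
  have hn0 : q ^ n ≠ 0 := pow_ne_zero _ hq
  rw [hn] at hd
  unfold headProb
  rw [hpow i hi, hpow (u + m) (by omega), hn]
  generalize q ^ n = Y at *
  clear hpow
  by_cases hs : i + h = u + m + h'
  swap
  · rw [lineWeight_of_ne _ _ _ (h := h) (i' := u + m) hs, zero_mul]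
    have z : ∀ a b k, a + b + h ≠ u + m + h' →
        lineWeight q α q⁻¹ a h u k * lineWeight q (α * q) Y⁻¹ b k m h' = 0 := by
      intro a b k hab
      by_cases h1 : a + h = u + k
      · rw [lineWeight_of_ne q (α * q) _ (by omega : b + k ≠ m + h'), mul_zero]
      · rw [lineWeight_of_ne q α _ h1, zero_mul]
    rw [z 0 i 0 (by omega), z 0 i 1 (by omega)]
    rcases i with _ | i
    · simp
    · rw [z 1 _ 0 (by omega), z 1 _ 1 (by omega)]; simp
  have hi0 : q ^ m ≠ 0 := pow_ne_zero _ hq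
  interval_cases h <;> interval_cases u <;> interval_cases h'
  · obtain rfl : i = m := by omega
    rcases i with _ | i <;> simp [lineWeight, pow_succ] <;> field_simp <;> ring
  · obtain rfl : i = m + 1 := by omega
    simp [lineWeight, pow_succ]; field_simp; ring
  · obtain rfl : i = m + 1 := by omega
    simp [lineWeight, pow_succ, add_comm 1 m]; field_simp
  · obtain rfl : i = m + 2 := by omega
    simp [lineWeight, pow_succ, add_comm 1 m]; field_simp
  · obtain rfl : m = i + 1 := by omega
    rcases i with _ | i <;> simp [lineWeight, pow_succ] <;> field_simp <;> ring
  · obtain rfl : i = m := by omega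
    rcases i with _ | i <;> simp [lineWeight, pow_succ] <;> field_simp <;> ring
  · obtain rfl : i = m := by omega
    rcases i with _ | i <;> simp [lineWeight, pow_succ, add_comm 1] <;> field_simp <;> ring
  · obtain rfl : i = m + 1 := by omega
    simp [lineWeight, pow_succ, add_comm 1 m]; field_simp; ring

end HorizontalFusion

/-! ### From local relations to whole rows. -/

section Transfer

/-- The weight of a row of `n` vertices: `W k` is the weight of the `k`-th vertex, `c` and `d` the
lines at the bottom and at the top, `h` and `h'` the lines entering at the left and leaving at the
right. -/
noncomputable def transfer {A B : Type*} [Fintype B] [DecidableEq B] :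
    (n : ℕ) → (ℕ → A → B → A → B → ℝ) → (Fin n → A) → (Fin n → A) → B → B → ℝ
  | 0, _, _, _, h, h' => if h = h' then 1 else 0
  | n + 1, W, c, d, h, h'' => ∑ h', W 0 (c 0) h (d 0) h' *
      transfer n (fun k => W (k + 1)) (Fin.tail c) (Fin.tail d) h' h''

theorem sum_fin_cons {A : Type*} [Fintype A] {n : ℕ} (f : (Fin (n + 1) → A) → ℝ) :
    ∑ e, f e = ∑ a, ∑ e : Fin n → A, f (Fin.cons a e) := by
  rw [← Fintype.sum_prod_type', ← (Fin.consEquiv fun _ : Fin (n + 1) => A).sum_comp]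
  rfl

/-- Zipper argument: the splitting matrix `M` of the horizontal lines is pulled through the two
rows, one vertex at a time, and each passage merges a pair of vertices into one. -/
theorem transfer_fusion {A B₁ B₂ B : Type*} [Fintype A] [Fintype B₁] [DecidableEq B₁] [Fintype B₂]
    [DecidableEq B₂] [Fintype B] [DecidableEq B] (n : ℕ) (W₁ : ℕ → A → B₁ → A → B₁ → ℝ)
    (W₂ : ℕ → A → B₂ → A → B₂ → ℝ) (W : ℕ → A → B → A → B → ℝ) (M : B → B₁ → B₂ → ℝ)
    (hloc : ∀ k b a a'' c₁ c₂, ∑ b₁, ∑ b₂, M b b₁ b₂ * ∑ a', W₁ k a b₁ a' c₁ * W₂ k a' b₂ a'' c₂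
      = ∑ b', W k a b a'' b' * M b' c₁ c₂) (c d : Fin n → A) (b : B) (c₁ : B₁) (c₂ : B₂) :
    ∑ b₁, ∑ b₂, M b b₁ b₂ * ∑ e : Fin n → A, transfer n W₁ c e b₁ c₁ * transfer n W₂ e d b₂ c₂
      = ∑ b', transfer n W c d b b' * M b' c₁ c₂ := by
  induction n generalizing W₁ W₂ W b with
  | zero => simp [transfer]
  | succ n ih =>
    have ih' := ih (fun k => W₁ (k + 1)) (fun k => W₂ (k + 1)) (fun k => W (k + 1))
      (fun k => hloc (k + 1)) (Fin.tail c) (Fin.tail d)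
    set T₁ := transfer n (fun k => W₁ (k + 1)) with hT₁
    set T₂ := transfer n (fun k => W₂ (k + 1)) with hT₂
    set T := transfer n (fun k => W (k + 1)) with hT
    have e1 : ∀ b₁ b₂, ∑ e : Fin (n + 1) → A, transfer (n + 1) W₁ c e b₁ c₁ *
        transfer (n + 1) W₂ e d b₂ c₂ = ∑ m₁, ∑ m₂,
          (∑ a', W₁ 0 (c 0) b₁ a' m₁ * W₂ 0 a' b₂ (d 0) m₂) *
            ∑ e : Fin n → A, T₁ (Fin.tail c) e m₁ c₁ * T₂ e (Fin.tail d) m₂ c₂ := by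
      intro b₁ b₂
      rw [sum_fin_cons]
      simp only [transfer, Fin.cons_zero, Fin.tail_cons, Finset.sum_mul_sum, ← hT₁, ← hT₂]
      simp only [Finset.sum_comm (s := (Finset.univ : Finset (Fin n → A)))]
      rw [Finset.sum_comm]
      refine Finset.sum_congr rfl fun m₁ _ => ?_
      rw [Finset.sum_comm]
      refine Finset.sum_congr rfl fun m₂ _ => ?_
      refine Finset.sum_congr rfl fun a' _ => ?_
      refine Finset.sum_congr rfl fun e _ => ?_
      ring
    simp only [e1, Finset.mul_sum (s := (Finset.univ : Finset B₁)),
      Finset.mul_sum (s := (Finset.univ : Finset B₂)), ← mul_assoc]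
    calc _ = ∑ m₁, ∑ m₂, (∑ b₁, ∑ b₂, M b b₁ b₂ * ∑ a', W₁ 0 (c 0) b₁ a' m₁ *
          W₂ 0 a' b₂ (d 0) m₂) *
            ∑ e : Fin n → A, T₁ (Fin.tail c) e m₁ c₁ * T₂ e (Fin.tail d) m₂ c₂ := by
          simp only [Finset.sum_mul (s := (Finset.univ : Finset B₁)),
            Finset.sum_mul (s := (Finset.univ : Finset B₂))]
          simp only [Finset.sum_comm (s := (Finset.univ : Finset B₂))
            (t := (Finset.univ : Finset B₁))]
          rw [Finset.sum_comm]
          refine Finset.sum_congr rfl fun m₁ _ => ?_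
          refine Finset.sum_congr rfl fun b₁ _ => ?_
          rw [Finset.sum_comm]
      _ = ∑ b', W 0 (c 0) b (d 0) b' * ∑ m₁, ∑ m₂, M b' m₁ m₂ *
            ∑ e : Fin n → A, T₁ (Fin.tail c) e m₁ c₁ * T₂ e (Fin.tail d) m₂ c₂ := by
          simp only [hloc, Finset.mul_sum (s := (Finset.univ : Finset B₁)),
            Finset.mul_sum (s := (Finset.univ : Finset B₂)),
            Finset.sum_mul (s := (Finset.univ : Finset B))]
          rw [Finset.sum_comm (s := (Finset.univ : Finset B))]
          refine Finset.sum_congr rfl fun m₁ _ => ?_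
          rw [Finset.sum_comm (s := (Finset.univ : Finset B))]
          simp only [mul_assoc]
      _ = _ := by
          simp only [ih']
          simp only [transfer, Finset.sum_mul, Finset.mul_sum, ← hT]
          rw [Finset.sum_comm]
          simp only [mul_assoc]

/-- Here the splitting acts on the vertical lines, independently at each site, so the local relation
is applied successively from the left end; the intermediate horizontal state is unchanged by the
splitting. -/
theorem transfer_intertwining {A X B : Type*} [Fintype A] [Fintype X] [Fintype B] [DecidableEq B]
    (n : ℕ) (L : A → X → ℝ) (T : ℕ → X → B → X → B → ℝ) (V : ℕ → A → B → A → B → ℝ)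
    (hloc : ∀ k a h x' h', ∑ x, L a x * T k x h x' h' = ∑ a', V k a h a' h' * L a' x')
    (c : Fin n → A) (ξ' : Fin n → X) (h h' : B) :
    ∑ ξ : Fin n → X, (∏ k, L (c k) (ξ k)) * transfer n T ξ ξ' h h'
      = ∑ c' : Fin n → A, transfer n V c c' h h' * ∏ k, L (c' k) (ξ' k) := by
  induction n generalizing T V h with
  | zero => simp [transfer]
  | succ n ih =>
    have ih' := ih (fun k => T (k + 1)) (fun k => V (k + 1)) (fun k => hloc (k + 1))
      (Fin.tail c) (Fin.tail ξ')
    simp only [sum_fin_cons, transfer, Fin.prod_univ_succ, Fin.cons_zero, Fin.tail_cons,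
      Fin.cons_succ]
    calc _ = ∑ m, (∑ x, L (c 0) x * T 0 x h (ξ' 0) m) * ∑ ξ : Fin n → X,
          (∏ k, L (Fin.tail c k) (ξ k)) *
            transfer n (fun k => T (k + 1)) ξ (Fin.tail ξ') m h' := by
          simp only [Finset.sum_mul_sum, Finset.mul_sum (s := (Finset.univ : Finset B))]
          symm
          rw [Finset.sum_comm]
          refine Finset.sum_congr rfl fun x _ => ?_
          rw [Finset.sum_comm]
          refine Finset.sum_congr rfl fun m _ => ?_
          refine Finset.sum_congr rfl fun ξ _ => ?_
          simp only [Fin.tail]; ring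
      _ = _ := by
          simp only [hloc, ih', Finset.sum_mul_sum, Finset.sum_mul (s := (Finset.univ : Finset B))]
          rw [Finset.sum_comm]
          refine Finset.sum_congr rfl fun a _ => ?_
          rw [Finset.sum_comm]
          refine Finset.sum_congr rfl fun c' _ => ?_
          refine Finset.sum_congr rfl fun m _ => ?_
          simp only [Fin.tail]; ring

end Transfer

/-! ### Sequential description of the splitting matrix. -/

section Split

/-- After reversal the first site carries the largest exponent `n`, which is the source of the
factor `q^n`. -/
theorem lambdaWeight_rev_cons (q : ℝ) (n v : ℕ) (u : Fin 2) (w : Fin n → Fin 2) :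
    lambdaWeight q (n + 1) v (fun r => (Fin.cons u w : Fin (n + 1) → Fin 2) r.rev) =
      q ^ (n * (u : ℕ)) *
        if (u : ℕ) ≤ v then lambdaWeight q n (v - u) (fun r => w r.rev) else 0 := by
  unfold lambdaWeight
  simp only [Fin.sum_univ_castSucc, Fin.rev_castSucc, Fin.cons_succ, Fin.rev_last, Fin.cons_zero,
    Fin.val_castSucc, Fin.val_last]
  by_cases h : (u : ℕ) ≤ v
  · rw [if_pos h]
    by_cases h' : ∑ r : Fin n, (w r.rev : ℕ) = v - u
    · rw [if_pos h', if_pos (by omega), pow_add]; ring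
    · rw [if_neg h', if_neg (by omega), mul_zero]
  · rw [if_neg h, if_neg (by omega), mul_zero]

theorem sum_comp_rev {n : ℕ} (f : (Fin n → Fin 2) → ℝ) :
    ∑ w : Fin n → Fin 2, f (fun r => w r.rev) = ∑ w, f w :=
  (Equiv.arrowCongr Fin.revPerm (Equiv.refl (Fin 2))).sum_comp f

/-- The normalizing constant `Z_{v,n}`. -/
noncomputable def lambdaNorm (q : ℝ) (n v : ℕ) : ℝ := ∑ u : Fin n → Fin 2, lambdaWeight q n v u

theorem lambdaNorm_succ (q : ℝ) (n v : ℕ) :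
    lambdaNorm q (n + 1) v = lambdaNorm q n v + q ^ n *
      if 1 ≤ v then lambdaNorm q n (v - 1) else 0 := by
  unfold lambdaNorm
  rw [← sum_comp_rev, sum_fin_cons, Fin.sum_univ_two]
  simp only [lambdaWeight_rev_cons]
  simp only [Fin.val_zero, Fin.val_one, Nat.zero_le, if_true, mul_zero, pow_zero, one_mul,
    Nat.sub_zero, mul_one, ← Finset.mul_sum]
  rw [sum_comp_rev (lambdaWeight q n v)]
  split_ifs
  · rw [sum_comp_rev (lambdaWeight q n (v - 1))]
  · simp

/-- The normalization is `q^{v(v-1)/2}` times a Gaussian binomial coefficient. Only the ratio of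
consecutive values is needed, and it follows from the `q`-Pascal rule `lambdaNorm_succ`. -/
theorem lambdaNorm_ratio (q : ℝ) (n v : ℕ) :
    (1 - q ^ (v + 1)) * lambdaNorm q n (v + 1) = (q ^ v - q ^ n) * lambdaNorm q n v := by
  induction n generalizing v with
  | zero =>
    rcases v with _ | v <;> simp [lambdaNorm, lambdaWeight]
  | succ n ih =>
    have h1 := ih v
    rw [lambdaNorm_succ, lambdaNorm_succ, if_pos (by omega), Nat.add_sub_cancel]
    rcases v with _ | v
    · simp only [nonpos_iff_eq_zero, one_ne_zero, if_false]
      linear_combination h1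
    · have h2 := ih v
      rw [if_pos (by omega), Nat.add_sub_cancel]
      linear_combination h1 + q ^ (n + 1) * h2

theorem lambdaNorm_pos {q : ℝ} (hq : 0 < q) {n v : ℕ} (hv : v ≤ n) : 0 < lambdaNorm q n v := by
  have hnn : ∀ n v, 0 ≤ lambdaNorm q n v := fun n v =>
    Finset.sum_nonneg fun u _ => by unfold lambdaWeight; split_ifs <;> positivity
  induction n generalizing v with
  | zero =>
    obtain rfl : v = 0 := by omega
    simp [lambdaNorm, lambdaWeight]
  | succ n ih =>
    rw [lambdaNorm_succ]
    have h0 := hnn n v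
    rcases v with _ | v
    · simpa using ih (Nat.zero_le n)
    · have := mul_pos (pow_pos hq n) (ih (by omega : v ≤ n))
      simp only [le_add_iff_nonneg_left, zero_le, if_true, Nat.add_sub_cancel]
      linarith

/-- The sites of a block can be sampled one after the other, because the remaining sites are again
split by `Λ'`. The ratio of normalizing constants is evaluated by `lambdaNorm_ratio`. -/
theorem lambdaMat'_cons {q : ℝ} (hq : 0 < q) (hq1 : q ≠ 1) {n v : ℕ} (hv : v ≤ n + 1) (u : Fin 2)
    (w : Fin n → Fin 2) :
    lambdaMat' q (n + 1) v (Fin.cons u w) = headProb q n v u * lambdaMat' q n (v - u) w := by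
  unfold lambdaMat' lambdaMat
  rw [lambdaWeight_rev_cons]
  change (lambdaNorm q (n + 1) v)⁻¹ * _ = _ * ((lambdaNorm q n (v - u))⁻¹ * _)
  have hd : 1 - q ^ (n + 1) ≠ 0 := by
    rw [sub_ne_zero]
    intro h
    exact hq1 ((pow_eq_one_iff_of_nonneg hq.le (by omega)).1 h.symm)
  have hZ := lambdaNorm_pos hq hv
  unfold headProb
  have hs := lambdaNorm_succ q n v
  have hpow : q ^ (n + 1 - v) * q ^ v = q ^ (n + 1) := by rw [← pow_add]; congr 1; omega
  have hv0 : q ^ v ≠ 0 := (pow_pos hq _).ne'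
  have hu2 : (u : ℕ) < 2 := u.isLt
  rcases Nat.eq_zero_or_pos (u : ℕ) with hu | hu
  · rw [hu]
    simp only [mul_zero, pow_zero, one_mul, Nat.zero_le, if_true, Nat.sub_zero]
    rcases Nat.lt_or_ge n v with hv' | hv'
    · obtain rfl : v = n + 1 := by omega
      have : lambdaWeight q n (n + 1) (fun r => w r.rev) = 0 := by
        unfold lambdaWeight
        rw [if_neg]
        have : ∑ r : Fin n, (w r.rev : ℕ) ≤ ∑ _r : Fin n, 1 :=
          Finset.sum_le_sum fun r _ => by have := (w r.rev).isLt; omega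
        intro h
        beta_reduce at h
        simp only [Finset.sum_const, Finset.card_univ, Fintype.card_fin, smul_eq_mul] at this
        omega
      rw [this]; simp
    · have hZ' := lambdaNorm_pos hq hv'
      rw [← mul_assoc]
      congr 1
      rw [eq_comm, ← div_eq_mul_inv, div_div, div_eq_iff (mul_ne_zero hd hZ'.ne'), inv_mul_eq_div,
        eq_div_iff hZ.ne', hs]
      rcases v with _ | v
      · simp
      · have hr := lambdaNorm_ratio q n v
        rw [if_pos (by omega), Nat.add_sub_cancel]
        apply mul_right_cancel₀ hv0
        linear_combination (-(lambdaNorm q n (v + 1) + q ^ n * lambdaNorm q n v)) * hpow -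
          q ^ (n + 1) * hr
  · have hu1 : (u : ℕ) = 1 := by omega
    rw [hu1, if_neg one_ne_zero, mul_one]
    rcases v with _ | v
    · simp
    · have hZ' := lambdaNorm_pos hq (by omega : v ≤ n)
      simp only [le_add_iff_nonneg_left, zero_le, if_true, Nat.add_sub_cancel] at hs ⊢
      rw [← mul_assoc, ← mul_assoc]
      congr 1
      have hr := lambdaNorm_ratio q n v
      rw [eq_comm, ← div_eq_mul_inv, div_div, div_eq_iff (mul_ne_zero hd hZ'.ne'), mul_assoc,
        inv_mul_eq_div, eq_div_iff hZ.ne', hs]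
      apply mul_right_cancel₀ hv0
      linear_combination (lambdaNorm q n (v + 1) + q ^ n * lambdaNorm q n v) * hpow +
        q ^ (n + 1) * hr

end Split

/-! ### The two fusion relations in transfer form, and the row kernels. -/

section LocalRelations

variable {q α : ℝ} {I J : ℕ}

theorem lambdaMat'_of_ne (q : ℝ) {n v : ℕ} {w : Fin n → Fin 2} (h : ∑ r, (w r : ℕ) ≠ v) :
    lambdaMat' q n v w = 0 := by
  unfold lambdaMat' lambdaMat lambdaWeight
  rw [if_neg, mul_zero]
  rwa [← Equiv.sum_comp Fin.revPerm fun r => (w r : ℕ)] at h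

theorem sum_val_le {n : ℕ} (w : Fin n → Fin 2) : ∑ r, (w r : ℕ) ≤ n := by
  calc ∑ r, (w r : ℕ) ≤ ∑ _r : Fin n, 1 :=
        Finset.sum_le_sum fun r _ => Nat.le_of_lt_succ (w r).isLt
    _ = n := by simp

/-- The weights of the unfused vertices in a block, with parameters `α, αq, αq², …`. -/
noncomputable def siteWeight (q α : ℝ) (k : ℕ) (a h a' h' : Fin 2) : ℝ :=
  lineWeight q (α * q ^ k) q⁻¹ a h a' h'

theorem siteWeight_succ (q α : ℝ) :
    (fun k => siteWeight q α (k + 1)) = siteWeight q (α * q) := by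
  funext k a h a' h'; simp only [siteWeight, pow_succ', mul_assoc]

/-- Induction on the block length: the first site is split off by `lambdaMat'_cons`, the rest of the
block is a fused vertex at `αq` by induction, and `lineWeight_fusion` joins the two. -/
theorem sum_lambdaMat'_mul_transfer {n : ℕ} (hα : Nondegenerate q α (n + 1)) {i : ℕ} (hi : i ≤ n)
    (w' : Fin n → Fin 2) (h h' : Fin 2) :
    ∑ w, lambdaMat' q n i w * transfer n (siteWeight q α) w w' h h' =
      lineWeight q α (q ^ n)⁻¹ i h (∑ r, (w' r : ℕ)) h' *
        lambdaMat' q n (∑ r, (w' r : ℕ)) w' := by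
  induction n generalizing α i h with
  | zero =>
    obtain rfl : i = 0 := by omega
    have ha0 : 1 + α ≠ 0 := by simpa using hα.one_add_ne 0 (by omega)
    fin_cases h <;> fin_cases h' <;>
      simp [transfer, lambdaMat', lambdaMat, lambdaWeight, lineWeight, ha0, add_comm α 1]
  | succ n ih =>
    have ih' := fun {i : ℕ} (hi : i ≤ n) h => ih hα.shift hi (Fin.tail w') h
    have hm := sum_val_le (Fin.tail w')
    have hw' : ∑ r, (w' r : ℕ) = w' 0 + ∑ r, (Fin.tail w' r : ℕ) := by
      rw [Fin.sum_univ_succ]; rfl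
    have hcons : w' = Fin.cons (w' 0) (Fin.tail w') := (Fin.cons_self_tail w').symm
    set m := ∑ r, (Fin.tail w' r : ℕ) with hmdef
    have hlam : lambdaMat' q (n + 1) (w' 0 + m) w' =
        headProb q n (w' 0 + m) (w' 0) * lambdaMat' q n m (Fin.tail w') := by
      conv_lhs => rw [hcons]
      rw [Fin.cons_zero, lambdaMat'_cons hα.q_pos hα.q_ne_one
        (by have := (w' 0).isLt; omega) (w' 0) (Fin.tail w'), Nat.add_sub_cancel_left]
    have key := lineWeight_fusion (n := n) (hα.mono (by omega)) hi hm
      (Nat.le_of_lt_succ h.isLt) (Nat.le_of_lt_succ (w' 0).isLt) (Nat.le_of_lt_succ h'.isLt)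
    have term : ∀ u : Fin 2, ∑ w : Fin n → Fin 2, lambdaMat' q (n + 1) i (Fin.cons u w) *
        transfer (n + 1) (siteWeight q α) (Fin.cons u w) w' h h' =
        headProb q n i u * (∑ h₁ : Fin 2, lineWeight q α q⁻¹ u h (w' 0) h₁ *
          lineWeight q (α * q) (q ^ n)⁻¹ (i - u) h₁ m h') * lambdaMat' q n m (Fin.tail w') := by
      intro u
      simp only [lambdaMat'_cons hα.q_pos hα.q_ne_one hi, transfer, Fin.cons_zero, Fin.tail_cons,
        siteWeight_succ, Finset.mul_sum, Finset.sum_mul]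
      rw [Finset.sum_comm]
      refine Finset.sum_congr rfl fun h₁ _ => ?_
      by_cases hiu : i - (u : ℕ) ≤ n
      · have := ih' hiu h₁
        rw [mul_assoc, mul_assoc, ← this, Finset.mul_sum, Finset.mul_sum]
        refine Finset.sum_congr rfl fun w _ => ?_
        simp only [siteWeight, pow_zero, mul_one]; ring
      -- If all `n + 1` sites of the block are full, then the first one is not empty.
      · have : headProb q n i u = 0 := by
          have hu : (u : ℕ) = 0 := by omega
          have : i = n + 1 := by omega
          simp [headProb, hu, this]
        simp [this]
    rw [sum_fin_cons]
    simp only [term]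
    rw [Fin.sum_univ_two, ← add_mul, hw', hlam, ← mul_assoc, ← key]
    simp [Fin.sum_univ_two]

/-- The vertex weight as a function of the numbers of lines. -/
noncomputable def fusedWeight (q α : ℝ) (I J : ℕ) (a : Fin (I + 1)) (h : Fin (J + 1))
    (a' : Fin (I + 1)) (h' : Fin (J + 1)) : ℝ := vertexWeight q α I J a h a' h'

theorem fusedWeight_one (hα : Nondegenerate q α (I + 1)) (a a' : Fin (I + 1)) (h h' : Fin 2) :
    fusedWeight q α I 1 a h a' h' = lineWeight q α (q ^ I)⁻¹ a h a' h' := by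
  rw [← zpow_natCast, ← zpow_neg]
  exact vertexWeight_one_row hα (Nat.le_of_lt_succ a.isLt) (Nat.le_of_lt_succ a'.isLt)
    (Nat.le_of_lt_succ h.isLt) (Nat.le_of_lt_succ h'.isLt)

theorem lambdaMat'_intertwining (hα : Nondegenerate q α (I + 1)) (a : Fin (I + 1)) (h : Fin 2)
    (w' : Fin I → Fin 2) (h' : Fin 2) :
    ∑ w, lambdaMat' q I a w * transfer I (siteWeight q α) w w' h h' =
      ∑ a' : Fin (I + 1), fusedWeight q α I 1 a h a' h' * lambdaMat' q I a' w' := by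
  rw [sum_lambdaMat'_mul_transfer hα (Nat.le_of_lt_succ a.isLt)]
  have hs : ∑ r, (w' r : ℕ) < I + 1 := Nat.lt_succ_of_le (sum_val_le w')
  rw [Finset.sum_eq_single (⟨∑ r, (w' r : ℕ), hs⟩ : Fin (I + 1)), fusedWeight_one hα]
  · intro a' _ ha'
    rw [lambdaMat'_of_ne, mul_zero]
    exact fun e => ha' (Fin.ext e.symm)
  · simp

theorem sum_fin_eq_single {n : ℕ} (f : ℕ → ℝ) (m : ℕ) (h : ∀ k, k ≠ m → f k = 0)
    (h' : n ≤ m → f m = 0) : ∑ k : Fin n, f k = f m := by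
  rw [Fin.sum_univ_eq_sum_range]
  refine Finset.sum_eq_single m (fun k _ hk => h k hk) fun hm => h' ?_
  simpa using hm

/-- The probability under `Λ_{J+1}(j; ·)` that the first entry is `h` and the others sum to `k`. -/
noncomputable def splitProb (q : ℝ) (J j h k : ℕ) : ℝ :=
  if h + k = j then (if h = 0 then q ^ j - q ^ (J + 1) else 1 - q ^ j) / (1 - q ^ (J + 1)) else 0

/-- By conservation every inner sum has at most one nonzero term. What remains is
`vertexWeight_fusion_zero` or `vertexWeight_fusion_one`, according to `c₁`, divided by `1 -
q^{J+1}`. -/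
theorem fusedWeight_fusion (hα : Nondegenerate q α (I + J + 1)) (b : Fin (J + 2))
    (a a'' : Fin (I + 1)) (c₁ : Fin 2) (c₂ : Fin (J + 1)) :
    ∑ b₁ : Fin 2, ∑ b₂ : Fin (J + 1), splitProb q J b b₁ b₂ *
        ∑ a', fusedWeight q α I 1 a b₁ a' c₁ * fusedWeight q (α * q) I J a' b₂ a'' c₂
      = ∑ b' : Fin (J + 2), fusedWeight q α I (J + 1) a b a'' b' * splitProb q J b' c₁ c₂ := by
  have hc₁ := c₁.isLt
  have hc₂ := c₂.isLt
  have hb := b.isLt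
  have ha := a.isLt
  have ha'' := a''.isLt
  have hR : ∑ b' : Fin (J + 2), fusedWeight q α I (J + 1) a b a'' b' * splitProb q J b' c₁ c₂ =
      vertexWeight q α I (J + 1) a b a'' (c₁ + c₂ : ℕ) * splitProb q J (c₁ + c₂) c₁ c₂ :=
    sum_fin_eq_single (fun b' => vertexWeight q α I (J + 1) a b a'' b' * splitProb q J b' c₁ c₂)
      (c₁ + c₂ : ℕ) (fun k hk => by
        rw [splitProb, if_neg (fun h => hk h.symm), mul_zero]) (fun h => by omega)
  have hin : ∀ (b₁ : Fin 2) (b₂ : Fin (J + 1)),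
      ∑ a', fusedWeight q α I 1 a b₁ a' c₁ * fusedWeight q (α * q) I J a' b₂ a'' c₂ =
      lineWeight q α (q ^ I)⁻¹ a b₁ (a + b₁ - c₁ : ℕ) c₁ *
        vertexWeight q (α * q) I J (a + b₁ - c₁ : ℕ) b₂ a'' c₂ := by
    intro b₁ b₂
    have hb₁ := b₁.isLt
    simp only [fusedWeight_one (hα.mono (by omega : I + 1 ≤ I + J + 1))]
    simp only [fusedWeight]
    refine sum_fin_eq_single (fun a' => lineWeight q α (q ^ I)⁻¹ a b₁ a' c₁ *
        vertexWeight q (α * q) I J a' b₂ a'' c₂) _ (fun k hk => ?_) fun h => ?_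
    · rw [lineWeight_of_ne, zero_mul]; omega
    -- The forced intermediate value can leave the range only as `I + 1`, and then the weight `1 -
    -- q^{-I} q^I` is zero.
    · have e1 : (b₁ : ℕ) = 1 := by omega
      have e2 : (c₁ : ℕ) = 0 := by omega
      have e3 : (a : ℕ) = I := by omega
      have : lineWeight q α (q ^ I)⁻¹ a b₁ (a + b₁ - c₁ : ℕ) c₁ = 0 := by
        rw [e1, e2, e3]; simp [lineWeight, hα.q_pos.ne']
      rw [this, zero_mul]
  have hout : ∀ b₁ : Fin 2, ∑ b₂ : Fin (J + 1), splitProb q J b b₁ b₂ *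
      (lineWeight q α (q ^ I)⁻¹ a b₁ (a + b₁ - c₁ : ℕ) c₁ *
        vertexWeight q (α * q) I J (a + b₁ - c₁ : ℕ) b₂ a'' c₂) =
      splitProb q J b b₁ (b - b₁ : ℕ) * (lineWeight q α (q ^ I)⁻¹ a b₁ (a + b₁ - c₁ : ℕ) c₁ *
        vertexWeight q (α * q) I J (a + b₁ - c₁ : ℕ) (b - b₁ : ℕ) a'' c₂) := by
    intro b₁
    have hb₁ := b₁.isLt
    refine sum_fin_eq_single (fun b₂ => splitProb q J b b₁ b₂ *
      (lineWeight q α (q ^ I)⁻¹ a b₁ (a + b₁ - c₁ : ℕ) c₁ *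
        vertexWeight q (α * q) I J (a + b₁ - c₁ : ℕ) b₂ a'' c₂)) _ (fun k hk => ?_) fun h => ?_
    · rw [splitProb, if_neg, zero_mul]; omega
    · have e1 : (b₁ : ℕ) = 0 := by omega
      have e2 : (b : ℕ) = J + 1 := by omega
      simp [splitProb, e1, e2]
  simp only [hin, hout, hR]
  rw [Fin.sum_univ_two]
  simp only [Fin.val_zero, Fin.val_one, Nat.add_zero, Nat.sub_zero]
  have hIz : (q ^ I)⁻¹ = q ^ (-(I : ℤ)) := by rw [zpow_neg, zpow_natCast]
  by_cases hs : (a : ℕ) + b = a'' + (c₁ + c₂)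
  swap
  · rw [vertexWeight_of_ne _ _ _ _ hs, zero_mul]
    have z : ∀ k, k ≤ (b : ℕ) → lineWeight q α (q ^ I)⁻¹ a k (a + k - c₁ : ℕ) c₁ *
        vertexWeight q (α * q) I J (a + k - c₁ : ℕ) (b - k : ℕ) a'' c₂ = 0 := by
      intro k hk
      by_cases h1 : (a : ℕ) + k = (a + k - c₁ : ℕ) + c₁
      · rw [vertexWeight_of_ne _ _ _ _ (by omega), mul_zero]
      · rw [lineWeight_of_ne _ _ _ h1, zero_mul]
    have z0 := z 0 (Nat.zero_le _)
    simp only [Nat.add_zero, Nat.sub_zero] at z0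
    rw [z0, mul_zero, zero_add]
    rcases Nat.eq_zero_or_pos (b : ℕ) with hb0 | hb0
    · simp [splitProb, hb0]
    · rw [z 1 hb0, mul_zero]
  have hsplit1 : splitProb q J b 1 (b - 1 : ℕ) = (1 - q ^ (b : ℕ)) / (1 - q ^ (J + 1)) := by
    unfold splitProb
    rcases Nat.eq_zero_or_pos (b : ℕ) with hb0 | hb0
    · simp [hb0]
    · rw [if_pos (by omega), if_neg one_ne_zero]
  rw [hsplit1]
  rcases Nat.lt_or_ge 0 (c₁ : ℕ) with hc | hc
  · have hc1 : (c₁ : ℕ) = 1 := by omega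
    rw [hc1] at hs ⊢
    have key := vertexWeight_fusion_one hα (k := c₂) (by omega : (a : ℕ) + b = a'' + (c₂ + 1))
      (by omega) (by omega) (by omega)
    rw [add_comm 1 (c₂ : ℕ)]
    have l1 : lineWeight q α (q ^ I)⁻¹ a 0 (a - 1 : ℕ) 1 = α * (1 - q ^ (a : ℕ)) / (1 + α) := by
      rcases Nat.eq_zero_or_pos (a : ℕ) with h0 | h0
      · simp [lineWeight, h0]
      · unfold lineWeight
        rw [if_neg (by omega), if_pos (by omega)]
    have l2 : lineWeight q α (q ^ I)⁻¹ a 1 (a + 1 - 1 : ℕ) 1 =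
        (α + q ^ (-(I : ℤ)) * q ^ (a : ℕ)) / (1 + α) := by
      simp [lineWeight]
    rw [l1, l2]
    simp only [splitProb, zero_add, if_true, one_ne_zero, if_false, Nat.add_sub_cancel,
      add_comm 1 (c₂ : ℕ)]
    linear_combination (1 - q ^ (J + 1))⁻¹ * key
  · have hc0 : (c₁ : ℕ) = 0 := by omega
    rw [hc0] at hs ⊢
    rw [zero_add] at hs
    have key := vertexWeight_fusion_zero hα hs (by omega) (by omega) (by omega) (by omega)
    have l1 : lineWeight q α (q ^ I)⁻¹ a 0 (a - 0 : ℕ) 0 = (1 + α * q ^ (a : ℕ)) / (1 + α) := by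
      simp [lineWeight]
    have l2 : lineWeight q α (q ^ I)⁻¹ a 1 (a + 1 - 0 : ℕ) 0 =
        (1 - q ^ (-(I : ℤ)) * q ^ (a : ℕ)) / (1 + α) := by
      simp [lineWeight]
    rw [l1, l2]
    simp only [splitProb, zero_add, if_true, Nat.sub_zero]
    linear_combination (1 - q ^ (J + 1))⁻¹ * key

/-- The weight of the transition from `c` to `d` in a row without lines at both ends. -/
noncomputable def rowKernel (q α : ℝ) (I J : ℕ) {n : ℕ} (c d : Fin n → Fin (I + 1)) : ℝ :=
  transfer n (fun _ => fusedWeight q α I J) c d 0 0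

/-- Zero lines split only as `0 + 0`, with probability one, and only zero lines produce this
splitting. Hence the splitting matrices at the two ends disappear and a composition of kernels is
left. -/
theorem rowKernel_fusion (hα : Nondegenerate q α (I + J + 1)) {n : ℕ} (c d : Fin n → Fin (I + 1)) :
    ∑ e, rowKernel q α I 1 c e * rowKernel q (α * q) I J e d = rowKernel q α I (J + 1) c d := by
  have hd : 1 - q ^ (J + 1) ≠ 0 := by
    have := hα.one_sub_zpow_ne (k := (J + 1 : ℕ)) (by omega)
    rwa [zpow_natCast] at this
  have key := transfer_fusion n (fun _ => fusedWeight q α I 1) (fun _ => fusedWeight q (α * q) I J)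
    (fun _ => fusedWeight q α I (J + 1))
    (fun (b : Fin (J + 2)) (b₁ : Fin 2) (b₂ : Fin (J + 1)) => splitProb q J b b₁ b₂)
    (fun _ => fusedWeight_fusion hα) c d 0 0 0
  rw [Fintype.sum_eq_single (0 : Fin 2), Fintype.sum_eq_single (0 : Fin (J + 1)),
    Fintype.sum_eq_single (0 : Fin (J + 2))] at key
  · simpa [splitProb, hd, rowKernel] using key
  · intro b' hb'
    have : (b' : ℕ) ≠ 0 := fun h => hb' (Fin.ext h)
    simp [splitProb, this.symm]
  · intro b₂ hb₂
    have : (b₂ : ℕ) ≠ 0 := fun h => hb₂ (Fin.ext h)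
    simp [splitProb, this]
  · intro b₁ hb₁
    have : (b₁ : ℕ) ≠ 0 := fun h => hb₁ (Fin.ext h)
    refine Finset.sum_eq_zero fun b₂ _ => ?_
    simp [splitProb, this]

theorem rowKernel_intertwining (hα : Nondegenerate q α (I + 1)) {n : ℕ} (c : Fin n → Fin (I + 1))
    (ξ' : Fin n → Fin I → Fin 2) :
    ∑ ξ : Fin n → Fin I → Fin 2, (∏ k, lambdaMat' q I (c k) (ξ k)) *
        transfer n (fun _ w h w' h' => transfer I (siteWeight q α) w w' h h') ξ ξ' 0 0
      = ∑ c', rowKernel q α I 1 c c' * ∏ k, lambdaMat' q I (c' k) (ξ' k) :=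
  transfer_intertwining n (fun (a : Fin (I + 1)) w => lambdaMat' q I a w) _ _
    (fun _ a h x' h' => lambdaMat'_intertwining hα a h x' h') c ξ' 0 0

end LocalRelations

/-! ### The particle dynamics as a six-vertex row. -/

section Particles

/-- The probability that a particle which reaches `x` stops at `p'`, if it is passed on with
probability `β` at every site and cannot go beyond `r`. -/
noncomputable def stopProb (β : ℤ → ℝ) (x p' : ℤ) (r : Option ℤ) : ℝ :=
  if x ≤ p' ∧ ∀ y ∈ r, p' ≤ y then
    (∏ k ∈ Finset.Ico x p', β k) * (if r = some p' then 1 else 1 - β p') else 0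

theorem stopProb_of_gt (β : ℤ → ℝ) {x p' : ℤ} (r : Option ℤ) (h : p' < x) :
    stopProb β x p' r = 0 := by
  rw [stopProb, if_neg]; intro h'; omega

theorem stopProb_self (β : ℤ → ℝ) {x : ℤ} {r : Option ℤ} (h : ∀ y ∈ r, x < y) :
    stopProb β x x r = 1 - β x := by
  rw [stopProb, if_pos ⟨le_rfl, fun y hy => (h y hy).le⟩, if_neg, Finset.Ico_self,
    Finset.prod_empty, one_mul]
  intro hr; exact lt_irrefl _ (h x hr)

theorem stopProb_blocked (β : ℤ → ℝ) (x p' : ℤ) :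
    stopProb β x p' (some x) = if p' = x then 1 else 0 := by
  unfold stopProb
  by_cases h : p' = x
  · subst h; simp
  · rw [if_neg h, if_neg]; simp; omega

theorem stopProb_succ (β : ℤ → ℝ) {x p' : ℤ} {r : Option ℤ} (hp : x < p') :
    stopProb β x p' r = β x * stopProb β (x + 1) p' r := by
  unfold stopProb
  by_cases h : ∀ y ∈ r, p' ≤ y
  · rw [if_pos (And.intro hp.le h), if_pos (And.intro (Int.add_one_le_iff.2 hp) h), ← mul_assoc]
    congr 1
    rw [← Finset.prod_insert (by simp)]
    congr 1
    ext k; simp; omega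
  · rw [if_neg (fun h' => h h'.2), if_neg (fun h' => h h'.2), mul_zero]

/-- The probability of the transition `l → l'` of the particle dynamics with parameters `β₁`, `β₂`;
`b` tells whether the previous particle has moved to the position of the first one. -/
noncomputable def stepProb (β₁ β₂ : ℤ → ℝ) : Bool → List ℤ → List ℤ → ℝ
  | _, [], [] => 1
  | b, p :: ps, p' :: ps' =>
      (if b = false ∧ p' = p then β₁ p
        else (if b then 1 else 1 - β₁ p) * stopProb β₂ (p + 1) p' ps.head?) *
      stepProb β₁ β₂ (decide (ps.head? = some p')) ps ps'
  | _, _, _ => 0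

theorem stepProb_of_length_ne (β₁ β₂ : ℤ → ℝ) (b : Bool) {l l' : List ℤ}
    (h : l.length ≠ l'.length) : stepProb β₁ β₂ b l l' = 0 := by
  induction l generalizing b l' with
  | nil => cases l' <;> simp_all [stepProb]
  | cons p ps ih =>
    cases l' with
    | nil => simp [stepProb]
    | cons p' ps' => rw [stepProb, ih _ (by simpa using h), mul_zero]

/-- The probability of the transition `l → l'` if `h` particles from the left reach `x`. -/
noncomputable def carryProb (β₁ β₂ : ℤ → ℝ) (h : Fin 2) (x : ℤ) (l l' : List ℤ) : ℝ :=
  if h = 0 then stepProb β₁ β₂ false l l' else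
    match l' with
    | [] => 0
    | p' :: ps' => stopProb β₂ x p' l.head? *
        stepProb β₁ β₂ (decide (l.head? = some p')) l ps'

/-- The stochastic six vertex weights. -/
noncomputable def sixVertex (β₁ β₂ : ℝ) (a h a' h' : Fin 2) : ℝ :=
  match a, h, a', h' with
  | 0, 0, 0, 0 => 1
  | 1, 1, 1, 1 => 1
  | 1, 0, 1, 0 => β₁
  | 1, 0, 0, 1 => 1 - β₁
  | 0, 1, 0, 1 => β₂
  | 0, 1, 1, 0 => 1 - β₂
  | _, _, _, _ => 0

/-- Adds the site `x` to the list `l` if `a = 1`. -/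
def consIf (a : Fin 2) (x : ℤ) (l : List ℤ) : List ℤ := if a = 1 then x :: l else l

theorem head?_ne_of_lt {l : List ℤ} {x : ℤ} (h : ∀ y ∈ l, x < y) : ∀ y ∈ l.head?, x < y :=
  fun y hy => h y (List.mem_of_mem_head? hy)

/-- The information passed from `x` to `x + 1` is whether a moving particle crosses the edge. A
mover reaching an occupied site must stop there and pushes the resident on, which is the weight `1`
of `(1,1;1,1)`; an empty site passes it on with probability `β₂ x`; an unpushed resident stays with
probability `β₁ x`. -/
theorem carryProb_consIf (β₁ β₂ : ℤ → ℝ) (a a' h : Fin 2) (x : ℤ) {l l' : List ℤ}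
    (hl : ∀ y ∈ l, x < y) (hl' : ∀ y ∈ l', x < y) :
    carryProb β₁ β₂ h x (consIf a x l) (consIf a' x l') =
      ∑ h', sixVertex (β₁ x) (β₂ x) a h a' h' * carryProb β₁ β₂ h' (x + 1) l l' := by
  have hh := head?_ne_of_lt hl
  have hx : l.head? ≠ some x := fun e => lt_irrefl _ (hh x e)
  rw [Fin.sum_univ_two]
  fin_cases h <;> fin_cases a <;> fin_cases a'
  · simp [carryProb, consIf, sixVertex]
  · cases l with
    | nil => simp [carryProb, consIf, sixVertex, stepProb]
    | cons p ps =>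
      have hp : x < p := hl p (by simp)
      simp [carryProb, consIf, sixVertex, stepProb, hp.ne, stopProb_of_gt β₂ _ (by omega : x < p + 1)]
  · cases l' with
    | nil => simp [carryProb, consIf, sixVertex, stepProb]
    | cons p' ps' =>
      have hp : x < p' := hl' p' (by simp)
      simp [carryProb, consIf, sixVertex, stepProb, hp.ne', mul_assoc]
  · simp [carryProb, consIf, sixVertex, stepProb, hx]
  · cases l' with
    | nil => simp [carryProb, consIf, sixVertex]
    | cons p' ps' =>
      have hp : x < p' := hl' p' (by simp)
      simp [carryProb, consIf, sixVertex, stopProb_succ β₂ hp, mul_assoc]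
  · simp [carryProb, consIf, sixVertex, stopProb_self β₂ hh, hx]
  · cases l' with
    | nil => simp [carryProb, consIf, sixVertex]
    | cons p' ps' =>
      have hp : x < p' := hl' p' (by simp)
      simp [carryProb, consIf, sixVertex, stopProb_blocked, hp.ne']
  · cases l' with
    | nil => simp [carryProb, consIf, sixVertex, stepProb]
    | cons p' ps' =>
      simp [carryProb, consIf, sixVertex, stepProb, stopProb_blocked]

/-- The positions of the particles of `w` on the sites `x, x + 1, …`, followed by `l`. -/
def siteList : (n : ℕ) → ℤ → (Fin n → Fin 2) → List ℤ → List ℤ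
  | 0, _, _, l => l
  | n + 1, x, w, l => consIf (w 0) x (siteList n (x + 1) (Fin.tail w) l)

theorem mem_siteList {n : ℕ} {x y : ℤ} {w : Fin n → Fin 2} {l : List ℤ} :
    y ∈ siteList n x w l ↔ (∃ r : Fin n, w r = 1 ∧ y = x + r) ∨ y ∈ l := by
  induction n generalizing x with
  | zero => simp [siteList]
  | succ n ih =>
    have : y ∈ siteList (n + 1) x w l ↔
        (w 0 = 1 ∧ y = x) ∨ y ∈ siteList n (x + 1) (Fin.tail w) l := by
      simp only [siteList, consIf]; split_ifs with h <;> simp [h]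
    rw [this, ih, Fin.exists_fin_succ, or_assoc]
    simp [Fin.tail, add_assoc, add_comm (1 : ℤ)]

theorem le_of_mem_siteList {n : ℕ} {x : ℤ} {w : Fin n → Fin 2} {l : List ℤ}
    (hl : ∀ y ∈ l, x + n ≤ y) : ∀ y ∈ siteList n x w l, x ≤ y := by
  intro y hy
  rcases mem_siteList.1 hy with ⟨r, _, rfl⟩ | hy
  · omega
  · have := hl y hy; omega

theorem pairwise_siteList {n : ℕ} {x : ℤ} {w : Fin n → Fin 2} {l : List ℤ}
    (hl : ∀ y ∈ l, x + n ≤ y) (hs : l.Pairwise (· < ·)) : (siteList n x w l).Pairwise (· < ·) := by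
  induction n generalizing x with
  | zero => exact hs
  | succ n ih =>
    have hl' : ∀ y ∈ l, x + 1 + n ≤ y := fun y hy => by have := hl y hy; push_cast at this; omega
    simp only [siteList, consIf]
    split_ifs
    · exact List.pairwise_cons.2 ⟨fun y hy => by
        have := le_of_mem_siteList hl' y hy; omega, ih hl'⟩
    · exact ih hl'

theorem carryProb_siteList (β₁ β₂ : ℤ → ℝ) (n : ℕ) (w w' : Fin n → Fin 2) (h : Fin 2) (x : ℤ)
    {l l' : List ℤ} (hl : ∀ y ∈ l, x + n ≤ y) (hl' : ∀ y ∈ l', x + n ≤ y) :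
    carryProb β₁ β₂ h x (siteList n x w l) (siteList n x w' l') =
      ∑ h', transfer n (fun k => sixVertex (β₁ (x + k)) (β₂ (x + k))) w w' h h' *
        carryProb β₁ β₂ h' (x + n) l l' := by
  induction n generalizing x h with
  | zero => simp [siteList, transfer]
  | succ n ih =>
    have hl1 : ∀ y ∈ l, x + 1 + n ≤ y := fun y hy => by have := hl y hy; push_cast at this; omega
    have hl1' : ∀ y ∈ l', x + 1 + n ≤ y := fun y hy => by
      have := hl' y hy; push_cast at this; omega
    have e : (fun k : ℕ => sixVertex (β₁ (x + 1 + k)) (β₂ (x + 1 + k))) =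
        fun k : ℕ => sixVertex (β₁ (x + (k + 1 : ℕ))) (β₂ (x + (k + 1 : ℕ))) := by
      funext k; rw [show x + 1 + (k : ℤ) = x + (k + 1 : ℕ) by push_cast; ring]
    simp only [siteList]
    rw [carryProb_consIf _ _ _ _ _ _
      (fun y hy => by have := le_of_mem_siteList hl1 y hy; omega)
      (fun y hy => by have := le_of_mem_siteList hl1' y hy; omega)]
    simp only [ih _ _ _ _ hl1 hl1', transfer, e, Finset.mul_sum, Finset.sum_mul]
    rw [Finset.sum_comm]
    refine Finset.sum_congr rfl fun h' _ => Finset.sum_congr rfl fun h₁ _ => ?_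
    rw [show x + 1 + (n : ℤ) = x + (n + 1 : ℕ) by push_cast; ring]
    simp [mul_assoc]

/-- The positions of the particles of the blocks `ξ 0, ξ 1, …`, the first of which starts at `x`. -/
def blockList (I : ℕ) : (n : ℕ) → ℤ → (Fin n → Fin I → Fin 2) → List ℤ
  | 0, _, _ => []
  | n + 1, x, ξ => siteList I x (ξ 0) (blockList I n (x + I) (Fin.tail ξ))

theorem mem_blockList {I n : ℕ} {x y : ℤ} {ξ : Fin n → Fin I → Fin 2} :
    y ∈ blockList I n x ξ ↔ ∃ (k : Fin n) (r : Fin I), ξ k r = 1 ∧ y = x + k * I + r := by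
  induction n generalizing x with
  | zero => simp [blockList]
  | succ n ih =>
    simp only [blockList]
    rw [mem_siteList, ih, Fin.exists_fin_succ]
    simp [Fin.tail, add_mul, add_assoc, add_comm]

theorem le_of_mem_blockList {I n : ℕ} {x : ℤ} {ξ : Fin n → Fin I → Fin 2} :
    ∀ y ∈ blockList I n x ξ, x ≤ y := by
  intro y hy
  obtain ⟨k, r, _, rfl⟩ := mem_blockList.1 hy
  have : (0 : ℤ) ≤ (k : ℕ) * (I : ℤ) := by positivity
  omega

theorem pairwise_blockList {I n : ℕ} {x : ℤ} {ξ : Fin n → Fin I → Fin 2} :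
    (blockList I n x ξ).Pairwise (· < ·) := by
  induction n generalizing x with
  | zero => exact List.Pairwise.nil
  | succ n ih => exact pairwise_siteList le_of_mem_blockList ih

theorem transfer_congr {A B : Type*} [Fintype B] [DecidableEq B] {n : ℕ}
    {W W' : ℕ → A → B → A → B → ℝ} (hW : ∀ k < n, W k = W' k) (c d : Fin n → A) (h h' : B) :
    transfer n W c d h h' = transfer n W' c d h h' := by
  induction n generalizing W W' h with
  | zero => rfl
  | succ n ih =>
    simp only [transfer]
    rw [hW 0 (by omega)]
    refine Finset.sum_congr rfl fun h₁ _ => ?_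
    rw [ih (fun k hk => hW (k + 1) (by omega))]

theorem carryProb_blockList (β₁ β₂ : ℤ → ℝ) {I : ℕ} (n : ℕ) (W : ℕ → Fin 2 → Fin 2 → Fin 2 → Fin 2 → ℝ)
    (ξ ξ' : Fin n → Fin I → Fin 2) (h : Fin 2) (a : ℤ)
    (hW : ∀ (b : ℤ), ∀ k < I, sixVertex (β₁ (b * I + k)) (β₂ (b * I + k)) = W k) :
    carryProb β₁ β₂ h (a * I) (blockList I n (a * I) ξ) (blockList I n (a * I) ξ') =
      transfer n (fun _ w h w' h' => transfer I W w w' h h') ξ ξ' h 0 := by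
  induction n generalizing a h with
  -- No sites remain, so a line that is still moving has nowhere to stop and gets mass `0`: this
  -- forces `0` lines at the right end.
  | zero => fin_cases h <;> simp [blockList, transfer, carryProb, stepProb]
  | succ n ih =>
    simp only [blockList, transfer]
    rw [carryProb_siteList _ _ _ _ _ _ _ le_of_mem_blockList le_of_mem_blockList]
    rw [show a * (I : ℤ) + I = (a + 1) * I by ring]
    simp only [ih, transfer_congr (hW a)]

theorem stepProb_blockList (β₁ β₂ : ℤ → ℝ) {I : ℕ} (n : ℕ) (W : ℕ → Fin 2 → Fin 2 → Fin 2 → Fin 2 → ℝ)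
    (ξ ξ' : Fin n → Fin I → Fin 2) (a : ℤ)
    (hW : ∀ (b : ℤ), ∀ k < I, sixVertex (β₁ (b * I + k)) (β₂ (b * I + k)) = W k) :
    stepProb β₁ β₂ false (blockList I n (a * I) ξ) (blockList I n (a * I) ξ') =
      transfer n (fun _ w h w' h' => transfer I W w w' h h') ξ ξ' 0 0 := by
  rw [← carryProb_blockList β₁ β₂ n W ξ ξ' 0 a hW]; rfl

theorem exists_blockList {I : ℕ} (n : ℕ) (a : ℤ) {l : List ℤ} (hs : l.Pairwise (· < ·))
    (hl : ∀ y ∈ l, a * I ≤ y ∧ y < (a + n) * I) :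
    ∃ ξ : Fin n → Fin I → Fin 2, blockList I n (a * I) ξ = l := by
  refine ⟨fun k r => if a * I + k * I + r ∈ l then 1 else 0, ?_⟩
  refine List.Perm.eq_of_pairwise' (r := (· < ·)) pairwise_blockList hs ?_
  rw [List.perm_ext_iff_of_nodup (pairwise_blockList.imp ne_of_lt) (hs.imp ne_of_lt)]
  intro y
  rw [mem_blockList]
  constructor
  · rintro ⟨k, r, h, rfl⟩
    by_contra hy
    simp [hy] at h
  · intro hy
    obtain ⟨h1, h2⟩ := hl y hy
    rcases Nat.eq_zero_or_pos I with rfl | hI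
    · simp at h1 h2; omega
    have hI' : (0 : ℤ) < I := by exact_mod_cast hI
    have e := Int.emod_add_mul_ediv (y - a * I) I
    have m0 := Int.emod_nonneg (y - a * I) hI'.ne'
    have m1 := Int.emod_lt_of_pos (y - a * I) hI'
    have d0 : 0 ≤ (y - a * I) / I := Int.ediv_nonneg (by omega) hI'.le
    have d1 : (y - a * I) / I < n := by
      apply Int.ediv_lt_of_lt_mul hI'
      linarith [add_mul a (n : ℤ) (I : ℤ)]
    obtain ⟨k, hk⟩ := Int.eq_ofNat_of_zero_le d0
    obtain ⟨r, hr⟩ := Int.eq_ofNat_of_zero_le m0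
    rw [hk, hr] at e
    rw [hk] at d1
    rw [hr] at m1
    have ey : a * I + k * I + r = y := by linarith [mul_comm (k : ℤ) (I : ℤ)]
    refine ⟨⟨k, by omega⟩, ⟨r, by omega⟩, ?_, ey.symm⟩
    simp [ey, hy]

end Particles

/-! ### Pathwise analysis of one update. -/

section Update

/-- The minimum of `a` and `r`, where `none` stands for `+∞`. -/
def minOption (a : ℤ) : Option ℤ → ℤ
  | none => a
  | some r => min a r

theorem s6vUpdate_cons (χ j : ℤ → ℕ) (prev : WithBot ℤ) (p : ℤ) (ps : List ℤ) :
    s6vUpdate χ j prev (p :: ps) =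
      (if prev < (p : WithBot ℤ) ∧ χ p = 1 then p else minOption (p + j p) ps.head?) ::
        s6vUpdate χ j ((if prev < (p : WithBot ℤ) ∧ χ p = 1 then p
          else minOption (p + j p) ps.head? : ℤ) : WithBot ℤ) ps := by
  cases ps with
  | nil => simp [s6vUpdate, minOption]
  | cons r ps => rfl

theorem length_s6vUpdate (χ j : ℤ → ℕ) (prev : WithBot ℤ) (l : List ℤ) :
    (s6vUpdate χ j prev l).length = l.length := by
  induction l generalizing prev with
  | nil => rfl
  | cons p ps ih => rw [s6vUpdate_cons]; simp [ih]

theorem minOption_le (a : ℤ) {r : Option ℤ} : ∀ y ∈ r, minOption a r ≤ y := by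
  intro y hy; cases hy; exact min_le_right _ _

theorem le_minOption {a b : ℤ} {r : Option ℤ} (h : b ≤ a) (hr : ∀ y ∈ r, b ≤ y) :
    b ≤ minOption a r := by
  cases r with
  | none => exact h
  | some r => exact le_min h (hr r rfl)

theorem s6vUpdate_congr {χ j χ' j' : ℤ → ℕ} (prev : WithBot ℤ) {l : List ℤ}
    (h : ∀ x ∈ l, χ x = χ' x ∧ j x = j' x) :
    s6vUpdate χ j prev l = s6vUpdate χ' j' prev l := by
  induction l generalizing prev with
  | nil => rfl
  | cons p ps ih =>
    rw [s6vUpdate_cons, s6vUpdate_cons, (h p (by simp)).1, (h p (by simp)).2,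
      ih _ fun x hx => h x (by simp [hx])]

/-- If all jumps are positive, then the new positions are increasing, and each particle moves to
the right. -/
theorem s6vUpdate_spec {χ j : ℤ → ℕ} (hj : ∀ x, 1 ≤ j x) (prev : WithBot ℤ) {l : List ℤ}
    (hl : l.Pairwise (· < ·)) (hprev : ∀ p ∈ l.head?, prev ≤ (p : WithBot ℤ)) :
    (s6vUpdate χ j prev l).Pairwise (· < ·) ∧
      (∀ y ∈ s6vUpdate χ j prev l, prev < (y : WithBot ℤ)) ∧
      List.Forall₂ (· ≤ ·) l (s6vUpdate χ j prev l) := by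
  induction l generalizing prev with
  | nil => simp [s6vUpdate]
  | cons p ps ih =>
    rw [s6vUpdate_cons]
    set p' := if prev < (p : WithBot ℤ) ∧ χ p = 1 then p else minOption (p + j p) ps.head? with hp'
    obtain ⟨h1, h2⟩ := List.pairwise_cons.1 hl
    have hhead : ∀ y ∈ ps.head?, p < y := head?_ne_of_lt h1
    have hle : p ≤ p' := by
      rw [hp']; split_ifs
      · exact le_rfl
      · exact le_minOption (by omega) fun y hy => (hhead y hy).le
    have hlt : prev < (p' : WithBot ℤ) := by
      have h0 : prev ≤ (p : WithBot ℤ) := hprev p (by simp)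
      rcases h0.lt_or_eq with h | h
      · exact h.trans_le (by exact_mod_cast hle)
      · rw [h, hp', if_neg (by simp [h])]
        have : p + 1 ≤ minOption (p + j p) ps.head? :=
          le_minOption (by have := hj p; omega) fun y hy => hhead y hy
        exact_mod_cast Int.lt_of_add_one_le this
    have hnext : ∀ y ∈ ps.head?, (p' : WithBot ℤ) ≤ (y : WithBot ℤ) := by
      intro y hy
      rw [hp']; split_ifs
      · exact_mod_cast (hhead y hy).le
      · exact_mod_cast minOption_le _ y hy
    obtain ⟨i1, i2, i3⟩ := ih (p' : WithBot ℤ) h2 hnext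
    refine ⟨List.pairwise_cons.2 ⟨fun y hy => by exact_mod_cast i2 y hy, i1⟩, ?_,
      List.Forall₂.cons hle i3⟩
    intro y hy
    rcases List.mem_cons.1 hy with rfl | hy
    · exact hlt
    · exact hlt.trans (i2 y hy)

/-- The event that the update leads from `l` to `l'` is a product event, whose probability is
`stepProb`. -/
theorem exists_rectangle (β₁ β₂ : ℤ → ℝ) (m₁ m₂ : ℤ → Set ℕ → ℝ)
    (hm₁ : ∀ x, m₁ x {1} = β₁ x) (hm₁' : ∀ x, m₁ x {1}ᶜ = 1 - β₁ x)
    (hm₁u : ∀ x, m₁ x Set.univ = 1) (hm₂u : ∀ x, m₂ x Set.univ = 1) (hm₂e : ∀ x, m₂ x ∅ = 0)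
    (hm₂ : ∀ x p' r, (∀ y ∈ r, x < y) →
      m₂ x {n | minOption (x + n) r = p'} = stopProb β₂ (x + 1) p' r)
    {l l' : List ℤ} (hl : l.Pairwise (· < ·)) (hlen : l.length = l'.length) (prev : WithBot ℤ)
    (b : Bool) (hb : ∀ p ∈ l.head?, (prev < (p : WithBot ℤ) ↔ b = false)) :
    ∃ A B : ℤ → Set ℕ,
      (∀ χ j : ℤ → ℕ, (∀ x, 1 ≤ j x) →
        (s6vUpdate χ j prev l = l' ↔ ∀ x ∈ l, χ x ∈ A x ∧ j x ∈ B x)) ∧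
      ∏ x ∈ l.toFinset, m₁ x (A x) * m₂ x (B x) = stepProb β₁ β₂ b l l' := by
  induction l generalizing l' prev b with
  | nil =>
    cases l' with
    | nil => exact ⟨fun _ => ∅, fun _ => ∅, by simp [s6vUpdate], by simp [stepProb]⟩
    | cons p' ps' => simp at hlen
  | cons p ps ih =>
    cases l' with
    | nil => simp at hlen
    | cons p' ps' =>
      obtain ⟨h1, h2⟩ := List.pairwise_cons.1 hl
      have hhead : ∀ y ∈ ps.head?, p < y := head?_ne_of_lt h1
      have hp : p ∉ ps := fun h => lt_irrefl _ (h1 p h)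
      have hbp := hb p (by simp)
      by_cases hr : ∀ y ∈ ps.head?, p' ≤ y
      swap
      -- A target beyond the next particle is never reached, so the event is empty and its
      -- probability is zero.
      · refine ⟨fun _ => ∅, fun _ => ∅, fun χ j hj => ?_, ?_⟩
        · constructor
          · intro h
            rw [s6vUpdate_cons] at h
            obtain ⟨h, -⟩ := List.cons.inj h
            exfalso
            apply hr
            intro y hy
            rw [← h]; split_ifs
            · exact (hhead y hy).le
            · exact minOption_le _ y hy
          · intro h; exact absurd (h p (by simp)).1 (by simp)
        · rw [Finset.prod_eq_zero (i := p) (by simp) (by simp [hm₂e]), stepProb]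
          have : p' ≠ p := fun e => hr fun y hy => by rw [e]; exact (hhead y hy).le
          have hz : stopProb β₂ (p + 1) p' ps.head? = 0 := by
            rw [stopProb, if_neg (fun h => hr h.2)]
          rw [if_neg (by simp [this]), hz]; simp
      obtain ⟨A, B, hAB, hprod⟩ := ih (l' := ps') h2 (by simpa using hlen) (p' : WithBot ℤ)
        (decide (ps.head? = some p')) (fun y hy => by
          have h0 := hr y hy
          have e : ps.head? = some y := hy
          rw [e]
          simp only [Option.some.injEq, decide_eq_false_iff_not]
          rw [WithBot.coe_lt_coe]; omega)
      -- It suffices to describe the first particle by sets at `p`. Overriding the sets of the tail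
      -- there is harmless, because `p` is not one of the remaining positions.
      have main : ∀ (A₀ B₀ : Set ℕ), (∀ (χ₀ j₀ : ℕ), 1 ≤ j₀ →
            ((if prev < (p : WithBot ℤ) ∧ χ₀ = 1 then p else minOption (p + j₀) ps.head?) = p' ↔
              χ₀ ∈ A₀ ∧ j₀ ∈ B₀)) →
          m₁ p A₀ * m₂ p B₀ = (if b = false ∧ p' = p then β₁ p
            else (if b then 1 else 1 - β₁ p) * stopProb β₂ (p + 1) p' ps.head?) →
          ∃ A B : ℤ → Set ℕ, (∀ χ j : ℤ → ℕ, (∀ x, 1 ≤ j x) →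
            (s6vUpdate χ j prev (p :: ps) = p' :: ps' ↔
              ∀ x ∈ p :: ps, χ x ∈ A x ∧ j x ∈ B x)) ∧
          ∏ x ∈ (p :: ps).toFinset, m₁ x (A x) * m₂ x (B x) =
            stepProb β₁ β₂ b (p :: ps) (p' :: ps') := by
        intro A₀ B₀ hiff hw
        refine ⟨Function.update A p A₀, Function.update B p B₀, fun χ j hj => ?_, ?_⟩
        · rw [s6vUpdate_cons, List.cons.injEq, hiff _ _ (hj p), List.forall_mem_cons]
          simp only [Function.update_self]
          refine and_congr_right fun h => ?_
          rw [(hiff _ _ (hj p)).2 h, hAB χ j hj]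
          refine forall₂_congr fun x hx => ?_
          have : x ≠ p := fun e => hp (e ▸ hx)
          simp [this]
        · rw [List.toFinset_cons, Finset.prod_insert (by simpa using hp)]
          simp only [Function.update_self]
          rw [hw, stepProb, ← hprod]
          congr 1
          refine Finset.prod_congr rfl fun x hx => ?_
          have : x ≠ p := fun e => hp (by simpa [e] using hx)
          simp [this]
      cases b with
      | true =>
        have hnlt : ¬ prev < (p : WithBot ℤ) := by rw [hbp]; simp
        refine main Set.univ {n | minOption (p + n) ps.head? = p'} (fun χ₀ j₀ _ => ?_) ?_
        · simp [hnlt]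
        · rw [hm₁u, hm₂ _ _ _ hhead]; simp
      | false =>
        have hlt : prev < (p : WithBot ℤ) := hbp.2 rfl
        by_cases hpp : p' = p
        -- A particle that stays uses only `χ`. One that moves uses `χ ≠ 1` and its jump; a pushed
        -- one, treated above, uses only its jump. Positive jumps prevent a mover from ending at
        -- `p`.
        · refine main {1} Set.univ (fun χ₀ j₀ hj₀ => ?_) ?_
          · have : p + 1 ≤ minOption (p + j₀) ps.head? :=
              le_minOption (by omega) fun y hy => hhead y hy
            by_cases hχ : χ₀ = 1
            · simp [hlt, hχ, hpp]
            · simp only [hlt, hχ, and_false, if_false, Set.mem_singleton_iff, Set.mem_univ,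
                and_true, iff_false]
              omega
          · simp [hm₁, hm₂u, hpp]
        · refine main {1}ᶜ {n | minOption (p + n) ps.head? = p'} (fun χ₀ j₀ hj₀ => ?_) ?_
          · by_cases hχ : χ₀ = 1
            · simp [hlt, hχ, Ne.symm hpp]
            · simp [hχ]
          · rw [hm₁', hm₂ _ _ _ hhead]; simp [hpp]

end Update

/-! ### Consequences of the parameter range. -/

section Parameters

variable {q α : ℝ} {I J : ℕ}

theorem StochasticRange.nondegenerate (h : StochasticRange q α I J) :
    Nondegenerate q α (I + J) := by
  rcases h with ⟨h0, h1, h2⟩ | ⟨h1, h2, h3⟩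
  · have hneg : α < 0 := h2.trans (neg_neg_of_pos (zpow_pos h0 _))
    refine ⟨h0, h1.ne, hneg.ne, fun m hm => ?_⟩
    have hm' : q ^ (-(I : ℤ) - J + 1) * q ^ m ≥ 1 := by
      rw [← zpow_natCast, ← zpow_add₀ h0.ne']
      exact one_le_zpow_of_nonpos₀ h0 h1.le (by omega)
    have := mul_lt_mul_of_pos_right h2 (pow_pos h0 m)
    have : 1 + α * q ^ m < 0 := by linarith
    exact this.ne
  · have h0 : 0 < q := by linarith
    refine ⟨h0, h1.ne', h3.ne, fun m hm => ?_⟩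
    have hm' : q ^ (-(I : ℤ) - J + 1) * q ^ m ≤ 1 := by
      rw [← zpow_natCast, ← zpow_add₀ h0.ne']
      exact zpow_le_one_of_nonpos₀ h1.le (by omega)
    have := mul_lt_mul_of_pos_right h2 (pow_pos h0 m)
    have : 0 < 1 + α * q ^ m := by linarith
    exact this.ne'

theorem Nondegenerate.shift_pow {n m : ℕ} (h : Nondegenerate q α (n + m)) :
    Nondegenerate q (α * q ^ m) n := by
  induction m generalizing α with
  | zero => simpa using h
  | succ m ih =>
    have := ih (h.shift (n := n + m))
    rwa [mul_assoc, ← pow_succ'] at this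

theorem betaExp_block (I J : ℕ) (b : ℤ) {k : ℕ} (hk : k < I) (t : ℕ) :
    betaExp I J (b * I + k) t = ((k + t % J : ℕ) : ℤ) := by
  unfold betaExp
  rw [add_comm (b * (I : ℤ)), Int.add_mul_emod_self_right, Int.emod_eq_of_lt (by omega) (by omega)]
  push_cast; rfl

theorem exists_block (hI : 1 ≤ I) (x : ℤ) : ∃ (b : ℤ) (k : ℕ), k < I ∧ x = b * I + k := by
  have hI' : (0 : ℤ) < I := by exact_mod_cast hI
  have m0 := Int.emod_nonneg x hI'.ne'
  have m1 := Int.emod_lt_of_pos x hI'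
  obtain ⟨r, hr⟩ := Int.eq_ofNat_of_zero_le m0
  refine ⟨x / I, r, by omega, ?_⟩
  have := Int.emod_add_mul_ediv x I
  rw [hr] at this
  linarith [mul_comm (x / (I : ℤ)) (I : ℤ)]

/-- The exponent `β` at the `k`-th site of any block is `k + t mod J`. All blocks therefore carry
the same weights, those of a fused vertex at `α q^{t mod J}`, as horizontal fusion requires. -/
theorem sixVertex_eq_siteWeight (h : Nondegenerate q α (I + J)) (hJ : 1 ≤ J) (t : ℕ) (b : ℤ)
    (k : ℕ) (hk : k < I) :
    sixVertex (b₁ q α I J (b * I + k) t) (b₂ q α I J (b * I + k) t) =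
      siteWeight q (α * q ^ (t % J)) k := by
  have ht : t % J < J := Nat.mod_lt _ hJ
  have h2 : Nondegenerate q (α * q ^ (k + t % J)) (1 + 1) :=
    (h.mono (by omega : 1 + 1 + (k + t % J) ≤ I + J)).shift_pow
  have e1 : b₁ q α I J (b * I + k) t =
      lineWeight q (α * q ^ (k + t % J)) q⁻¹ 1 0 1 0 := by
    rw [b₁, betaExp_block I J b hk, zpow_natCast, vertexWeight_one_row h2 le_rfl le_rfl
      (by omega) (by omega)]
    simp
  have e2 : b₂ q α I J (b * I + k) t =
      lineWeight q (α * q ^ (k + t % J)) q⁻¹ 0 1 0 1 := by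
    rw [b₂, betaExp_block I J b hk, zpow_natCast, vertexWeight_one_row h2 (by omega) (by omega)
      le_rfl le_rfl]
    simp
  have ha : 1 + α * q ^ (k + t % J) ≠ 0 := by simpa using h2.one_add_ne 0 (by omega)
  have hq := h.q_pos.ne'
  rw [e1, e2]
  funext a h a' h'
  simp only [siteWeight]
  rw [mul_assoc, ← pow_add, add_comm (t % J) k]
  generalize α * q ^ (k + t % J) = c at *
  fin_cases a <;> fin_cases h <;> fin_cases a' <;> fin_cases h' <;>
    simp [sixVertex, lineWeight] <;> field_simp <;> ring

theorem b₂_mem (h : StochasticRange q α I J) (hI : 1 ≤ I) (hJ : 1 ≤ J) (x : ℤ) (t : ℕ) :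
    0 ≤ b₂ q α I J x t ∧ b₂ q α I J x t < 1 := by
  obtain ⟨b, k, hk, rfl⟩ := exists_block hI x
  have hn := h.nondegenerate
  have ht : t % J < J := Nat.mod_lt _ hJ
  have h2 : Nondegenerate q (α * q ^ (k + t % J)) (1 + 1) :=
    (hn.mono (by omega : 1 + 1 + (k + t % J) ≤ I + J)).shift_pow
  have e2 : b₂ q α I J (b * I + k) t =
      (α * q ^ (k + t % J) + q⁻¹) / (1 + α * q ^ (k + t % J)) := by
    rw [b₂, betaExp_block I J b hk, zpow_natCast, vertexWeight_one_row h2 (by omega) (by omega)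
      le_rfl le_rfl]
    simp [lineWeight]
  rw [e2]
  set m := k + t % J
  have hm : m + 1 < I + J := by omega
  rcases h with ⟨h0, h1, h2⟩ | ⟨h1, h2, h3⟩
  · have hm' : q ^ (-(I : ℤ) - J + 1) * q ^ m ≥ q⁻¹ := by
      rw [← zpow_natCast, ← zpow_add₀ h0.ne', ← zpow_neg_one]
      exact zpow_le_zpow_right_of_le_one₀ h0 h1.le (by omega)
    have := mul_lt_mul_of_pos_right h2 (pow_pos h0 m)
    have hq1 : 1 < q⁻¹ := (one_lt_inv₀ h0).2 h1
    have l1 : α * q ^ m + q⁻¹ < 0 := by linarith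
    have l2 : 1 + α * q ^ m < 0 := by linarith
    refine ⟨(div_pos_of_neg_of_neg l1 l2).le, ?_⟩
    rw [div_lt_one_of_neg l2]; linarith
  · have h0 : 0 < q := by linarith
    have hm' : q ^ (-(I : ℤ) - J + 1) * q ^ m ≤ q⁻¹ := by
      rw [← zpow_natCast, ← zpow_add₀ h0.ne', ← zpow_neg_one]
      exact zpow_le_zpow_right₀ h1.le (by omega)
    have := mul_lt_mul_of_pos_right h2 (pow_pos h0 m)
    have hq1 : q⁻¹ < 1 := inv_lt_one_of_one_lt₀ h1
    have l1 : 0 < α * q ^ m + q⁻¹ := by linarith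
    have l2 : 0 < 1 + α * q ^ m := by linarith
    refine ⟨(div_pos l1 l2).le, ?_⟩
    rw [div_lt_one l2]; linarith

/-- Periodicity in `x` leaves finitely many values below `1`, hence a uniform bound; it makes the
jumps almost surely finite and positive. -/
theorem b₂_le (h : StochasticRange q α I J) (hI : 1 ≤ I) (hJ : 1 ≤ J) (t : ℕ) :
    ∃ ρ : ℝ, 0 ≤ ρ ∧ ρ < 1 ∧ ∀ x, b₂ q α I J x t ≤ ρ := by
  have hne : (Finset.range I).Nonempty := ⟨0, by simp; omega⟩
  obtain ⟨k₀, _, hk₀⟩ := Finset.exists_max_image (Finset.range I)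
    (fun k : ℕ => b₂ q α I J (k : ℤ) t) hne
  refine ⟨b₂ q α I J (k₀ : ℤ) t, (b₂_mem h hI hJ _ _).1, (b₂_mem h hI hJ _ _).2, fun x => ?_⟩
  obtain ⟨b, k, hk, rfl⟩ := exists_block hI x
  have : b₂ q α I J (b * I + k) t = b₂ q α I J (k : ℤ) t := by
    have := betaExp_block I J 0 hk t
    rw [zero_mul, zero_add] at this
    rw [b₂, b₂, betaExp_block I J b hk, this]
  rw [this]
  exact hk₀ k (by simpa using hk)

end Parameters

/-! ### The law of a jump. -/

section Jumps

theorem prod_Ico_int (β : ℤ → ℝ) (x : ℤ) (n : ℕ) :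
    ∏ k ∈ Finset.Ico (x + 1) (x + 1 + n), β k = ∏ k ∈ Finset.Ico 1 (n + 1), β (x + (k : ℕ)) := by
  induction n with
  | zero => simp
  | succ n ih =>
    rw [Finset.prod_Ico_succ_top (by omega), ← ih]
    have : Finset.Ico (x + 1) (x + 1 + (n + 1 : ℕ)) =
        insert (x + (n + 1 : ℕ)) (Finset.Ico (x + 1) (x + 1 + n)) := by
      ext k; simp; omega
    rw [this, Finset.prod_insert (by simp; omega), mul_comm]

variable {Ω : Type*} [MeasurableSpace Ω] {P : Measure Ω} [IsProbabilityMeasure P]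
  {Y : Ω → ℕ} {β : ℤ → ℝ} {x : ℤ}

theorem jump_sum (hY : Measurable Y)
    (hlaw : ∀ n : ℕ, 1 ≤ n → P.real {ω | Y ω = n} =
      (1 - β (x + n)) * ∏ k ∈ Finset.Ico 1 n, β (x + (k : ℕ))) (n : ℕ) :
    P.real {ω | 1 ≤ Y ω ∧ Y ω ≤ n} = 1 - ∏ k ∈ Finset.Ico 1 (n + 1), β (x + (k : ℕ)) := by
  induction n with
  | zero =>
    have : {ω | 1 ≤ Y ω ∧ Y ω ≤ 0} = ∅ := by
      ext ω; simp only [Set.mem_ofPred_eq, Set.mem_empty_iff_false, iff_false]; omega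
    rw [this]; simp
  | succ n ih =>
    have e : {ω | 1 ≤ Y ω ∧ Y ω ≤ n + 1} = {ω | 1 ≤ Y ω ∧ Y ω ≤ n} ∪ {ω | Y ω = (n + 1 : ℕ)} := by
      ext ω; simp; omega
    rw [e, measureReal_union, ih, hlaw _ (by omega),
      Finset.prod_Ico_succ_top (by omega : 1 ≤ n + 1)]
    · ring
    · rw [Set.disjoint_left]; intro ω h1 h2; simp at h1 h2; omega
    · exact hY (measurableSet_singleton (n + 1))

/-- The law is prescribed only for `n ≥ 1`. The masses of `1, …, n` add up to `1` minus a product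
bounded by `ρ ^ n`, so nothing is left for the value `0`. -/
theorem jump_pos (hY : Measurable Y)
    (hlaw : ∀ n : ℕ, 1 ≤ n → P.real {ω | Y ω = n} =
      (1 - β (x + n)) * ∏ k ∈ Finset.Ico 1 n, β (x + (k : ℕ)))
    {ρ : ℝ} (hρ0 : 0 ≤ ρ) (hρ1 : ρ < 1) (hβ0 : ∀ y, 0 ≤ β y) (hβ : ∀ y, β y ≤ ρ) :
    P.real {ω | Y ω = 0} = 0 := by
  have hle : ∀ n : ℕ, P.real {ω | Y ω = 0} ≤ ρ ^ n := by
    intro n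
    have h1 := jump_sum hY hlaw n
    have h2 : P.real ({ω | Y ω = 0} ∪ {ω | 1 ≤ Y ω ∧ Y ω ≤ n}) ≤ 1 := measureReal_le_one
    rw [measureReal_union, h1] at h2
    · have h3 : ∏ k ∈ Finset.Ico 1 (n + 1), β (x + (k : ℕ)) ≤ ∏ k ∈ Finset.Ico 1 (n + 1), ρ :=
        Finset.prod_le_prod (fun _ _ => hβ0 _) fun _ _ => hβ _
      simp at h3
      linarith
    · rw [Set.disjoint_left]; intro ω h1 h2; simp at h1 h2; omega
    · exact (hY (measurableSet_Icc (a := 1) (b := n)) : _)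
  refine le_antisymm ?_ measureReal_nonneg
  exact ge_of_tendsto' (tendsto_pow_atTop_nhds_zero_of_lt_one hρ0 hρ1) hle

theorem jump_stopProb (hY : Measurable Y)
    (hlaw : ∀ n : ℕ, 1 ≤ n → P.real {ω | Y ω = n} =
      (1 - β (x + n)) * ∏ k ∈ Finset.Ico 1 n, β (x + (k : ℕ)))
    (h0 : P.real {ω | Y ω = 0} = 0) (p' : ℤ) (r : Option ℤ)
    (hr : ∀ y ∈ r, x < y) :
    P.real {ω | minOption (x + Y ω) r = p'} = stopProb β (x + 1) p' r := by
  have single : ∀ z : ℤ, P.real {ω | x + (Y ω : ℤ) = z} =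
      if x + 1 ≤ z then (∏ k ∈ Finset.Ico (x + 1) z, β k) * (1 - β z) else 0 := by
    intro z
    split_ifs with hz
    · obtain ⟨n, hn⟩ := Int.eq_ofNat_of_zero_le (by omega : 0 ≤ z - (x + 1))
      have e : {ω | x + (Y ω : ℤ) = z} = {ω | Y ω = n + 1} := by ext ω; simp; omega
      obtain rfl : z = x + 1 + n := by omega
      rw [e, hlaw _ (by omega), prod_Ico_int, mul_comm]
      congr 3
      push_cast; ring
    · refine le_antisymm ?_ measureReal_nonneg
      rw [← h0]
      refine measureReal_mono fun ω hω => ?_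
      simp at hω ⊢; omega
  cases r with
  | none =>
    simp only [minOption, single, stopProb]
    simp
  | some r =>
    have hxr : x < r := hr r rfl
    unfold stopProb
    simp only [minOption, Option.mem_def, Option.some.injEq, forall_eq']
    rcases lt_trichotomy p' r with hp | rfl | hp
    · have e : {ω | min (x + (Y ω : ℤ)) r = p'} = {ω | x + (Y ω : ℤ) = p'} := by
        ext ω; simp; omega
      rw [e, single, if_neg hp.ne']
      simp [hp.le]
    · obtain ⟨n, hn⟩ := Int.eq_ofNat_of_zero_le (by omega : 0 ≤ p' - (x + 1))
      have e : {ω | min (x + (Y ω : ℤ)) p' = p'} =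
          ({ω | Y ω = 0} ∪ {ω | 1 ≤ Y ω ∧ Y ω ≤ n})ᶜ := by
        ext ω; simp; omega
      have m1 : MeasurableSet {ω | Y ω = 0} := hY (measurableSet_singleton 0)
      have m2 : MeasurableSet {ω | 1 ≤ Y ω ∧ Y ω ≤ n} :=
        (hY (measurableSet_Icc (a := 1) (b := n)) : _)
      rw [e, probReal_compl_eq_one_sub (m1.union m2), measureReal_union _ m2, h0,
        jump_sum hY hlaw n]
      · obtain rfl : p' = x + 1 + n := by omega
        rw [prod_Ico_int]; simp
      · rw [Set.disjoint_left]; intro ω h1 h2; simp at h1 h2; omega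
    · have e : {ω | min (x + (Y ω : ℤ)) r = p'} = ∅ := by
        ext ω; simp; omega
      rw [e, if_neg (by omega)]; simp

end Jumps

/-! ### Path probabilities of the unfused model. -/

section Path

theorem occupation_eq_one_iff {l : List ℤ} {x : ℤ} : occupation l x = 1 ↔ x ∈ l := by
  unfold occupation; split_ifs with h <;> simp [h]

theorem eq_of_occupation_eq {l l' : List ℤ} (hl : l.Pairwise (· < ·)) (hl' : l'.Pairwise (· < ·))
    (h : occupation l = occupation l') : l = l' := by
  refine List.Perm.eq_of_pairwise' (r := (· < ·)) hl hl' ?_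
  rw [List.perm_ext_iff_of_nodup (hl.imp ne_of_lt) (hl'.imp ne_of_lt)]
  intro x
  rw [← occupation_eq_one_iff, h, occupation_eq_one_iff]

variable {Ω : Type*} [MeasurableSpace Ω] {P : Measure Ω} {q α : ℝ}
  {I J : ℕ} {χ j : ℕ → ℤ → Ω → ℕ} {p : ℕ → Ω → List ℤ}

/-- The update reads only the finitely many coordinates at the sites of `l`, and on that countable
discrete space every set is measurable. -/
theorem measurableSet_s6vUpdate_eq {f g : ℤ → Ω → ℕ} (hf : ∀ x, Measurable (f x))
    (hg : ∀ x, Measurable (g x)) (prev : WithBot ℤ) (l l' : List ℤ) :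
    MeasurableSet {ω | s6vUpdate (fun x => f x ω) (fun x => g x ω) prev l = l'} := by
  have hH : Measurable fun ω => fun x : l.toFinset => (f x ω, g x ω) :=
    measurable_pi_lambda _ fun x => (hf x).prodMk (hg x)
  have hset : MeasurableSet {h : l.toFinset → ℕ × ℕ | s6vUpdate
      (fun x => if hx : x ∈ l.toFinset then (h ⟨x, hx⟩).1 else 0)
      (fun x => if hx : x ∈ l.toFinset then (h ⟨x, hx⟩).2 else 0) prev l = l'} :=
    MeasurableSet.of_discrete
  convert hH hset using 1
  ext ω
  simp only [Set.mem_ofPred_eq, Set.mem_preimage]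
  rw [s6vUpdate_congr]
  intro x hx
  simp [hx]

/-- Measurability at time `0` is assumed only for the occupation configuration, but a sorted list is
determined by it. Later times follow because there are countably many lists. -/
theorem IsUnfusedSHS6V.measurableSet_eq (hp : IsUnfusedSHS6V P q α I J χ j p) (t : ℕ)
    (l : List ℤ) : MeasurableSet {ω | p t ω = l} := by
  induction t generalizing l with
  | zero =>
    by_cases hl : l.Pairwise (· < ·)
    · convert hp.measurable_zero (measurableSet_singleton (occupation l)) using 1
      ext ω
      exact ⟨fun h => congrArg occupation h, fun h => eq_of_occupation_eq (hp.sorted_zero ω) hl h⟩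
    · convert MeasurableSet.empty using 1
      ext ω
      simp only [Set.mem_ofPred_eq, Set.mem_empty_iff_false, iff_false]
      exact fun h => hl (h ▸ hp.sorted_zero ω)
  | succ t ih =>
    have : {ω | p (t + 1) ω = l} = ⋃ l₀ : List ℤ, {ω | p t ω = l₀} ∩
        {ω | s6vUpdate (fun x => χ t x ω) (fun x => j t x ω) ⊥ l₀ = l} := by
      ext ω
      simp [hp.update]
    rw [this]
    exact MeasurableSet.iUnion fun l₀ => (ih l₀).inter
      (measurableSet_s6vUpdate_eq (hp.measurable_χ t) (hp.measurable_j t) ⊥ l₀ l)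

theorem IsUnfusedSHS6V.ae_jump_pos [IsProbabilityMeasure P] (hp : IsUnfusedSHS6V P q α I J χ j p)
    (h : StochasticRange q α I J) (hI : 1 ≤ I) (hJ : 1 ≤ J) :
    ∀ᵐ ω ∂P, ∀ t x, 1 ≤ j t x ω := by
  rw [ae_all_iff]; intro t
  rw [ae_all_iff]; intro x
  obtain ⟨ρ, h0, h1, hρ⟩ := b₂_le h hI hJ t
  have := jump_pos (hp.measurable_j t x) (hp.law_j t x) h0 h1
    (fun y => (b₂_mem h hI hJ y t).1) hρ
  rw [measureReal_eq_zero_iff] at this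
  rw [ae_iff]
  convert this using 2
  ext ω; simp

theorem IsUnfusedSHS6V.sorted (hp : IsUnfusedSHS6V P q α I J χ j p) {ω : Ω}
    (hω : ∀ t x, 1 ≤ j t x ω) (t : ℕ) : (p t ω).Pairwise (· < ·) := by
  induction t with
  | zero => exact hp.sorted_zero ω
  | succ t ih =>
    rw [hp.update]
    exact (s6vUpdate_spec (hω t) ⊥ ih (by simp)).1

theorem IsUnfusedSHS6V.forall₂_le (hp : IsUnfusedSHS6V P q α I J χ j p) {ω : Ω}
    (hω : ∀ t x, 1 ≤ j t x ω) (t : ℕ) : List.Forall₂ (· ≤ ·) (p t ω) (p (t + 1) ω) := by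
  rw [hp.update]
  exact (s6vUpdate_spec (hω t) ⊥ (hp.sorted hω t) (by simp)).2.2

theorem IsUnfusedSHS6V.exists_rectangle [IsProbabilityMeasure P]
    (hp : IsUnfusedSHS6V P q α I J χ j p) (h : StochasticRange q α I J) (hI : 1 ≤ I) (hJ : 1 ≤ J)
    (t : ℕ) {l l' : List ℤ} (hl : l.Pairwise (· < ·)) (hlen : l.length = l'.length) :
    ∃ A B : ℤ → Set ℕ,
      (∀ χ j : ℤ → ℕ, (∀ x, 1 ≤ j x) →
        (s6vUpdate χ j ⊥ l = l' ↔ ∀ x ∈ l, χ x ∈ A x ∧ j x ∈ B x)) ∧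
      ∏ x ∈ l.toFinset, P.real (χ t x ⁻¹' A x) * P.real (j t x ⁻¹' B x) =
        stepProb (b₁ q α I J · t) (b₂ q α I J · t) false l l' := by
  refine _root_.exists_rectangle (b₁ q α I J · t) (b₂ q α I J · t)
    (fun x A => P.real (χ t x ⁻¹' A)) (fun x B => P.real (j t x ⁻¹' B))
    (hp.law_χ_one t) (fun x => ?_) (by simp) (by simp) (by simp) (fun x p' r hr => ?_) hl hlen ⊥
    false (by simp)
  · rw [Set.preimage_compl, probReal_compl_eq_one_sub
      (hp.measurable_χ t x (measurableSet_singleton 1))]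
    exact congrArg (1 - ·) (hp.law_χ_one t x)
  · obtain ⟨ρ, h0, h1, hρ⟩ := b₂_le h hI hJ t
    have := jump_pos (hp.measurable_j t x) (hp.law_j t x) h0 h1
      (fun y => (b₂_mem h hI hJ y t).1) hρ
    exact jump_stopProb (hp.measurable_j t x) (hp.law_j t x) this p' r hr

/-- Along a fixed path each step is a rectangle in the variables of its own time, so the whole path
is one rectangle in which every driving variable occurs at most once. Independence factorizes it. If
the number of particles changes, both sides vanish. -/
theorem IsUnfusedSHS6V.path_prob [IsProbabilityMeasure P] (hp : IsUnfusedSHS6V P q α I J χ j p)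
    (h : StochasticRange q α I J) (hI : 1 ≤ I) (hJ : 1 ≤ J) (l : ℕ → List ℤ)
    (hl : ∀ s, (l s).Pairwise (· < ·)) (T : ℕ) :
    P.real {ω | ∀ s ≤ T, p s ω = l s} = P.real {ω | p 0 ω = l 0} *
      ∏ s ∈ Finset.range T,
        stepProb (b₁ q α I J · s) (b₂ q α I J · s) false (l s) (l (s + 1)) := by
  by_cases hlen : ∀ s < T, (l s).length = (l (s + 1)).length
  swap
  · push Not at hlen
    obtain ⟨s, hs, hne⟩ := hlen
    rw [Finset.prod_eq_zero (Finset.mem_range.2 hs) (stepProb_of_length_ne _ _ _ hne), mul_zero]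
    have : {ω | ∀ s ≤ T, p s ω = l s} = ∅ := by
      ext ω
      simp only [Set.mem_ofPred_eq, Set.mem_empty_iff_false, iff_false]
      intro hω
      apply hne
      rw [← hω s hs.le, ← hω (s + 1) hs, hp.update, length_s6vUpdate]
    rw [this]; simp
  have hrect : ∀ s, ∃ A B : ℤ → Set ℕ, s < T →
      (∀ χ j : ℤ → ℕ, (∀ x, 1 ≤ j x) →
        (s6vUpdate χ j ⊥ (l s) = l (s + 1) ↔ ∀ x ∈ l s, χ x ∈ A x ∧ j x ∈ B x)) ∧
      ∏ x ∈ (l s).toFinset, P.real (χ s x ⁻¹' A x) * P.real (j s x ⁻¹' B x) =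
        stepProb (b₁ q α I J · s) (b₂ q α I J · s) false (l s) (l (s + 1)) := by
    intro s
    by_cases hs : s < T
    · obtain ⟨A, B, hAB⟩ := hp.exists_rectangle h hI hJ s (hl s) (hlen s hs)
      exact ⟨A, B, fun _ => hAB⟩
    · exact ⟨fun _ => ∅, fun _ => ∅, fun hs' => absurd hs' hs⟩
  choose A B hAB using hrect
  set S₁ : Finset (ℕ × ℤ) := ((Finset.range T).sigma fun s => (l s).toFinset).image
    fun z => (z.1, z.2) with hS₁
  have hmem : ∀ s x, (s, x) ∈ S₁ ↔ s < T ∧ x ∈ l s := by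
    intro s x; simp [hS₁]
  set R : Set ((ℕ × ℤ → ℕ) × (ℕ × ℤ → ℕ)) :=
    {c | ∀ z ∈ S₁, c.1 z ∈ A z.1 z.2 ∧ c.2 z ∈ B z.1 z.2} with hR
  have hRm : MeasurableSet R := by
    have : R = ⋂ z ∈ S₁, ((fun c => c.1 z) ⁻¹' A z.1 z.2 ∩ (fun c => c.2 z) ⁻¹' B z.1 z.2) := by
      ext c; simp [hR]
    rw [this]
    refine Finset.measurableSet_biInter _ fun z _ => MeasurableSet.inter ?_ ?_
    · exact ((measurable_pi_apply z).comp measurable_fst) MeasurableSet.of_discrete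
    · exact ((measurable_pi_apply z).comp measurable_snd) MeasurableSet.of_discrete
  set Ψ : Ω → (ℕ × ℤ → ℕ) × (ℕ × ℤ → ℕ) :=
    fun ω => ((fun s : ℕ × ℤ => χ s.1 s.2 ω), (fun s : ℕ × ℤ => j s.1 s.2 ω)) with hΨ
  have hE : {ω | ∀ s ≤ T, p s ω = l s} =ᵐ[P]
      ((fun ω => occupation (p 0 ω)) ⁻¹' {occupation (l 0)} ∩ Ψ ⁻¹' R : Set Ω) := by
    filter_upwards [hp.ae_jump_pos h hI hJ] with ω hω
    apply propext
    change (∀ s ≤ T, p s ω = l s) ↔ (occupation (p 0 ω) = occupation (l 0) ∧ Ψ ω ∈ R)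
    have h0 : occupation (p 0 ω) = occupation (l 0) ↔ p 0 ω = l 0 :=
      ⟨fun e => eq_of_occupation_eq (hp.sorted_zero ω) (hl 0) e, fun e => by rw [e]⟩
    have hstep : ∀ s < T, (s6vUpdate (fun x => χ s x ω) (fun x => j s x ω) ⊥ (l s) = l (s + 1) ↔
        ∀ x ∈ l s, χ s x ω ∈ A s x ∧ j s x ω ∈ B s x) := fun s hs => (hAB s hs).1 _ _ (hω s)
    rw [h0]
    constructor
    · intro hall
      refine ⟨hall 0 (Nat.zero_le _), ?_⟩
      rintro ⟨s, x⟩ hz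
      obtain ⟨hs, hx⟩ := (hmem s x).1 hz
      refine (hstep s hs).1 ?_ x hx
      rw [← hall (s + 1) hs, hp.update, hall s hs.le]
    · rintro ⟨h00, hRω⟩ s
      induction s with
      | zero => exact fun _ => h00
      | succ s ih =>
        intro hs
        rw [hp.update, ih (by omega)]
        exact (hstep s hs).2 fun x hx => hRω (s, x) ((hmem s x).2 ⟨hs, hx⟩)
  have h00 : {ω | p 0 ω = l 0} = (fun ω => occupation (p 0 ω)) ⁻¹' {occupation (l 0)} := by
    ext ω
    exact ⟨fun e => congrArg occupation e, fun e => eq_of_occupation_eq (hp.sorted_zero ω) (hl 0) e⟩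
  have hsplit : P.real ((fun ω => occupation (p 0 ω)) ⁻¹' {occupation (l 0)} ∩ Ψ ⁻¹' R) =
      P.real {ω | p 0 ω = l 0} * P.real (Ψ ⁻¹' R) := by
    rw [h00]
    simp only [measureReal_def]
    rw [hp.indep_zero.measure_inter_preimage_eq_mul _ _ (measurableSet_singleton _) hRm,
      ENNReal.toReal_mul]
  rw [measureReal_congr hE, hsplit]
  congr 1
  have hΨR : Ψ ⁻¹' R = ⋂ i ∈ S₁.disjSum S₁,
      (Sum.elim (fun s : ℕ × ℤ => χ s.1 s.2) (fun s : ℕ × ℤ => j s.1 s.2) i) ⁻¹'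
        (Sum.elim (fun z : ℕ × ℤ => A z.1 z.2) (fun z : ℕ × ℤ => B z.1 z.2) i) := by
    ext ω
    simp only [Set.mem_preimage, hR, Set.mem_ofPred_eq, Set.mem_iInter, hΨ]
    constructor
    · rintro hω (z | z) hz
      · exact (hω z (by simpa using hz)).1
      · exact (hω z (by simpa using hz)).2
    · intro hω z hz
      exact ⟨hω (Sum.inl z) (by simpa using hz), hω (Sum.inr z) (by simpa using hz)⟩
  rw [hΨR, measureReal_def, hp.indep.measure_inter_preimage_eq_mul _
    (fun i _ => MeasurableSet.of_discrete), ENNReal.toReal_prod, Finset.prod_disjSum]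
  simp only [Sum.elim_inl, Sum.elim_inr, ← measureReal_def]
  rw [← Finset.prod_mul_distrib, hS₁, Finset.prod_image, Finset.prod_sigma]
  · exact Finset.prod_congr rfl fun s hs => (hAB s (Finset.mem_range.1 hs)).2
  · rintro ⟨s, x⟩ _ ⟨s', x'⟩ _ e
    simp only [Prod.mk.injEq] at e
    obtain ⟨rfl, rfl⟩ := e
    rfl

end Path

/-! ### Configurations in a finite window of blocks. -/

section Window

theorem fin_two_eq_zero {a : Fin 2} (h : a ≠ 1) : a = 0 := by
  fin_cases a <;> simp_all

variable {I n : ℕ}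

/-- The configuration with the values `c` on `a, a + 1, …, a + n - 1` and `0` elsewhere. -/
def extendConfig (a : ℤ) (c : Fin n → Fin (I + 1)) : ℤ → Fin (I + 1) := fun k =>
  if h : 0 ≤ k - a ∧ k - a < n then c ⟨(k - a).toNat, by omega⟩ else 0

theorem extendConfig_add (a : ℤ) (c : Fin n → Fin (I + 1)) (k : Fin n) :
    extendConfig a c (a + k) = c k := by
  unfold extendConfig
  rw [dif_pos (by constructor <;> omega)]
  congr 1
  ext
  simp

theorem extendConfig_of_lt (a : ℤ) (c : Fin n → Fin (I + 1)) {k : ℤ} (hk : k < a) :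
    extendConfig a c k = 0 := by
  unfold extendConfig
  rw [dif_neg (by omega)]

theorem extendConfig_of_ge (a : ℤ) (c : Fin n → Fin (I + 1)) {k : ℤ} (hk : a + n ≤ k) :
    extendConfig a c k = 0 := by
  unfold extendConfig
  rw [dif_neg (by omega)]

theorem extendConfig_injective (a : ℤ) :
    Function.Injective (extendConfig a : (Fin n → Fin (I + 1)) → ℤ → Fin (I + 1)) := by
  intro c d h
  funext k
  rw [← extendConfig_add a c k, h, extendConfig_add]

theorem extendConfig_ext (a : ℤ) {f : ℤ → Fin (I + 1)} {c : Fin n → Fin (I + 1)}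
    (h : ∀ k : Fin n, f (a + k) = c k) (h' : ∀ k, k < a ∨ a + n ≤ k → f k = 0) :
    f = extendConfig a c := by
  funext k
  by_cases hk : k < a ∨ a + n ≤ k
  · rw [h' k hk]
    rcases hk with hk | hk
    · rw [extendConfig_of_lt a c hk]
    · rw [extendConfig_of_ge a c hk]
  · obtain ⟨i, hi⟩ := Int.eq_ofNat_of_zero_le (by omega : 0 ≤ k - a)
    obtain rfl : k = a + i := by omega
    have hi' : i < n := by omega
    rw [h ⟨i, hi'⟩, ← extendConfig_add a c ⟨i, hi'⟩]

/-- The numbers of particles in the blocks of `ξ`. -/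
def blockSum (ξ : Fin n → Fin I → Fin 2) : Fin n → Fin (I + 1) := fun k =>
  ⟨∑ r, (ξ k r : ℕ), Nat.lt_succ_of_le (sum_val_le (ξ k))⟩

theorem block_index_unique {b b' : ℤ} {r r' : Fin I} (h : b * I + (r : ℕ) = b' * I + (r' : ℕ)) :
    b = b' ∧ r = r' := by
  have hr := r.isLt
  have hr' := r'.isLt
  have hI : (0 : ℤ) < I := by omega
  have e1 : (b * I + (r : ℕ)) / (I : ℤ) = b := by
    rw [add_comm, Int.add_mul_ediv_right _ _ hI.ne', Int.ediv_eq_zero_of_lt (by omega) (by omega),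
      zero_add]
  have e2 : (b' * I + (r' : ℕ)) / (I : ℤ) = b' := by
    rw [add_comm, Int.add_mul_ediv_right _ _ hI.ne', Int.ediv_eq_zero_of_lt (by omega) (by omega),
      zero_add]
  obtain rfl : b = b' := by rw [← e1, h, e2]
  exact ⟨rfl, Fin.ext (by omega)⟩

theorem mem_blockList_iff {a : ℤ} {ξ : Fin n → Fin I → Fin 2} (k : Fin n) (r : Fin I) :
    (a + k) * I + r ∈ blockList I n (a * I) ξ ↔ ξ k r = 1 := by
  rw [mem_blockList]
  constructor
  · rintro ⟨k', r', h, e⟩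
    rw [← add_mul] at e
    obtain ⟨e1, rfl⟩ := block_index_unique e
    obtain rfl : k = k' := Fin.ext (by omega)
    exact h
  · intro h
    exact ⟨k, r, h, by ring⟩

theorem blockList_injective (a : ℤ) :
    Function.Injective (blockList I n (a * I)) := by
  intro ξ ξ' h
  funext k r
  have h1 := mem_blockList_iff (a := a) (ξ := ξ) k r
  rw [h, mem_blockList_iff] at h1
  have := (ξ k r).isLt
  have := (ξ' k r).isLt
  by_cases h2 : ξ k r = 1
  · rw [h2, h1.2 h2]
  · have h3 : ξ' k r ≠ 1 := fun h3 => h2 (h1.1 h3)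
    rw [fin_two_eq_zero h2, fin_two_eq_zero h3]

theorem mem_blockList_bounds {a : ℤ} {ξ : Fin n → Fin I → Fin 2} :
    ∀ y ∈ blockList I n (a * I) ξ, a * I ≤ y ∧ y < (a + n) * I := by
  intro y hy
  refine ⟨le_of_mem_blockList y hy, ?_⟩
  obtain ⟨k, r, _, rfl⟩ := mem_blockList.1 hy
  have h1 : ((k : ℕ) + 1 : ℤ) * I ≤ n * I :=
    mul_le_mul_of_nonneg_right (by have := k.isLt; omega) (by positivity)
  have h2 := r.isLt
  linarith [add_mul a (n : ℤ) (I : ℤ), add_mul ((k : ℕ) : ℤ) 1 (I : ℤ),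
    (by exact_mod_cast h2 : ((r : ℕ) : ℤ) < I)]

theorem collapse_pos_of_mem {l : List ℤ} {b : ℤ} {r : ℕ} (hr : r < I) (h : b * I + r ∈ l) :
    collapse I (occupation l) b ≠ 0 := by
  intro h0
  have h1 : ∑ r : Fin I, (occupation l (b * I + (r : ℕ)) : ℕ) = 0 := congrArg Fin.val h0
  rw [Finset.sum_eq_zero_iff] at h1
  have h2 := h1 ⟨r, hr⟩ (Finset.mem_univ _)
  rw [occupation_eq_one_iff.2 h] at h2
  simp at h2

theorem bounds_of_collapse (hI : 1 ≤ I) {a : ℤ} {l : List ℤ} {c : Fin n → Fin (I + 1)}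
    (h : collapse I (occupation l) = extendConfig a c) :
    ∀ y ∈ l, a * I ≤ y ∧ y < (a + n) * I := by
  intro y hy
  obtain ⟨b, r, hr, rfl⟩ := exists_block hI y
  have h1 := collapse_pos_of_mem hr hy
  rw [h] at h1
  have ha : a ≤ b := by
    by_contra hb
    exact h1 (extendConfig_of_lt a c (by omega))
  have hb : b < a + n := by
    by_contra hb
    exact h1 (extendConfig_of_ge a c (by omega))
  have m1 : a * (I : ℤ) ≤ b * I := mul_le_mul_of_nonneg_right ha (by positivity)
  have m2 : (b + 1) * (I : ℤ) ≤ (a + n) * I := mul_le_mul_of_nonneg_right (by omega) (by positivity)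
  constructor
  · omega
  · rw [add_mul b] at m2; omega

theorem collapse_blockList (hI : 1 ≤ I) (a : ℤ) (ξ : Fin n → Fin I → Fin 2) :
    collapse I (occupation (blockList I n (a * I) ξ)) = extendConfig a (blockSum ξ) := by
  refine extendConfig_ext a (fun k => ?_) fun k hk => ?_
  · apply Fin.ext
    change ∑ r : Fin I, (occupation _ ((a + k) * I + (r : ℕ)) : ℕ) = ∑ r, (ξ k r : ℕ)
    refine Finset.sum_congr rfl fun r _ => ?_
    unfold occupation
    by_cases h : ξ k r = 1
    · rw [if_pos ((mem_blockList_iff k r).2 h), h]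
    · rw [if_neg (fun h' => h ((mem_blockList_iff k r).1 h'))]
      rw [fin_two_eq_zero h]
  · apply Fin.ext
    change ∑ r : Fin I, (occupation _ (k * I + (r : ℕ)) : ℕ) = 0
    refine Finset.sum_eq_zero fun r _ => ?_
    unfold occupation
    rw [if_neg]
    · rfl
    · intro hmem
      obtain ⟨h1, h2⟩ := mem_blockList_bounds _ hmem
      have := r.isLt
      rcases hk with hk | hk
      · have : (k + 1) * (I : ℤ) ≤ a * I := mul_le_mul_of_nonneg_right (by omega) (by positivity)
        rw [add_mul] at this; omega
      · have : (a + n) * (I : ℤ) ≤ k * I := mul_le_mul_of_nonneg_right hk (by positivity)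
        omega

/-- The weight `∏ Λ'(c_k; ξ_k)` of the splitting `ξ` of `c`. -/
noncomputable def lambdaProd (q : ℝ) (c : Fin n → Fin (I + 1)) (ξ : Fin n → Fin I → Fin 2) : ℝ :=
  ∏ k, lambdaMat' q I (c k) (ξ k)

theorem lambdaProd_of_ne (q : ℝ) {c : Fin n → Fin (I + 1)} {ξ : Fin n → Fin I → Fin 2}
    (h : c ≠ blockSum ξ) : lambdaProd q c ξ = 0 := by
  obtain ⟨k, hk⟩ := Function.ne_iff.1 h
  refine Finset.prod_eq_zero (Finset.mem_univ k) (lambdaMat'_of_ne q ?_)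
  exact fun e => hk (Fin.ext e.symm)

theorem sum_lambdaMat' {q : ℝ} (hq : 0 < q) (v : Fin (I + 1)) :
    ∑ w, lambdaMat' q I v w = 1 := by
  unfold lambdaMat'
  rw [sum_comp_rev (lambdaMat q I v)]
  unfold lambdaMat
  rw [← Finset.mul_sum]
  exact inv_mul_cancel₀ (lambdaNorm_pos hq (Nat.le_of_lt_succ v.isLt)).ne'

theorem sum_lambdaProd {q : ℝ} (hq : 0 < q) (c : Fin n → Fin (I + 1)) :
    ∑ ξ, lambdaProd q c ξ = 1 := by
  unfold lambdaProd
  rw [← Fintype.prod_sum fun k w => lambdaMat' q I (c k) w]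
  simp [sum_lambdaMat' hq]

end Window

/-! ### Markov chains observed through constraints. -/

section Chain

open scoped Classical in
/-- The masses of a chain with initial masses `F` and transition matrices `κ` which is killed at
time `t` outside of the set `C t`. -/
noncomputable def killedMass {X : Type*} [Fintype X] (F : X → ℝ) (κ : ℕ → X → X → ℝ)
    (C : ℕ → X → Prop) : ℕ → X → ℝ
  | 0 => F
  | t + 1 => fun y => ∑ x, (if C t x then killedMass F κ C t x else 0) * κ t x y

/-- `Λ y` is carried by the fibre of `π` over `y`, and the killing depends only on `π x`, so killing
commutes with `Λ`; the transition matrices commute with it by `hκ`. The form "mass upstairs times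
`Λ`" therefore survives each step. -/
theorem killedMass_intertwining {X Y : Type*} [Fintype X] [Fintype Y] {F : X → ℝ} {G : Y → ℝ}
    {κ : ℕ → X → X → ℝ} {K : ℕ → Y → Y → ℝ} {C : ℕ → X → Prop} {D : ℕ → Y → Prop}
    (Λ : Y → X → ℝ) (π : X → Y) (hΛ : ∀ y x, y ≠ π x → Λ y x = 0)
    (hC : ∀ t x, C t x ↔ D t (π x)) (hF : ∀ x, F x = ∑ y, G y * Λ y x)
    (hκ : ∀ t y x', ∑ x, Λ y x * κ t x x' = ∑ y', K t y y' * Λ y' x') (t : ℕ) (x : X) :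
    killedMass F κ C t x = ∑ y, killedMass G K D t y * Λ y x := by
  classical
  induction t generalizing x with
  | zero => exact hF x
  | succ t ih =>
    simp only [killedMass]
    have h1 : ∀ x', (if C t x' then killedMass F κ C t x' else 0) =
        ∑ y, (if D t y then killedMass G K D t y else 0) * Λ y x' := by
      intro x'
      by_cases h : C t x'
      · rw [if_pos h, ih]
        refine Finset.sum_congr rfl fun y _ => ?_
        by_cases hy : y = π x'
        · rw [if_pos (hy ▸ (hC t x').1 h)]
        · rw [hΛ y x' hy, mul_zero, mul_zero]
      · rw [if_neg h]
        refine (Finset.sum_eq_zero fun y _ => ?_).symm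
        by_cases hy : y = π x'
        · rw [if_neg (fun h' => h ((hC t x').2 (hy ▸ h'))), zero_mul]
        · rw [hΛ y x' hy, mul_zero]
    simp only [h1, Finset.sum_mul]
    rw [Finset.sum_comm]
    simp only [mul_assoc, ← Finset.mul_sum, hκ]
    simp only [Finset.mul_sum]
    rw [Finset.sum_comm]

/-- The induction on `t` relaxes exact positions to the constraint `C`, one time at a time. Keeping
the path exact from `t` up to `T` is what makes the product formula `hpath` applicable at the start.
By `hback` the position at the relaxed time lies in the window, so it ranges over the finite type
`X`. -/
theorem real_killed_path {Ω S X : Type*} [MeasurableSpace Ω] {P : Measure Ω}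
    [IsProbabilityMeasure P] [Fintype X] {p : ℕ → Ω → S} {emb : X → S}
    (hemb : Function.Injective emb) {κ : ℕ → X → X → ℝ} {C : ℕ → S → Prop}
    (hp : ∀ t s, MeasurableSet {ω | p t ω = s}) (hC : ∀ t, MeasurableSet {ω | C t (p t ω)})
    (hpath : ∀ (l : ℕ → X) (T : ℕ), P.real {ω | ∀ s ≤ T, p s ω = emb (l s)} =
      P.real {ω | p 0 ω = emb (l 0)} * ∏ s ∈ Finset.range T, κ s (l s) (l (s + 1)))
    (hback : ∀ᵐ ω ∂P, ∀ t, (∀ s ≤ t, C s (p s ω)) → p (t + 1) ω ∈ Set.range emb →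
      p t ω ∈ Set.range emb) (t : ℕ) (l : ℕ → X) (T : ℕ) (htT : t ≤ T) :
    P.real {ω | (∀ s < t, C s (p s ω)) ∧ ∀ s, t ≤ s → s ≤ T → p s ω = emb (l s)} =
      killedMass (fun x => P.real {ω | p 0 ω = emb x}) κ (fun s x => C s (emb x)) t (l t) *
        ∏ s ∈ Finset.Ico t T, κ s (l s) (l (s + 1)) := by
  classical
  induction t generalizing l with
  | zero =>
    simp only [Nat.not_lt_zero, false_imp_iff, implies_true, true_and, Nat.zero_le,
      true_imp_iff, killedMass, Nat.Ico_zero_eq_range]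
    exact hpath l T
  | succ t ih =>
    -- `B x` prescribes the position `x` at time `t` as well; the induction hypothesis is used for
    -- the path `l` modified at `t`.
    let B : X → Set Ω := fun x => {ω | C t (emb x)} ∩ {ω | (∀ s < t, C s (p s ω)) ∧
      ∀ s, t ≤ s → s ≤ T → p s ω = emb (Function.update l t x s)}
    have hB : ∀ x, MeasurableSet (B x) := fun x => by
      refine (MeasurableSet.const _).inter ?_
      simp only [Set.ofPred_and, Set.ofPred_forall]
      exact (MeasurableSet.iInter fun s => MeasurableSet.iInter fun _ => hC s).inter
        (MeasurableSet.iInter fun s => MeasurableSet.iInter fun _ =>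
          MeasurableSet.iInter fun _ => hp s _)
    have hBr : ∀ x, P.real (B x) = (if C t (emb x) then killedMass
        (fun x => P.real {ω | p 0 ω = emb x}) κ (fun s x => C s (emb x)) t x else 0) *
        (κ t x (l (t + 1)) * ∏ s ∈ Finset.Ico (t + 1) T, κ s (l s) (l (s + 1))) := by
      intro x
      by_cases h : C t (emb x)
      · have h1 : B x = {ω | (∀ s < t, C s (p s ω)) ∧
            ∀ s, t ≤ s → s ≤ T → p s ω = emb (Function.update l t x s)} := by
          ext ω; simp [B, h]
        rw [h1, ih _ (by omega), if_pos h, Finset.prod_eq_prod_Ico_succ_bot (by omega)]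
        simp only [Function.update_self]
        rw [Function.update_of_ne (by omega)]
        congr 2
        refine Finset.prod_congr rfl fun s hs => ?_
        rw [Finset.mem_Ico] at hs
        rw [Function.update_of_ne (by omega), Function.update_of_ne (by omega)]
      · have h1 : B x = ∅ := by
          ext ω; simp [B, h]
        rw [h1, if_neg h]; simp
    have hae : {ω | (∀ s < t + 1, C s (p s ω)) ∧ ∀ s, t + 1 ≤ s → s ≤ T → p s ω = emb (l s)}
        =ᵐ[P] ⋃ x ∈ (Finset.univ : Finset X), B x := by
      filter_upwards [hback] with ω hω
      apply propext
      change (_ ∧ _) ↔ ω ∈ ⋃ x ∈ (Finset.univ : Finset X), B x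
      simp only [Finset.mem_univ, Set.iUnion_true, Set.mem_iUnion]
      constructor
      · rintro ⟨h1, h2⟩
        obtain ⟨x, hx⟩ := hω t (fun s hs => h1 s (by omega))
          ⟨l (t + 1), (h2 (t + 1) le_rfl htT).symm⟩
        refine ⟨x, ?_, fun s hs => h1 s (by omega), fun s hs hs' => ?_⟩
        · have := h1 t (by omega)
          rwa [← hx] at this
        · rcases hs.eq_or_lt with rfl | hs
          · rw [Function.update_self, hx]
          · rw [Function.update_of_ne (by omega), h2 s hs hs']
      · rintro ⟨x, h0, h1, h2⟩
        refine ⟨fun s hs => ?_, fun s hs hs' => ?_⟩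
        · rcases Nat.lt_succ_iff_lt_or_eq.1 hs with hs | rfl
          · exact h1 s hs
          · have := h2 s le_rfl (by omega)
            rw [Function.update_self] at this
            rw [this]; exact h0
        · have := h2 s (by omega) hs'
          rwa [Function.update_of_ne (by omega)] at this
    have hdisj : Set.PairwiseDisjoint (↑(Finset.univ : Finset X)) B := by
      intro x _ y _ hxy
      refine Set.disjoint_left.2 fun ω h1 h2 => hxy (hemb ?_)
      have e1 := h1.2.2 t le_rfl (by omega)
      have e2 := h2.2.2 t le_rfl (by omega)
      rw [Function.update_self] at e1 e2
      rw [← e1, e2]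
    rw [measureReal_congr hae, measureReal_biUnion_finset hdisj fun x _ => hB x]
    simp only [hBr, killedMass, ← mul_assoc, ← Finset.sum_mul]

theorem real_constrained_path {Ω S X : Type*} [MeasurableSpace Ω] {P : Measure Ω}
    [IsProbabilityMeasure P] [Fintype X] {p : ℕ → Ω → S} {emb : X → S}
    (hemb : Function.Injective emb) {κ : ℕ → X → X → ℝ} {C : ℕ → S → Prop}
    [∀ x t, Decidable (C t (emb x))]
    (hp : ∀ t s, MeasurableSet {ω | p t ω = s}) (hC : ∀ t, MeasurableSet {ω | C t (p t ω)})
    (hpath : ∀ (l : ℕ → X) (T : ℕ), P.real {ω | ∀ s ≤ T, p s ω = emb (l s)} =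
      P.real {ω | p 0 ω = emb (l 0)} * ∏ s ∈ Finset.range T, κ s (l s) (l (s + 1)))
    (hback : ∀ᵐ ω ∂P, ∀ t, (∀ s ≤ t, C s (p s ω)) → p (t + 1) ω ∈ Set.range emb →
      p t ω ∈ Set.range emb) (T : ℕ)
    (hT : ∀ᵐ ω ∂P, C T (p T ω) → p T ω ∈ Set.range emb) :
    P.real {ω | ∀ s ≤ T, C s (p s ω)} = ∑ x, if C T (emb x) then
      killedMass (fun x => P.real {ω | p 0 ω = emb x}) κ (fun s x => C s (emb x)) T x else 0 := by
  classical
  let B : X → Set Ω := fun x => {ω | C T (emb x)} ∩ {ω | (∀ s < T, C s (p s ω)) ∧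
      ∀ s, T ≤ s → s ≤ T → p s ω = emb x}
  have hB : ∀ x, MeasurableSet (B x) := fun x => by
    refine (MeasurableSet.const _).inter ?_
    simp only [Set.ofPred_and, Set.ofPred_forall]
    exact (MeasurableSet.iInter fun s => MeasurableSet.iInter fun _ => hC s).inter
      (MeasurableSet.iInter fun s => MeasurableSet.iInter fun _ =>
        MeasurableSet.iInter fun _ => hp s _)
  have hBr : ∀ x, P.real (B x) = if C T (emb x) then
      killedMass (fun x => P.real {ω | p 0 ω = emb x}) κ (fun s x => C s (emb x)) T x else 0 := by
    intro x
    by_cases h : C T (emb x)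
    · have h1 : B x = {ω | (∀ s < T, C s (p s ω)) ∧
          ∀ s, T ≤ s → s ≤ T → p s ω = emb x} := by
        ext ω; simp [B, h]
      rw [h1, real_killed_path hemb hp hC hpath hback T (fun _ => x) T le_rfl, if_pos h]
      simp
    · have h1 : B x = ∅ := by
        ext ω; simp [B, h]
      rw [h1, if_neg h]; simp
  have hae : {ω | ∀ s ≤ T, C s (p s ω)} =ᵐ[P] ⋃ x ∈ (Finset.univ : Finset X), B x := by
    filter_upwards [hT] with ω hω
    apply propext
    change (∀ s ≤ T, _) ↔ ω ∈ ⋃ x ∈ (Finset.univ : Finset X), B x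
    simp only [Finset.mem_univ, Set.iUnion_true, Set.mem_iUnion]
    constructor
    · intro h
      obtain ⟨x, hx⟩ := hω (h T le_rfl)
      refine ⟨x, ?_, fun s hs => h s hs.le, fun s hs hs' => ?_⟩
      · have := h T le_rfl
        rwa [← hx] at this
      · rw [le_antisymm hs' hs, hx]
    · rintro ⟨x, h0, h1, h2⟩ s hs
      rcases hs.lt_or_eq with hs | rfl
      · exact h1 s hs
      · rw [h2 s le_rfl le_rfl]; exact h0
  have hdisj : Set.PairwiseDisjoint (↑(Finset.univ : Finset X)) B := by
    intro x _ y _ hxy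
    refine Set.disjoint_left.2 fun ω h1 h2 => hxy (hemb ?_)
    rw [← h1.2.2 T le_rfl le_rfl, h2.2.2 T le_rfl le_rfl]
  rw [measureReal_congr hae, measureReal_biUnion_finset hdisj fun x _ => hB x]
  simp only [hBr]

end Chain

/-! ### Point masses of the split initial law. -/

section InitialLaw

theorem tendsto_real_iInter {Ω : Type*} [MeasurableSpace Ω] {P : Measure Ω} [IsFiniteMeasure P]
    {A : ℕ → Set Ω} (hm : ∀ N, MeasurableSet (A N)) (hA : Antitone A) :
    Filter.Tendsto (fun N => P.real (A N)) Filter.atTop (nhds (P.real (⋂ N, A N))) :=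
  (ENNReal.tendsto_toReal (measure_ne_top _ _)).comp
    (tendsto_measure_iInter_atTop (fun N => (hm N).nullMeasurableSet) hA ⟨0, measure_ne_top _ _⟩)

variable {q : ℝ} {I n : ℕ} {μ : Measure (ℤ → Fin (I + 1))} {ν : Measure (ℤ → Fin 2)}

/-- A block pattern determines its number of particles, so one term of the sum survives. -/
theorem IsLambdaImage.cylinder_eq (h : IsLambdaImage q I μ ν) {a b : ℤ} (hab : a < b)
    (v : ℤ → Fin 2) :
    ν.real {η | ∀ x ∈ Set.Ico (a * I) (b * I), η x = v x} =
      μ.real {g | ∀ k ∈ Set.Ico a b, g k = collapse I v k} *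
        ∏ k ∈ Finset.Ico a b, lambdaMat' q I (collapse I v k)
          (fun r : Fin I => v (k * I + (r : ℕ))) := by
  rw [h.cylinder a b hab v, Fintype.sum_eq_single (fun k : Finset.Ico a b => collapse I v k)]
  · congr 1
    · congr 1
      ext g
      simp
    · exact Finset.prod_coe_sort (Finset.Ico a b) (fun k => lambdaMat' q I (collapse I v k)
          (fun r : Fin I => v (k * I + (r : ℕ))))
  · intro u hu
    obtain ⟨k, hk⟩ := Function.ne_iff.1 hu
    refine mul_eq_zero_of_right _ (Finset.prod_eq_zero (Finset.mem_univ k) ?_)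
    exact lambdaMat'_of_ne q fun e => hk (Fin.ext e.symm)

theorem lambdaMat'_zero {q : ℝ} (hq : 0 < q) : lambdaMat' q I 0 (fun _ => 0) = 1 := by
  have h := sum_lambdaMat' (I := I) hq 0
  rw [Fintype.sum_eq_single (fun _ => 0)] at h
  · exact h
  · intro w hw
    refine lambdaMat'_of_ne q fun e => hw ?_
    funext r
    exact Fin.ext ((Finset.sum_eq_zero_iff.1 e) r (Finset.mem_univ r))

theorem measurableSet_forall_eq {Z : Type*} [MeasurableSpace Z] [MeasurableSingletonClass Z] [Countable Z]
    (s : Set ℤ) (v : ℤ → Z) : MeasurableSet {η : ℤ → Z | ∀ x ∈ s, η x = v x} := by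
  simp only [Set.ofPred_forall]
  exact MeasurableSet.iInter fun x => MeasurableSet.iInter fun _ =>
    measurableSet_eq_fun (measurable_pi_apply x) measurable_const

theorem tendsto_real_window {Z : Type*} [MeasurableSpace Z] [MeasurableSingletonClass Z] [Countable Z]
    (ρ : Measure (ℤ → Z)) [IsFiniteMeasure ρ] (v : ℤ → Z) (a b : ℕ → ℤ)
    (ha : Antitone a) (hb : Monotone b) (hab : ∀ x, ∃ N, x ∈ Set.Ico (a N) (b N)) :
    Filter.Tendsto (fun N => ρ.real {η | ∀ x ∈ Set.Ico (a N) (b N), η x = v x}) Filter.atTop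
      (nhds (ρ.real {v})) := by
  have hI : ⋂ N, {η | ∀ x ∈ Set.Ico (a N) (b N), η x = v x} = {v} := by
    ext η
    simp only [Set.mem_iInter, Set.mem_ofPred_eq, Set.mem_singleton_iff]
    constructor
    · intro h
      funext x
      obtain ⟨N, hN⟩ := hab x
      exact h N x hN
    · rintro rfl N x _
      rfl
  rw [← hI]
  refine tendsto_real_iInter (fun N => measurableSet_forall_eq _ v) fun N M hNM η hη x hx => ?_
  exact hη x ⟨(ha hNM).trans hx.1, hx.2.trans_le (hb hNM)⟩

/-- The definition speaks of cylinders, while point masses are needed. The cylinders over growing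
windows decrease to the point on both sides, and the empty blocks added on the way contribute
factors `1`. -/
theorem IsLambdaImage.real_singleton (h : IsLambdaImage q I μ ν) [IsFiniteMeasure μ]
    (hq : 0 < q) (hI : 1 ≤ I) (a : ℤ) (ξ : Fin n → Fin I → Fin 2) :
    ν.real {occupation (blockList I n (a * I) ξ)} =
      μ.real {extendConfig a (blockSum ξ)} * lambdaProd q (blockSum ξ) ξ := by
  have := h.prob
  set v := occupation (blockList I n (a * I) ξ) with hv
  have hc : collapse I v = extendConfig a (blockSum ξ) := collapse_blockList hI a ξ
  let f : ℤ → ℝ := fun k => lambdaMat' q I (collapse I v k) (fun r : Fin I => v (k * I + (r : ℕ)))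
  have hprod : ∀ N : ℕ, ∏ k ∈ Finset.Ico (a - N - 1) (a + n + N + 1), f k =
      lambdaProd q (blockSum ξ) ξ := by
    intro N
    have hsub : Finset.Ico a (a + n) ⊆ Finset.Ico (a - N - 1) (a + n + N + 1) :=
      Finset.Ico_subset_Ico (by omega) (by omega)
    rw [← Finset.prod_subset hsub]
    · unfold lambdaProd
      symm
      refine Finset.prod_nbij (fun k : Fin n => a + (k : ℕ)) ?_ ?_ ?_ ?_
      · intro k _
        simp
      · intro k _ k' _ e
        exact Fin.ext (by simpa using e)
      · intro k hk
        simp only [Finset.coe_Ico, Set.mem_Ico] at hk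
        refine ⟨⟨(k - a).toNat, by omega⟩, by simp, ?_⟩
        simp only
        omega
      · intro k _
        simp only [f]
        rw [hc, extendConfig_add]
        congr 1
        funext r
        by_cases h1 : ξ k r = 1
        · rw [h1, eq_comm, hv, occupation_eq_one_iff, mem_blockList_iff, h1]
        · rw [fin_two_eq_zero h1, eq_comm]
          refine fin_two_eq_zero ?_
          rw [hv, Ne, occupation_eq_one_iff, mem_blockList_iff]
          exact h1
    · intro k _ hk
      have hk0 : collapse I v k = 0 := by
        rw [hc]
        simp only [Finset.mem_Ico, not_and_or, not_le, not_lt] at hk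
        rcases hk with hk | hk
        · exact extendConfig_of_lt a _ hk
        · exact extendConfig_of_ge a _ hk
      have hv0 : (fun r : Fin I => v (k * I + (r : ℕ))) = fun _ => 0 := by
        funext r
        refine fin_two_eq_zero fun h1 => ?_
        exact collapse_pos_of_mem r.isLt (occupation_eq_one_iff.1 h1) hk0
      simp only [f]
      rw [hk0, hv0]
      exact lambdaMat'_zero hq
  have hI' : (0 : ℤ) < I := by exact_mod_cast hI
  have t1 := tendsto_real_window ν v (fun N => (a - N - 1) * I) (fun N => (a + n + N + 1) * I)
    (fun N M hNM => mul_le_mul_of_nonneg_right (by omega) hI'.le)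
    (fun N M hNM => mul_le_mul_of_nonneg_right (by omega) hI'.le) (fun x => by
      refine ⟨x.natAbs + a.natAbs + n, ?_, ?_⟩
      · push_cast
        nlinarith [neg_abs_le x, le_abs_self a, abs_nonneg x]
      · push_cast
        nlinarith [le_abs_self x, neg_abs_le a, abs_nonneg x])
  have t2 := tendsto_real_window μ (extendConfig a (blockSum ξ)) (fun N => (a - N - 1))
    (fun N => (a + n + N + 1)) (fun N M hNM => by simp only; omega)
    (fun N M hNM => by simp only; omega) (fun x => ⟨x.natAbs + a.natAbs, by constructor <;> omega⟩)
  have e : ∀ N : ℕ, ν.real {η | ∀ x ∈ Set.Ico ((a - N - 1) * I : ℤ) ((a + n + N + 1) * I), η x = v x}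
      = μ.real {g | ∀ k ∈ Set.Ico (a - N - 1 : ℤ) (a + n + N + 1),
        g k = extendConfig a (blockSum ξ) k} * lambdaProd q (blockSum ξ) ξ := by
    intro N
    rw [h.cylinder_eq (by omega) v, ← hprod N, ← hc]
  simp only [e] at t1
  exact tendsto_nhds_unique t1 (t2.mul_const _)

end InitialLaw

/-! ### Composition of `J` unfused steps. -/

section FusedMass

variable {q α : ℝ} {I J n : ℕ}

/-- `rowKernel_fusion` removes the lowest row; the time evolution appends rows at the top.
Associativity of composition converts one into the other. -/
theorem rowKernel_fusion_right {r : ℕ} (hr : 1 ≤ r) (hα : Nondegenerate q α (I + r + 1))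
    (c d : Fin n → Fin (I + 1)) :
    ∑ e, rowKernel q α I r c e * rowKernel q (α * q ^ r) I 1 e d = rowKernel q α I (r + 1) c d := by
  induction r, hr using Nat.le_induction generalizing α c with
  | base => simpa using rowKernel_fusion hα c d
  | succ r hr ih =>
    have h1 : Nondegenerate q (α * q) (I + r + 1) := hα.shift
    simp only [← rowKernel_fusion (hα.mono (by omega : I + r + 1 ≤ I + (r + 1) + 1)),
      Finset.sum_mul]
    rw [Finset.sum_comm]
    simp only [mul_assoc, ← Finset.mul_sum]
    have e : α * q ^ (r + 1) = α * q * q ^ r := by ring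
    simp only [e, ih h1]
    exact rowKernel_fusion hα c d

/-- The masses of the fused configurations, constrained to be `c m` at time `J m`. -/
noncomputable def fusedMass (q α : ℝ) (I J : ℕ) {n : ℕ} (G : (Fin n → Fin (I + 1)) → ℝ)
    (c : ℕ → Fin n → Fin (I + 1)) : ℕ → (Fin n → Fin (I + 1)) → ℝ :=
  killedMass G (fun t => rowKernel q (α * q ^ (t % J)) I 1) (fun t e => J ∣ t → e = c (t / J))

/-- Strictly between multiples of `J` there is no constraint, so the one-line kernels compose freely
and start from the single configuration allowed at time `J m`. -/
theorem fusedMass_add (hα : Nondegenerate q α (I + J)) (hJ : 1 ≤ J)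
    (G : (Fin n → Fin (I + 1)) → ℝ) (c : ℕ → Fin n → Fin (I + 1)) (m : ℕ) {r : ℕ} (hr : 1 ≤ r)
    (hrJ : r ≤ J) (d : Fin n → Fin (I + 1)) :
    fusedMass q α I J G c (J * m + r) d =
      fusedMass q α I J G c (J * m) (c m) * rowKernel q α I r (c m) d := by
  induction r, hr using Nat.le_induction generalizing d with
  | base =>
    unfold fusedMass
    simp only [killedMass]
    rw [Fintype.sum_eq_single (c m)]
    · rw [if_pos (fun _ => by rw [Nat.mul_div_cancel_left _ hJ]), Nat.mul_mod_right]
      simp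
    · intro e he
      rw [if_neg, zero_mul]
      intro h
      apply he
      rw [h (dvd_mul_right _ _), Nat.mul_div_cancel_left _ hJ]
  | succ r hr ih =>
    have hmod : (J * m + r) % J = r := by
      rw [Nat.mul_add_mod, Nat.mod_eq_of_lt (by omega)]
    have hdvd : ¬ J ∣ J * m + r := by
      rw [Nat.dvd_iff_mod_eq_zero, hmod]; omega
    have ih' := fun e => ih (by omega) e
    unfold fusedMass at ih' ⊢
    rw [← add_assoc, killedMass]
    simp only [hdvd, false_imp_iff, if_true, ih', hmod, mul_assoc]
    rw [← Finset.mul_sum, rowKernel_fusion_right hr (hα.mono (by omega))]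

theorem fusedMass_mul_succ (hα : Nondegenerate q α (I + J)) (hJ : 1 ≤ J)
    (G : (Fin n → Fin (I + 1)) → ℝ) (c : ℕ → Fin n → Fin (I + 1)) (m : ℕ)
    (d : Fin n → Fin (I + 1)) :
    fusedMass q α I J G c (J * (m + 1)) d =
      fusedMass q α I J G c (J * m) (c m) * rowKernel q α I J (c m) d :=
  fusedMass_add hα hJ G c m hJ le_rfl d

end FusedMass

/-! ### Path probabilities of the collapsed model. -/

section CollapsedPath

variable {Ω : Type*} [MeasurableSpace Ω] {P : Measure Ω} {q α : ℝ}
  {I J n : ℕ} {χ j : ℕ → ℤ → Ω → ℕ} {p : ℕ → Ω → List ℤ} {μ : Measure (ℤ → Fin (I + 1))}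

theorem IsUnfusedSHS6V.measurableSet_pred (hp : IsUnfusedSHS6V P q α I J χ j p) (t : ℕ)
    (Q : List ℤ → Prop) : MeasurableSet {ω | Q (p t ω)} := by
  have : {ω | Q (p t ω)} = ⋃ l : {l // Q l}, {ω | p t ω = l} := by
    ext ω
    simp
  rw [this]
  exact MeasurableSet.iUnion fun l => hp.measurableSet_eq t l

theorem forall₂_le_lower {l l' : List ℤ} (h : List.Forall₂ (· ≤ ·) l l') {A : ℤ}
    (hA : ∀ y ∈ l, A ≤ y) : ∀ y ∈ l', A ≤ y := by
  induction h with
  | nil => simp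
  | cons hab _ ih =>
    simp only [List.mem_cons, forall_eq_or_imp] at hA ⊢
    exact ⟨hA.1.trans hab, ih hA.2⟩

theorem forall₂_le_upper {l l' : List ℤ} (h : List.Forall₂ (· ≤ ·) l l') {A : ℤ}
    (hA : ∀ y ∈ l', y < A) : ∀ y ∈ l, y < A := by
  induction h with
  | nil => simp
  | cons hab _ ih =>
    simp only [List.mem_cons, forall_eq_or_imp] at hA ⊢
    exact ⟨hab.trans_lt hA.1, ih hA.2⟩

theorem IsUnfusedSHS6V.real_zero [IsProbabilityMeasure P] (hp : IsUnfusedSHS6V P q α I J χ j p)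
    [IsFiniteMeasure μ] (hq : 0 < q) (hI : 1 ≤ I)
    (hp0 : IsLambdaImage q I μ (P.map fun ω => occupation (p 0 ω))) (a : ℤ)
    (ξ : Fin n → Fin I → Fin 2) :
    P.real {ω | p 0 ω = blockList I n (a * I) ξ} =
      μ.real {extendConfig a (blockSum ξ)} * lambdaProd q (blockSum ξ) ξ := by
  rw [← hp0.real_singleton hq hI a ξ, map_measureReal_apply hp.measurable_zero
    (measurableSet_singleton _)]
  congr 1
  ext ω
  exact ⟨fun h => congrArg occupation h,
    fun h => eq_of_occupation_eq (hp.sorted_zero ω) pairwise_blockList h⟩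

/-- The unfused masses equal the fused masses times `Λ'` by `killedMass_intertwining`. Summing over
all splittings of the final configuration removes `Λ'`, whose rows sum to one. -/
theorem IsUnfusedSHS6V.real_collapse_path [IsProbabilityMeasure P]
    (hp : IsUnfusedSHS6V P q α I J χ j p) [IsFiniteMeasure μ] (h : StochasticRange q α I J)
    (hI : 1 ≤ I) (hJ : 1 ≤ J) (hp0 : IsLambdaImage q I μ (P.map fun ω => occupation (p 0 ω)))
    (a : ℤ) (c : ℕ → Fin n → Fin (I + 1)) (m : ℕ) :
    P.real {ω | ∀ s ≤ m, collapse I (occupation (p (J * s) ω)) = extendConfig a (c s)} =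
      fusedMass q α I J (fun e => μ.real {extendConfig a e}) c (J * m) (c m) := by
  classical
  have hα := h.nondegenerate
  have hq := hα.q_pos
  let C : ℕ → List ℤ → Prop := fun s l =>
    J ∣ s → collapse I (occupation l) = extendConfig a (c (s / J))
  let κ : ℕ → (Fin n → Fin I → Fin 2) → (Fin n → Fin I → Fin 2) → ℝ := fun s ξ ξ' =>
    transfer n (fun _ w h w' h' => transfer I (siteWeight q (α * q ^ (s % J))) w w' h h') ξ ξ' 0 0
  have hsub : ∀ s, Nondegenerate q (α * q ^ (s % J)) (I + 1) := fun s =>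
    (hα.mono (by have := Nat.mod_lt s hJ; omega : I + 1 + s % J ≤ I + J)).shift_pow
  have hrange : ∀ {l : List ℤ}, l.Pairwise (· < ·) → (∀ y ∈ l, a * I ≤ y) →
      (∀ y ∈ l, y < (a + n) * I) → l ∈ Set.range (blockList I n (a * I)) :=
    fun hl h1 h2 => exists_blockList n a hl fun y hy => ⟨h1 y hy, h2 y hy⟩
  have hset : {ω | ∀ s ≤ m, collapse I (occupation (p (J * s) ω)) = extendConfig a (c s)} =
      {ω | ∀ s ≤ J * m, C s (p s ω)} := by
    ext ω
    constructor
    · rintro hω s hs ⟨r, rfl⟩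
      rw [Nat.mul_div_cancel_left _ hJ]
      exact hω r (le_of_mul_le_mul_left hs hJ)
    · intro hω s hs
      have := hω (J * s) (Nat.mul_le_mul_left _ hs) (dvd_mul_right _ _)
      rwa [Nat.mul_div_cancel_left _ hJ] at this
  rw [hset, real_constrained_path (blockList_injective a) (κ := κ) (C := C)
    (fun t s => hp.measurableSet_eq t s) (fun t => hp.measurableSet_pred t (C t))]
  · have hmass : ∀ ξ, killedMass (fun x => P.real {ω | p 0 ω = blockList I n (a * I) x}) κ
        (fun s x => C s (blockList I n (a * I) x)) (J * m) ξ =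
        ∑ e, fusedMass q α I J (fun e => μ.real {extendConfig a e}) c (J * m) e *
          lambdaProd q e ξ := by
      intro ξ
      refine killedMass_intertwining (lambdaProd q) blockSum (fun y x => lambdaProd_of_ne q)
        (fun t x => ?_) (fun x => ?_) (fun t y x' => ?_) _ ξ
      · simp only [C, collapse_blockList hI]
        exact forall_congr' fun _ => (extendConfig_injective a).eq_iff
      · rw [Fintype.sum_eq_single (blockSum x)]
        · exact hp.real_zero hq hI hp0 a x
        · intro e he
          rw [lambdaProd_of_ne q he, mul_zero]
      · exact rowKernel_intertwining (hsub t) y x'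
    have hterm : ∀ ξ, (if C (J * m) (blockList I n (a * I) ξ) then
        killedMass (fun x => P.real {ω | p 0 ω = blockList I n (a * I) x}) κ
        (fun s x => C s (blockList I n (a * I) x)) (J * m) ξ else 0) =
        fusedMass q α I J (fun e => μ.real {extendConfig a e}) c (J * m) (c m) *
          lambdaProd q (c m) ξ := by
      intro ξ
      have hC : C (J * m) (blockList I n (a * I) ξ) ↔ blockSum ξ = c m := by
        simp only [C, collapse_blockList hI, dvd_mul_right, true_imp_iff,
          Nat.mul_div_cancel_left _ hJ]
        exact (extendConfig_injective a).eq_iff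
      by_cases hb : blockSum ξ = c m
      · rw [if_pos (hC.2 hb), hmass, Fintype.sum_eq_single (c m)]
        intro e he
        rw [lambdaProd_of_ne q (hb ▸ he), mul_zero]
      · rw [if_neg (fun h' => hb (hC.1 h')), lambdaProd_of_ne q (Ne.symm hb), mul_zero]
    simp only [hterm]
    rw [← Finset.mul_sum, sum_lambdaProd hq, mul_one]
  · intro l T
    rw [hp.path_prob h hI hJ (fun s => blockList I n (a * I) (l s)) (fun s => pairwise_blockList)]
    congr 1
    refine Finset.prod_congr rfl fun s _ => ?_
    exact stepProb_blockList _ _ n (siteWeight q (α * q ^ (s % J))) _ _ a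
      fun b k hk => sixVertex_eq_siteWeight hα hJ s b k hk
  -- No return to the window from outside: the constraint at time `0` bounds all particles from
  -- below for ever, and the position at time `t + 1` bounds them from above at time `t`.
  · filter_upwards [hp.ae_jump_pos h hI hJ] with ω hω t hC ht
    have h0 : ∀ y ∈ p 0 ω, a * I ≤ y := fun y hy =>
      (bounds_of_collapse hI (hC 0 (Nat.zero_le _) (dvd_zero _)) y hy).1
    have hlow : ∀ s, ∀ y ∈ p s ω, a * I ≤ y := by
      intro s
      induction s with
      | zero => exact h0
      | succ s ih => exact forall₂_le_lower (hp.forall₂_le hω s) ih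
    obtain ⟨ξ, hξ⟩ := ht
    refine hrange (hp.sorted hω t) (hlow t) (forall₂_le_upper (hp.forall₂_le hω t) ?_)
    rw [← hξ]
    exact fun y hy => (mem_blockList_bounds y hy).2
  · filter_upwards [hp.ae_jump_pos h hI hJ] with ω hω hC
    have := bounds_of_collapse hI (hC (dvd_mul_right _ _))
    exact hrange (hp.sorted hω _) (fun y hy => (this y hy).1) fun y hy => (this y hy).2

end CollapsedPath

/-! ### Path probabilities of the SHS6V model. -/

section SHS

variable {q α : ℝ} {I J : ℕ}

theorem transfer_fusedWeight_conserved {n : ℕ} {c d : Fin n → Fin (I + 1)} {h h' : Fin (J + 1)}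
    (hne : transfer n (fun _ => fusedWeight q α I J) c d h h' ≠ 0) :
    ∑ k, (c k : ℕ) + h = ∑ k, (d k : ℕ) + h' := by
  induction n generalizing h with
  | zero =>
    simp only [transfer, ne_eq, ite_eq_right_iff, one_ne_zero, imp_false, not_not] at hne
    simp [hne]
  | succ n ih =>
    simp only [transfer] at hne
    obtain ⟨k, _, hk⟩ := Finset.exists_ne_zero_of_sum_ne_zero hne
    have h1 := ih (right_ne_zero_of_mul hk)
    have h2 : (c 0 : ℕ) + h = d 0 + k := by
      by_contra h2
      exact left_ne_zero_of_mul hk (vertexWeight_of_ne q α I J h2)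
    rw [Fin.sum_univ_succ, Fin.sum_univ_succ]
    simp only [Fin.tail] at h1
    omega

theorem rowWeight_add (q α : ℝ) (c d : ℤ → Fin (I + 1)) (n m : ℕ) (h : Fin (J + 1)) (x : ℤ) :
    rowWeight q α I J c d (n + m) h x = ∑ h', transfer n (fun _ => fusedWeight q α I J)
      (fun k : Fin n => c (x + (k : ℕ))) (fun k : Fin n => d (x + (k : ℕ))) h h' *
        rowWeight q α I J c d m h' (x + n) := by
  induction n generalizing h x with
  | zero => simp [transfer]
  | succ n ih =>
    have e : n + 1 + m = (n + m) + 1 := by ring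
    rw [e, rowWeight]
    simp only [ih, Finset.mul_sum, transfer, Finset.sum_mul]
    rw [Finset.sum_comm]
    refine Finset.sum_congr rfl fun h' _ => Finset.sum_congr rfl fun k _ => ?_
    have e1 : (x + 1 + n : ℤ) = x + ((n + 1 : ℕ) : ℤ) := by push_cast; ring
    have e2 : ∀ f : ℤ → Fin (I + 1), (fun k : Fin n => f (x + 1 + (k : ℕ))) =
        Fin.tail fun k : Fin (n + 1) => f (x + (k : ℕ)) := by
      intro f
      funext k
      simp only [Fin.tail, Fin.val_succ]
      congr 1
      push_cast; ring
    rw [e1, e2 c, e2 d, mul_assoc]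
    simp [fusedWeight]

theorem rowWeight_empty (q α : ℝ) (c d : ℤ → Fin (I + 1)) (m : ℕ) (x : ℤ)
    (hc : ∀ y, x ≤ y → c y = 0) (hd : ∀ y, x ≤ y → d y = 0) :
    rowWeight q α I J c d m 0 x = 1 := by
  induction m generalizing x with
  | zero => rfl
  | succ m ih =>
    rw [rowWeight, Fintype.sum_eq_single 0]
    · rw [ih (x + 1) (fun y hy => hc y (by omega)) (fun y hy => hd y (by omega)), hc x le_rfl,
        hd x le_rfl, mul_one]
      rw [vertexWeight_eq _ _ _ _ (by simp)]
      have h0 : ∀ b : ℝ, qPoch b q 0 = 1 := fun b => by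
        change ∏ k ∈ Finset.range 0, (1 - b * q ^ k) = 1
        simp
      simp [vertexPref, vertexPhi, regPhi, h0]
    · intro k hk
      rw [vertexWeight_of_ne, zero_mul]
      rw [hc x le_rfl, hd x le_rfl]
      intro e
      exact hk (Fin.ext (by simpa using e.symm))

/-- A nonzero kernel means that `c` and `d` have equally many particles, so no line leaves the
window on the right, and the empty sites beyond it have weight `1`. -/
theorem rowWeight_extendConfig {n : ℕ} (a : ℤ) {c d : Fin n → Fin (I + 1)}
    (hK : rowKernel q α I J c d ≠ 0) (m : ℕ) :
    rowWeight q α I J (extendConfig a c) (extendConfig a d) (n + m) 0 a =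
      rowKernel q α I J c d := by
  rw [rowWeight_add]
  simp only [extendConfig_add]
  rw [Fintype.sum_eq_single 0]
  · rw [rowWeight_empty q α _ _ m _ (fun y hy => extendConfig_of_ge a c hy)
      (fun y hy => extendConfig_of_ge a d hy), mul_one, rowKernel]
  · intro k hk
    by_contra hne
    have h1 := transfer_fusedWeight_conserved (left_ne_zero_of_mul hne)
    have h2 := transfer_fusedWeight_conserved hK
    exact hk (Fin.ext (by simp only [Fin.val_zero] at h1 h2 ⊢; omega))

variable {Ω : Type*} [MeasurableSpace Ω] {P : Measure Ω} {g : ℕ → Ω → ℤ → Fin (I + 1)} {n : ℕ}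

theorem IsSHS6V.real_path_succ [IsProbabilityMeasure P] (hg : IsSHS6V P q α I J g) (a : ℤ)
    (c : ℕ → Fin n → Fin (I + 1)) (m : ℕ) (hK : rowKernel q α I J (c m) (c (m + 1)) ≠ 0) :
    P.real {ω | ∀ s ≤ m + 1, g s ω = extendConfig a (c s)} =
      P.real {ω | ∀ s ≤ m, g s ω = extendConfig a (c s)} *
        rowKernel q α I J (c m) (c (m + 1)) := by
  let A : ℕ → Set Ω := fun N => {ω | (∀ s ≤ m, g s ω = extendConfig a (c s)) ∧
    ∀ x < a + (n + N : ℕ), g (m + 1) ω x = extendConfig a (c (m + 1)) x}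
  have hA : ∀ N, P.real (A N) = P.real {ω | ∀ s ≤ m, g s ω = extendConfig a (c s)} *
      rowKernel q α I J (c m) (c (m + 1)) := by
    intro N
    rw [← rowWeight_extendConfig a hK N]
    refine hg.update m (fun s => extendConfig a (c s)) _ a (n + N) ?_
      (fun x hx => extendConfig_of_lt a _ hx) (fun x hx => extendConfig_of_lt a _ hx)
    refine (Set.finite_Ico a (a + n)).subset fun x hx => ⟨?_, ?_⟩
    · by_contra hlt
      exact hx (extendConfig_of_lt a _ (by omega))
    · by_contra hlt
      exact hx (extendConfig_of_ge a _ (by omega))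
  have hm : ∀ N, MeasurableSet (A N) := by
    intro N
    simp only [A, Set.ofPred_and, Set.ofPred_forall]
    refine (MeasurableSet.iInter fun s => MeasurableSet.iInter fun _ =>
      hg.measurable s (measurableSet_singleton _)).inter (MeasurableSet.iInter fun x =>
      MeasurableSet.iInter fun _ => ?_)
    exact measurableSet_eq_fun ((measurable_pi_apply x).comp (hg.measurable (m + 1)))
      measurable_const
  have hanti : Antitone A := fun N M hNM ω hω => ⟨hω.1, fun x hx => hω.2 x (by push_cast at *; omega)⟩
  have hInter : ⋂ N, A N = {ω | ∀ s ≤ m + 1, g s ω = extendConfig a (c s)} := by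
    ext ω
    simp only [Set.mem_iInter, Set.mem_ofPred_eq, A]
    constructor
    · intro hω s hs
      rcases Nat.le_succ_iff.1 hs with hs | rfl
      · exact (hω 0).1 s hs
      · funext x
        exact (hω (x - a + 1).toNat).2 x (by omega)
    · exact fun hω N => ⟨fun s hs => hω s (by omega), fun x _ => by rw [hω (m + 1) le_rfl]⟩
  have ht := tendsto_real_iInter (P := P) hm hanti
  simp only [hA, hInter] at ht
  exact tendsto_nhds_unique ht tendsto_const_nhds

/-- Nonvanishing is assumed so that every kernel factor along the path is nonzero and
`IsSHS6V.real_path_succ` applies. An equality on paths of positive mass is enough for the final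
comparison. -/
theorem IsSHS6V.real_path_eq [IsProbabilityMeasure P] (hg : IsSHS6V P q α I J g)
    (hα : Nondegenerate q α (I + J)) (hJ : 1 ≤ J) (a : ℤ) (c : ℕ → Fin n → Fin (I + 1)) (m : ℕ)
    (hne : fusedMass q α I J (fun e => (P.map (g 0)).real {extendConfig a e}) c (J * m) (c m) ≠ 0) :
    P.real {ω | ∀ s ≤ m, g s ω = extendConfig a (c s)} =
      fusedMass q α I J (fun e => (P.map (g 0)).real {extendConfig a e}) c (J * m) (c m) := by
  induction m with
  | zero =>
    simp only [fusedMass, mul_zero, killedMass]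
    rw [map_measureReal_apply (hg.measurable 0) (measurableSet_singleton _)]
    congr 1
    ext ω
    simp
  | succ m ih =>
    rw [fusedMass_mul_succ hα hJ] at hne ⊢
    rw [hg.real_path_succ a c m (right_ne_zero_of_mul hne), ih (left_ne_zero_of_mul hne)]

end SHS

/-! ### Comparison of the two laws. -/

section Law

/-- Countable additivity turns domination on atoms into `σ ≤ ρ`, and equal total masses turn this
into equality. -/
theorem measure_eq_of_singleton_le {W : Type*} [MeasurableSpace W] [MeasurableSingletonClass W]
    {ρ σ : Measure W} [IsProbabilityMeasure ρ] [IsProbabilityMeasure σ] {S : Set W}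
    (hS : S.Countable) (hσ : σ Sᶜ = 0) (h : ∀ w ∈ S, σ {w} ≤ ρ {w}) : ρ = σ := by
  have hle : σ ≤ ρ := by
    refine Measure.le_iff.2 fun A _ => ?_
    have hc : (A ∩ S).Countable := hS.mono Set.inter_subset_right
    have hsum : ∀ τ : Measure W, τ (A ∩ S) = ∑' w : (A ∩ S : Set W), τ {(w : W)} := by
      intro τ
      rw [← measure_biUnion hc (fun x _ y _ hxy => by simpa using hxy)
        fun w _ => measurableSet_singleton w, Set.biUnion_of_singleton]
    calc σ A ≤ σ (A ∩ S) + σ Sᶜ := (measure_mono (fun x hx => by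
            by_cases hxS : x ∈ S
            · exact Or.inl ⟨hx, hxS⟩
            · exact Or.inr hxS)).trans (measure_union_le _ _)
      _ = σ (A ∩ S) := by rw [hσ, add_zero]
      _ ≤ ρ (A ∩ S) := by
        rw [hsum, hsum]
        exact ENNReal.tsum_le_tsum fun w => h w w.2.2
      _ ≤ ρ A := measure_mono Set.inter_subset_left
  exact (Measure.eq_of_le_of_isProbabilityMeasure hle).symm

variable {I : ℕ}

theorem collapse_eq_extendConfig {l : List ℤ} {M : ℕ} (hl : ∀ y ∈ l, -(M : ℤ) ≤ y ∧ y ≤ M) :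
    ∃ c : Fin (2 * M + 1) → Fin (I + 1),
      collapse I (occupation l) = extendConfig (-(M : ℤ)) c := by
  refine ⟨fun k => collapse I (occupation l) (-(M : ℤ) + (k : ℕ)),
    extendConfig_ext _ (fun _ => rfl) fun k hk => ?_⟩
  apply Fin.ext
  change ∑ r : Fin I, (occupation _ (k * I + (r : ℕ)) : ℕ) = 0
  refine Finset.sum_eq_zero fun r _ => ?_
  have h0 : occupation l (k * I + (r : ℕ)) = 0 := by
    refine fin_two_eq_zero fun h => ?_
    obtain ⟨h1, h2⟩ := hl _ (occupation_eq_one_iff.1 h)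
    have hr : ((r : ℕ) : ℤ) < I := by exact_mod_cast r.isLt
    have hI : (1 : ℤ) ≤ I := by omega
    push_cast at hk
    rcases hk with hk | hk
    · nlinarith
    · nlinarith
  rw [h0]
  rfl

/-- The finite paths of configurations that vanish outside of a common finite window. -/
def windowPaths (I T : ℕ) : Set (Finset.Iic T → ℤ → Fin (I + 1)) :=
  ⋃ (a : ℤ) (n : ℕ), Set.range fun (c : Finset.Iic T → Fin n → Fin (I + 1)) s =>
    extendConfig a (c s)

theorem countable_windowPaths (I T : ℕ) : (windowPaths I T).Countable :=
  Set.countable_iUnion fun _ => Set.countable_iUnion fun _ => Set.countable_range _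

theorem collapse_mem_windowPaths (T : ℕ) (l : ℕ → List ℤ) :
    (fun s : Finset.Iic T => collapse I (occupation (l s))) ∈ windowPaths I T := by
  obtain ⟨M, hM⟩ : ∃ M : ℕ, ∀ s ≤ T, ∀ y ∈ l s, -(M : ℤ) ≤ y ∧ y ≤ M := by
    refine ⟨(Finset.Iic T).sup fun s => (l s).toFinset.sup Int.natAbs, fun s hs y hy => ?_⟩
    have h1 : y.natAbs ≤ (l s).toFinset.sup Int.natAbs :=
      Finset.le_sup (f := Int.natAbs) (List.mem_toFinset.2 hy)
    have h2 := h1.trans (Finset.le_sup (f := fun s => (l s).toFinset.sup Int.natAbs)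
      (Finset.mem_Iic.2 hs))
    omega
  have h := fun s : Finset.Iic T =>
    collapse_eq_extendConfig (I := I) (hM s (Finset.mem_Iic.1 s.2))
  choose c hc using h
  simp only [windowPaths, Set.mem_iUnion]
  exact ⟨-(M : ℤ), 2 * M + 1, c, funext fun s => (hc s).symm⟩

end Law

/-! ### Equality of the laws of the two processes. -/

theorem mainTheorem6 {Ω Ω' : Type*} [MeasurableSpace Ω] [MeasurableSpace Ω']
    (P : Measure Ω) [IsProbabilityMeasure P] (P' : Measure Ω') [IsProbabilityMeasure P']
    (I J : ℕ) (hI : 1 ≤ I) (hJ : 1 ≤ J) (q α : ℝ) (hqα : StochasticRange q α I J)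
    (μ : Measure (ℤ → Fin (I + 1)))
    (g : ℕ → Ω → ℤ → Fin (I + 1)) (hg : IsSHS6V P q α I J g) (hg0 : P.map (g 0) = μ)
    (χ j : ℕ → ℤ → Ω' → ℕ) (p : ℕ → Ω' → List ℤ)
    (hp : IsUnfusedSHS6V P' q α I J χ j p)
    (hp0 : IsLambdaImage q I μ (P'.map fun ω => occupation (p 0 ω))) :
    IdentDistrib (fun ω t => g t ω)
      (fun ω t => collapse I (occupation (p (J * t) ω))) P P' := by
  subst hg0
  have hX : Measurable fun ω t => g t ω := measurable_pi_lambda _ hg.measurable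
  have hY : Measurable fun ω t => collapse I (occupation (p (J * t) ω)) := by
    refine measurable_pi_lambda _ fun t => measurable_pi_lambda _ fun k => ?_
    refine measurable_to_countable' fun v => ?_
    exact hp.measurableSet_pred (J * t) fun l => collapse I (occupation l) k = v
  have : IsProbabilityMeasure (P.map (g 0)) :=
    Measure.isProbabilityMeasure_map (hg.measurable 0).aemeasurable
  have hX' : ∀ S : Finset ℕ, Measurable fun ω => S.restrict fun t => g t ω := fun S =>
    (Finset.measurable_restrict S).comp hX
  have hY' : ∀ S : Finset ℕ, Measurable fun ω =>
      S.restrict fun t => collapse I (occupation (p (J * t) ω)) := fun S =>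
    (Finset.measurable_restrict S).comp hY
  have hinit : ∀ T : ℕ, P.map (fun ω => (Finset.Iic T).restrict (fun t => g t ω)) =
      P'.map (fun ω => (Finset.Iic T).restrict
        fun t => collapse I (occupation (p (J * t) ω))) := by
    intro T
    have := Measure.isProbabilityMeasure_map (μ := P) (hX' (Finset.Iic T)).aemeasurable
    have := Measure.isProbabilityMeasure_map (μ := P') (hY' (Finset.Iic T)).aemeasurable
    -- The collapsed model plays the part of `σ`: its configurations come from finite lists, so each
    -- finite path lies in a common window. No such support property is needed for the SHS6V model.
    refine measure_eq_of_singleton_le (countable_windowPaths I T)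
      ?_ fun w hw => ?_
    · refine (Measure.map_apply (hY' _) (countable_windowPaths I T).measurableSet.compl).trans ?_
      convert measure_empty (μ := P')
      ext ω
      simp only [Set.mem_preimage, Set.mem_compl_iff, Set.mem_empty_iff_false, iff_false, not_not]
      exact collapse_mem_windowPaths T fun s => p (J * s) ω
    · simp only [windowPaths, Set.mem_iUnion] at hw
      obtain ⟨a, n, c₀, rfl⟩ := hw
      let c : ℕ → Fin n → Fin (I + 1) := fun s =>
        if hs : s ∈ Finset.Iic T then c₀ ⟨s, hs⟩ else 0
      have hc : ∀ s : Finset.Iic T, c s = c₀ s := fun s => dif_pos s.2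
      have e1 : ∀ f : ℕ → ℤ → Fin (I + 1), (Finset.Iic T).restrict f =
          (fun s => extendConfig a (c₀ s)) ↔ ∀ s ≤ T, f s = extendConfig a (c s) := by
        intro f
        constructor
        · intro hf s hs
          have := congrFun hf ⟨s, Finset.mem_Iic.2 hs⟩
          rw [← hc] at this
          exact this
        · intro hf
          funext s
          rw [← hc]
          exact hf s (Finset.mem_Iic.1 s.2)
      have e2 := hp.real_collapse_path hqα hI hJ hp0 a c T
      have e3 := hg.real_path_eq hqα.nondegenerate hJ a c T
      rw [← e2] at e3
      have e4 : P' {ω | ∀ s ≤ T, collapse I (occupation (p (J * s) ω)) = extendConfig a (c s)} ≤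
          P {ω | ∀ s ≤ T, g s ω = extendConfig a (c s)} := by
        by_cases h0 : P'.real {ω | ∀ s ≤ T,
          collapse I (occupation (p (J * s) ω)) = extendConfig a (c s)} = 0
        · rw [(measureReal_eq_zero_iff).1 h0]
          exact zero_le
        · exact ((measureReal_eq_measureReal_iff).1 (e3 h0)).ge
      rw [Measure.map_apply (hX' _) (measurableSet_singleton _),
        Measure.map_apply (hY' _) (measurableSet_singleton _)]
      convert e4 using 2
      · ext ω
        exact e1 _
      · ext ω
        exact e1 _
  refine ⟨hX.aemeasurable, hY.aemeasurable, ?_⟩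
  -- A law on path space is determined by its finite-dimensional marginals, and each of these is a
  -- marginal of an initial segment of times.
  refine IsProjectiveLimit.unique
    (P := fun S : Finset ℕ => P.map (fun ω => S.restrict (fun t => g t ω)))
    (isProjectiveLimit_map (X := g) hX.aemeasurable) fun S => ?_
  have hsub : S ⊆ Finset.Iic (S.sup id) := fun s hs => Finset.mem_Iic.2 (Finset.le_sup (f := id) hs)
  have hr : Measurable (Finset.restrict₂ (π := fun _ => ℤ → Fin (I + 1)) hsub) :=
    Finset.measurable_restrict₂ hsub
  have h2 := congrArg (Measure.map (Finset.restrict₂ (π := fun _ => ℤ → Fin (I + 1)) hsub))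
    (hinit (S.sup id))
  rw [Measure.map_map hr (hX' _), Measure.map_map hr (hY' _)] at h2
  rw [Measure.map_map (Finset.measurable_restrict _) hY]
  exact h2.symm
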